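/- Let $p,q:\mathbb{R}\to\mathbb{C}$ be $\pi$-periodic functions that are of bounded variation on $[0,\pi]$, let $$Q=\begin{pmatrix}p&q\\ q&-p\end{pmatrix},\qquad J=\begin{pmatrix}0&1\\-1&0\end{pmatrix},\qquad l(\mathbf y)=J\mathbf y'+Q\mathbf y .$$ Let $L(Q)$ be the operator generated by $l$ in $L_2(\mathbb{R};\mathbb{C}^2)$ with its maximal domain (locally absolutely continuous $\mathbf y\in L_2$ with $l(\mathbf y)\in L_2$), and, for real $t$, let $L_t(Q)$ be the operator generated by $l$ in $L_2([0,\pi];\mathbb{C}^2)$ on the absolutely continuous $\mathbf y$ with $l(\mathbf y)\in L_2$ and $\mathbf y(\pi)=e^{i\pi t}\mathbf y(0)$. The eigenvalues of the operators $L_t(Q)$, $t\in(-1,1]$, are called Bloch eigenvalues. Eigenvalues are counted with algebraic multiplicity; an eigenvalue is multiple if its multiplicity is at least $2$. A point $\lambda\in\sigma(L(Q))$ is a *spectral singularity* of $L(Q)$ if for every $\varepsilon>0$ there is a sequence of simple closed, positively oriented, piecewise $C^1$ contours $\gamma_n\subset\{z\in\mathbb{C}:|z-\lambda|<\varepsilon\}$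 such that, for each $n$ and every $t\in(-1,1]$, $\gamma_n$ encloses at most one eigenvalue (counting multiplicity) of $L_t(Q)$, and $$\lim_{n\to\infty}\ \sup_t\Big\|\int_{\gamma_n}(L_t(Q)-zI)^{-1}\,dz\Big\|=\infty ,$$ where the supremum is over all $t\in(-1,1]$ for which $\gamma_n$ lies in the resolvent set of $L_t(Q)$. A point $\lambda_0\in\mathbb{C}$ is an *essential spectral singularity* (ESS) of $L(Q)$ if there are $t_0\in(-1,1]$ and a continuous branch $\lambda(t)$ of eigenvalues of $L_t(Q)$, defined for $t$ in a real neighbourhood of $t_0$, with $\lambda(t_0)=\lambda_0$, such that $1/|\alpha|$ is not integrable on $(t_0-\varepsilon,t_0+\varepsilon)$ for any $\varepsilon>0$. Here $\alpha(t)=(\Psi_t,\Psi_t^*)$, where $\Psi_t$ and $\Psi_t^*$ are eigenfunctions of norm $1$ of $L_t(Q)$ and of its adjoint $L_t(Q)^*$ for the eigenvalues $\lambda(t)$ and $\overline{\lambda(t)}$, respectively. Then: 1. every spectral singularity of $L(Q)$ is a multiple Bloch eigenvalue, that is, a multiple eigenvalue of $L_t(Q)$ for some $t\in(-1,1]$;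 2. every ESS of $L(Q)$ is a spectral singularity of $L(Q)$; 3. every ESS of $L(Q)$ is a multiple eigenvalue of $L_0(Q)$ or of $L_1(Q)$. -/

import Mathlib

open MeasureTheory Set Filter Topology
open scoped ENNReal

noncomputable section

/-! ### Closed linear operators through their graphs

An unbounded operator `T` in a Hilbert space `H` is represented by its graph
`{(f, T f) | f ∈ D(T)}`, a linear subspace of `H × H`. -/

section Operators

variable {H : Type*} [NormedAddCommGroup H] [InnerProductSpace ℂ H]

/-- `R` is the (bounded, everywhere defined) inverse of `T - z`. -/
def IsResolventAt (T : Submodule ℂ (H × H)) (z : ℂ) (R : H →L[ℂ] H) : Prop :=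
  ∀ f g : H, R g = f ↔ (f, g + z • f) ∈ T

/-- The resolvent set of `T`. -/
def opResolventSet (T : Submodule ℂ (H × H)) : Set ℂ :=
  {z | ∃ R : H →L[ℂ] H, IsResolventAt T z R}

/-- The spectrum of `T`. -/
def opSpectrum (T : Submodule ℂ (H × H)) : Set ℂ := (opResolventSet T)ᶜ

open Classical in
/-- The resolvent `(T - z)⁻¹` for `z` in the resolvent set (and `0` elsewhere). -/
def opResolvent (T : Submodule ℂ (H × H)) (z : ℂ) : H →L[ℂ] H :=
  if h : ∃ R : H →L[ℂ] H, IsResolventAt T z R then h.choose else 0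

/-- `f` is an eigenvector of `T` with eigenvalue `z`. -/
def IsEigenvector (T : Submodule ℂ (H × H)) (z : ℂ) (f : H) : Prop :=
  f ≠ 0 ∧ (f, z • f) ∈ T

/-- `z` is an eigenvalue of `T`. -/
def IsEigenvalue (T : Submodule ℂ (H × H)) (z : ℂ) : Prop :=
  ∃ f : H, IsEigenvector T z f

/-- `ker (T - z)^k`: the vectors `f` with `(T - z)^k f = 0`. -/
def rootKer (T : Submodule ℂ (H × H)) (z : ℂ) : ℕ → Submodule ℂ H
  | 0 => ⊥
  | k + 1 =>
    { carrier := {f | ∃ g ∈ rootKer T z k, (f, z • f + g) ∈ T}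
      zero_mem' := ⟨0, Submodule.zero_mem _, by rw [smul_zero, add_zero]; exact T.zero_mem⟩
      add_mem' := by
        rintro f₁ f₂ ⟨g₁, hg₁, h₁⟩ ⟨g₂, hg₂, h₂⟩
        refine ⟨g₁ + g₂, Submodule.add_mem _ hg₁ hg₂, ?_⟩
        have h := Submodule.add_mem _ h₁ h₂
        rw [Prod.mk_add_mk] at h
        rwa [smul_add, add_add_add_comm]
      smul_mem' := by
        rintro c f ⟨g, hg, h⟩
        refine ⟨c • g, Submodule.smul_mem _ c hg, ?_⟩
        have h' := Submodule.smul_mem _ c h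
        rw [Prod.smul_mk] at h'
        rwa [smul_comm z c f, ← smul_add] }

/-- The algebraic multiplicity of `z` as an eigenvalue of `T`: the dimension of the space of all
root vectors (eigenvectors and associated vectors); it is `0` if `z` is not an eigenvalue. -/
def algMultiplicity (T : Submodule ℂ (H × H)) (z : ℂ) : ℕ∞ :=
  Cardinal.toENat (Module.rank ℂ ↥(⨆ k, rootKer T z k))

/-- `z` is a multiple eigenvalue of `T`. -/
def IsMultipleEigenvalue (T : Submodule ℂ (H × H)) (z : ℂ) : Prop :=
  IsEigenvalue T z ∧ 2 ≤ algMultiplicity T z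

end Operators

/-! ### The Dirac operators -/

/-- The value `J v + Q(x) y` of the differential expression at `x`, where `y` and `v` are the
values of the function and of its derivative at `x`. -/
def diracExpr (p q : ℝ → ℂ) (x : ℝ) (y v : EuclideanSpace ℂ (Fin 2)) :
    EuclideanSpace ℂ (Fin 2) :=
  WithLp.toLp 2 (Matrix.mulVec !![0, 1; -1, 0] v.ofLp + Matrix.mulVec !![p x, q x; q x, -p x] y.ofLp)

theorem diracExpr_zero (p q : ℝ → ℂ) (x : ℝ) : diracExpr p q x 0 0 = 0 := by
  simp [diracExpr]

theorem diracExpr_add (p q : ℝ → ℂ) (x : ℝ) (y₁ v₁ y₂ v₂ : EuclideanSpace ℂ (Fin 2)) :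
    diracExpr p q x (y₁ + y₂) (v₁ + v₂) = diracExpr p q x y₁ v₁ + diracExpr p q x y₂ v₂ := by
  simp only [diracExpr, WithLp.ofLp_add, Matrix.mulVec_add, ← WithLp.toLp_add]
  congr 1
  abel

theorem diracExpr_smul (p q : ℝ → ℂ) (x : ℝ) (c : ℂ) (y v : EuclideanSpace ℂ (Fin 2)) :
    diracExpr p q x (c • y) (c • v) = c • diracExpr p q x y v := by
  simp only [diracExpr, WithLp.ofLp_smul, Matrix.mulVec_smul, ← WithLp.toLp_smul, smul_add]

/-- The space `L₂²[0, π]`. -/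
abbrev L2Period : Type :=
  Lp (EuclideanSpace ℂ (Fin 2)) 2 (volume.restrict (Icc (0 : ℝ) Real.pi))

/-- The space `L₂²(-∞, ∞)`. -/
abbrev L2Line : Type := Lp (EuclideanSpace ℂ (Fin 2)) 2 (volume : Measure ℝ)

/-- The operator `L_t(Q)` in `L₂²[0, π]` (its graph): the domain consists of the absolutely
continuous functions `y` (with almost everywhere derivative `v`) such that `J y' + Q y` is in
`L₂²[0, π]` and `y(π) = exp(iπt) y(0)`. -/
def blochOp (p q : ℝ → ℂ) (t : ℝ) : Submodule ℂ (L2Period × L2Period) where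
  carrier := {u | ∃ y v : ℝ → EuclideanSpace ℂ (Fin 2),
    IntervalIntegrable v volume 0 Real.pi ∧
    (∀ x ∈ Icc 0 Real.pi, y x = y 0 + ∫ s in (0 : ℝ)..x, v s) ∧
    y Real.pi = Complex.exp (Complex.I * Real.pi * t) • y 0 ∧
    u.1 =ᵐ[volume.restrict (Icc (0 : ℝ) Real.pi)] y ∧
    u.2 =ᵐ[volume.restrict (Icc (0 : ℝ) Real.pi)] fun x => diracExpr p q x (y x) (v x)}
  zero_mem' := by
    refine ⟨0, 0, ?_, ?_, ?_, ?_, ?_⟩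
    · exact intervalIntegrable_const (c := (0 : EuclideanSpace ℂ (Fin 2)))
    · intro x _; simp
    · simp
    · exact Lp.coeFn_zero _ _ _
    · filter_upwards [Lp.coeFn_zero (EuclideanSpace ℂ (Fin 2)) 2
        (volume.restrict (Icc (0 : ℝ) Real.pi))] with x hx
      simpa [diracExpr_zero] using hx
  add_mem' := by
    rintro a b ⟨y₁, v₁, hi₁, hy₁, hb₁, ha₁, hc₁⟩ ⟨y₂, v₂, hi₂, hy₂, hb₂, ha₂, hc₂⟩
    refine ⟨y₁ + y₂, v₁ + v₂, hi₁.add hi₂, ?_, ?_, ?_, ?_⟩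
    · intro x hx
      have hsub : uIcc 0 x ⊆ uIcc 0 Real.pi := by
        rw [uIcc_of_le hx.1, uIcc_of_le Real.pi_pos.le]
        exact Icc_subset_Icc_right hx.2
      have h := intervalIntegral.integral_add (hi₁.mono_set hsub) (hi₂.mono_set hsub)
      simp only [Pi.add_apply]
      rw [h, hy₁ x hx, hy₂ x hx]
      abel
    · simp only [Pi.add_apply, hb₁, hb₂, smul_add]
    · filter_upwards [Lp.coeFn_add a.1 b.1, ha₁, ha₂] with x h h₁ h₂
      rw [Prod.fst_add, h, Pi.add_apply, Pi.add_apply, h₁, h₂]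
    · filter_upwards [Lp.coeFn_add a.2 b.2, hc₁, hc₂] with x h h₁ h₂
      rw [Prod.snd_add, h, Pi.add_apply, h₁, h₂, Pi.add_apply, Pi.add_apply, diracExpr_add]
  smul_mem' := by
    rintro c a ⟨y, v, hi, hy, hb, ha, hc⟩
    refine ⟨c • y, c • v, hi.smul c, ?_, ?_, ?_, ?_⟩
    · intro x hx
      simp only [Pi.smul_apply]
      rw [intervalIntegral.integral_smul, hy x hx, smul_add]
    · simp only [Pi.smul_apply, hb]
      rw [smul_comm]
    · filter_upwards [Lp.coeFn_smul c a.1, ha] with x h h₁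
      rw [Prod.smul_fst, h, Pi.smul_apply, Pi.smul_apply, h₁]
    · filter_upwards [Lp.coeFn_smul c a.2, hc] with x h h₁
      rw [Prod.smul_snd, h, Pi.smul_apply, h₁, Pi.smul_apply, Pi.smul_apply, diracExpr_smul]

/-- The operator `L(Q)` in `L₂²(-∞, ∞)` (its graph): the domain consists of the locally absolutely
continuous functions `y` (with almost everywhere derivative `v`) such that `y` and `J y' + Q y`
are in `L₂²(-∞, ∞)`. -/
def diracOp (p q : ℝ → ℂ) : Submodule ℂ (L2Line × L2Line) where
  carrier := {u | ∃ y v : ℝ → EuclideanSpace ℂ (Fin 2),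
    LocallyIntegrable v volume ∧
    (∀ x : ℝ, y x = y 0 + ∫ s in (0 : ℝ)..x, v s) ∧
    u.1 =ᵐ[volume] y ∧
    u.2 =ᵐ[volume] fun x => diracExpr p q x (y x) (v x)}
  zero_mem' := by
    refine ⟨0, 0, locallyIntegrable_zero, ?_, ?_, ?_⟩
    · intro x; simp
    · exact Lp.coeFn_zero _ _ _
    · filter_upwards [Lp.coeFn_zero (EuclideanSpace ℂ (Fin 2)) 2
        (volume : Measure ℝ)] with x hx
      simpa only [Prod.snd_zero, Pi.zero_apply, diracExpr_zero] using hx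
  add_mem' := by
    rintro a b ⟨y₁, v₁, hi₁, hy₁, ha₁, hc₁⟩ ⟨y₂, v₂, hi₂, hy₂, ha₂, hc₂⟩
    refine ⟨y₁ + y₂, v₁ + v₂, hi₁.add hi₂, ?_, ?_, ?_⟩
    · intro x
      have h := intervalIntegral.integral_add ((hi₁.integrableOn_isCompact isCompact_uIcc).intervalIntegrable (a := 0) (b := x))
        ((hi₂.integrableOn_isCompact isCompact_uIcc).intervalIntegrable (a := 0) (b := x))
      simp only [Pi.add_apply]
      rw [h, hy₁ x, hy₂ x]
      abel
    · filter_upwards [Lp.coeFn_add a.1 b.1, ha₁, ha₂] with x h h₁ h₂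
      rw [Prod.fst_add, h, Pi.add_apply, Pi.add_apply, h₁, h₂]
    · filter_upwards [Lp.coeFn_add a.2 b.2, hc₁, hc₂] with x h h₁ h₂
      rw [Prod.snd_add, h, Pi.add_apply, h₁, h₂, Pi.add_apply, Pi.add_apply, diracExpr_add]
  smul_mem' := by
    rintro c a ⟨y, v, hi, hy, ha, hc⟩
    refine ⟨c • y, c • v, hi.smul c, ?_, ?_, ?_⟩
    · intro x
      simp only [Pi.smul_apply]
      rw [intervalIntegral.integral_smul, hy x, smul_add]
    · filter_upwards [Lp.coeFn_smul c a.1, ha] with x h h₁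
      rw [Prod.smul_fst, h, Pi.smul_apply, Pi.smul_apply, h₁]
    · filter_upwards [Lp.coeFn_smul c a.2, hc] with x h h₁
      rw [Prod.smul_snd, h, Pi.smul_apply, h₁, Pi.smul_apply, Pi.smul_apply, diracExpr_smul]

/-! ### Contours -/

/-- The winding number of the closed path `γ : [0, 1] → ℂ` about `z`. -/
def windingNumber (γ : ℝ → ℂ) (z : ℂ) : ℂ :=
  (2 * Real.pi * Complex.I)⁻¹ * ∫ s in (0 : ℝ)..1, deriv γ s / (γ s - z)

/-- `γ` is piecewise continuously differentiable on `[0, 1]`: it is `C¹` on every closed subinterval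
with no point of some finite set `S` in its interior. -/
def IsPiecewiseC1 (γ : ℝ → ℂ) : Prop :=
  ∃ S : Finset ℝ, ∀ a b : ℝ, 0 ≤ a → a < b → b ≤ 1 → (∀ s ∈ S, s ∉ Ioo a b) →
    ContDiffOn ℝ 1 γ (Icc a b)

/-- `γ` (on `[0, 1]`) is a positively oriented, simple closed, piecewise `C¹` contour.
By the Jordan curve theorem a simple closed contour has winding number `0` about the points
outside it and `1` (positive orientation) or `-1` about the points inside it. -/
structure IsContour (γ : ℝ → ℂ) : Prop where
  continuousOn : ContinuousOn γ (Icc 0 1)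
  piecewiseC1 : IsPiecewiseC1 γ
  closed : γ 0 = γ 1
  simple : InjOn γ (Ico 0 1)
  positive : ∀ z ∉ γ '' Icc 0 1, windingNumber γ z = 0 ∨ windingNumber γ z = 1

/-- The contour `γ` encloses the point `z`. -/
def Encloses (γ : ℝ → ℂ) (z : ℂ) : Prop :=
  z ∉ γ '' Icc 0 1 ∧ windingNumber γ z = 1

/-- The operator `e(t, γ) = ∫_γ (L_t(Q) - z)⁻¹ dz`. -/
def contourProjection (p q : ℝ → ℂ) (t : ℝ) (γ : ℝ → ℂ) : L2Period →L[ℂ] L2Period :=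
  ∫ s in (0 : ℝ)..1, deriv γ s • opResolvent (blochOp p q t) (γ s)

/-! ### Spectral singularities -/

/-- `γ` encloses at most one eigenvalue of `L_t(Q)`, counted with multiplicity. -/
def EnclosesAtMostOne (p q : ℝ → ℂ) (t : ℝ) (γ : ℝ → ℂ) : Prop :=
  (∀ z w : ℂ, Encloses γ z → Encloses γ w →
    IsEigenvalue (blochOp p q t) z → IsEigenvalue (blochOp p q t) w → z = w) ∧
  ∀ z : ℂ, Encloses γ z → algMultiplicity (blochOp p q t) z ≤ 1

/-- `lam` is a spectral singularity of `L(Q)`. -/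
def IsSpectralSingularity (p q : ℝ → ℂ) (lam : ℂ) : Prop :=
  lam ∈ opSpectrum (diracOp p q) ∧
  ∀ ε : ℝ, 0 < ε → ∃ γ : ℕ → ℝ → ℂ,
    (∀ n, IsContour (γ n) ∧ (∀ s ∈ Icc (0 : ℝ) 1, γ n s ∈ Metric.ball lam ε) ∧
      ∀ t ∈ Ioc (-1 : ℝ) 1, EnclosesAtMostOne p q t (γ n)) ∧
    Tendsto (fun n => ⨆ (t : ℝ) (_ : t ∈ Ioc (-1 : ℝ) 1)
        (_ : ∀ s ∈ Icc (0 : ℝ) 1, γ n s ∈ opResolventSet (blochOp p q t)),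
        ‖contourProjection p q t (γ n)‖ₑ) atTop (𝓝 (⊤ : ℝ≥0∞))

/-- `lam` is an essential spectral singularity of `L(Q)`: for some `t₀ ∈ (-1, 1]` we have
`lam = μ(t₀)` for a continuous branch `μ(t)` of eigenvalues of `L_t(Q)` near `t₀`, with normalized
eigenfunctions `Ψ_t` of `L_t(Q)` and `Ψ*_t` of the adjoint `L_t(Q)*`, such that `1/α`, where
`α(t) = (Ψ_t, Ψ*_t)`, is not integrable on any interval `(t₀ - ε, t₀ + ε)`. The modulus of `α(t)`
does not depend on the choice of the eigenfunctions if `μ(t)` is a simple eigenvalue;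
the integrability is that of the modulus `1/|α|`. -/
def IsEssentialSpectralSingularity (p q : ℝ → ℂ) (lam : ℂ) : Prop :=
  ∃ t₀ ∈ Ioc (-1 : ℝ) 1, ∃ (μ : ℝ → ℂ) (Ψ Ψs : ℝ → L2Period),
    μ t₀ = lam ∧
    (∃ δ > 0, ContinuousOn μ (Ioo (t₀ - δ) (t₀ + δ)) ∧
      ∀ t ∈ Ioo (t₀ - δ) (t₀ + δ),
        IsEigenvector (blochOp p q t) (μ t) (Ψ t) ∧ ‖Ψ t‖ = 1 ∧
        IsEigenvector ((blochOp p q t).adjoint) (starRingEnd ℂ (μ t)) (Ψs t) ∧ ‖Ψs t‖ = 1) ∧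
    ∀ ε > 0, ¬ IntegrableOn (fun t => 1 / ‖inner ℂ (Ψs t) (Ψ t)‖) (Ioo (t₀ - ε) (t₀ + ε))

end

/-! The equation `J y' + Q y = z y` is the system `y' = (J Q - z J) y`. Its monodromy matrix `M(z)`
is entire in `z` and has determinant 1, because the system is trace-free. Put `w = exp(iπt)` and `D
= tr M`. The resolvent of `L_t(Q)` is `N(w, z) / Δ(z)`, where `N` is entire in `z` and jointly
continuous, and `Δ(z) = det (M(z) - w) = -w (D(z) - 2 cos πt)` (`isResolventPencil_blochOp`,
`charPoly_eq`). Hence the eigenvalues are the solutions of `D(z) = 2 cos πt`. A solution with `D' =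
0` is a multiple eigenvalue (`isMultipleEigenvalue_of_deriv_eq_zero`). A solution with `D' ≠ 0` is
simple, and there `‖N‖ / |D'|` is both `1 / |α|` (`one_div_norm_inner_eq`) and, up to the factor
`2π`, the norm of the contour integral of the resolvent around it (`norm_contourProjection`).

Suppose `lam` is a spectral singularity. If `D(lam)` were outside `[-2, 2]`, all contour integrals
near `lam` would vanish; if `D'(lam) ≠ 0`, they would be bounded by compactness. So `lam` is a
multiple Bloch eigenvalue.

Suppose `lam = μ(t₀)` is an ESS. Near `t₀` the numerator is bounded, so `1 / |α| ≤ B / |D'(μ(t))|`,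
and non-integrability forces `D'(lam) = 0`. If `sin πt₀ ≠ 0` and `D - D(lam)` vanishes to order `m +
1` at `lam`, then `|t - t₀|` is at most a constant times `|μ(t) - lam| ^ (m + 1)`, so `1 / |α|` is
at most a constant times `|t - t₀| ^ (-m / (m + 1))`, which is integrable
(`IsEssentialBranch.sin_eq_zero`). This leaves `t₀ = 0` and `t₀ = 1`.

Non-integrability also makes `1 / |α|` unbounded along the branch, so small circles around the
simple eigenvalues `μ(t)` witness a spectral singularity (`exists_contours`). Finally, `lam` lies in
the spectrum on the line because a bounded Floquet solution, multiplied by slowly decaying cutoffs,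
gives approximate eigenvectors (`IsFloquetSolution.mem_opSpectrum`). -/

/-! ### Operators whose resolvent is a quotient of entire functions -/

section ResolventPencil

variable {H : Type*} [NormedAddCommGroup H] [InnerProductSpace ℂ H]

/-- `N z / Δ z` is the resolvent of `T` at `z`, with `N` and `Δ` entire. -/
structure IsResolventPencil (T : Submodule ℂ (H × H)) (N : ℂ → H →L[ℂ] H) (Δ : ℂ → ℂ) : Prop where
  differentiable_num : Differentiable ℂ N
  differentiable_den : Differentiable ℂ Δ
  right_inv : ∀ z g, (N z g, Δ z • g + z • N z g) ∈ T
  left_inv : ∀ z f h, (f, h) ∈ T → N z (h - z • f) = Δ z • f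

theorem IsResolventAt.unique {T : Submodule ℂ (H × H)} {z : ℂ} {R R' : H →L[ℂ] H}
    (h : IsResolventAt T z R) (h' : IsResolventAt T z R') : R = R' := by
  ext g
  exact (h _ g).2 ((h' _ g).1 rfl)

theorem IsResolventAt.mem_opResolventSet {T : Submodule ℂ (H × H)} {z : ℂ} {R : H →L[ℂ] H}
    (h : IsResolventAt T z R) : z ∈ opResolventSet T := ⟨R, h⟩

theorem IsResolventAt.opResolvent_eq {T : Submodule ℂ (H × H)} {z : ℂ} {R : H →L[ℂ] H}
    (h : IsResolventAt T z R) : opResolvent T z = R := by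
  have hex : ∃ R : H →L[ℂ] H, IsResolventAt T z R := ⟨R, h⟩
  rw [opResolvent, dif_pos hex]
  exact hex.choose_spec.unique h

theorem IsEigenvalue.notMem_opResolventSet {T : Submodule ℂ (H × H)} {z : ℂ}
    (h : IsEigenvalue T z) : z ∉ opResolventSet T := by
  rintro ⟨R, hR⟩
  obtain ⟨f, hf, hT⟩ := h
  have := (hR f 0).2 (by simpa using hT)
  exact hf (by simpa using this.symm)

theorem mem_rootKer_one {T : Submodule ℂ (H × H)} {z : ℂ} {f : H} :
    f ∈ rootKer T z 1 ↔ (f, z • f) ∈ T := by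
  change (∃ g ∈ (⊥ : Submodule ℂ H), (f, z • f + g) ∈ T) ↔ _
  simp

theorem two_le_algMultiplicity {T : Submodule ℂ (H × H)} {z : ℂ} {k : ℕ} {f g : H}
    (hf : f ∈ rootKer T z k) (hg : g ∈ rootKer T z k) (hfg : LinearIndependent ℂ ![f, g]) :
    2 ≤ algMultiplicity T z := by
  have hle : rootKer T z k ≤ ⨆ k, rootKer T z k := le_iSup (rootKer T z) k
  have hli : LinearIndependent ℂ
      (![⟨f, hle hf⟩, ⟨g, hle hg⟩] : Fin 2 → ↥(⨆ k, rootKer T z k)) := by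
    apply LinearIndependent.of_comp (⨆ k, rootKer T z k).subtype
    convert hfg using 1
    ext i
    fin_cases i <;> rfl
  have h := hli.cardinal_lift_le_rank
  have h2 : Cardinal.toENat (2 : Cardinal) ≤ algMultiplicity T z :=
    Cardinal.toENat.monotone' (by simpa using h)
  simpa using h2

namespace IsResolventPencil

variable {T : Submodule ℂ (H × H)} {N : ℂ → H →L[ℂ] H} {Δ : ℂ → ℂ}

theorem isResolventAt (P : IsResolventPencil T N Δ) {z : ℂ} (hz : Δ z ≠ 0) :
    IsResolventAt T z ((Δ z)⁻¹ • N z) := by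
  intro f g
  constructor
  · rintro rfl
    have := T.smul_mem (Δ z)⁻¹ (P.right_inv z g)
    rw [Prod.smul_mk, smul_add, smul_smul, inv_mul_cancel₀ hz, one_smul, smul_comm] at this
    exact this
  · intro h
    have := P.left_inv z _ _ h
    rw [add_sub_cancel_right] at this
    rw [_root_.smul_apply, this, smul_smul, inv_mul_cancel₀ hz, one_smul]

theorem den_eq_zero (P : IsResolventPencil T N Δ) {z : ℂ} (h : IsEigenvalue T z) : Δ z = 0 := by
  by_contra hz
  exact h.notMem_opResolventSet (P.isResolventAt hz).mem_opResolventSet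

theorem hasDerivAt_num_apply (P : IsResolventPencil T N Δ) (z : ℂ) (g : H) :
    HasDerivAt (fun z => N z g) (deriv N z g) z :=
  (ContinuousLinearMap.apply ℂ H g).hasFDerivAt.comp_hasDerivAt z
    (P.differentiable_num z).hasDerivAt

/-- With `R` the resolvent at `z`, the graph is the set where the continuous maps `R (h - z f)` and
`f` agree. Closedness lets derivatives in `z` be taken inside the graph. -/
theorem isClosed (P : IsResolventPencil T N Δ) {z : ℂ} (hz : Δ z ≠ 0) :
    IsClosed (T : Set (H × H)) := by
  have : (T : Set (H × H)) = {u | ((Δ z)⁻¹ • N z) (u.2 - z • u.1) = u.1} := by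
    ext ⟨f, h⟩
    rw [Set.mem_ofPred_eq, P.isResolventAt hz f (h - z • f), sub_add_cancel]
    rfl
  rw [this]
  exact isClosed_eq (by fun_prop) (by fun_prop)

/-- Differentiate the identity `(z₀ - z) N(z) f = Δ(z) f` at `z₀`. -/
theorem num_apply_eigenvector (P : IsResolventPencil T N Δ) {z₀ : ℂ} {f : H}
    (hf : (f, z₀ • f) ∈ T) : N z₀ f = -deriv Δ z₀ • f := by
  have h1 : HasDerivAt (fun z => (z₀ - z) • N z f) (-N z₀ f) z₀ := by
    simpa using ((hasDerivAt_id z₀).const_sub z₀).fun_smul (P.hasDerivAt_num_apply z₀ f)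
  have h2 : HasDerivAt (fun z => Δ z • f) (deriv Δ z₀ • f) z₀ :=
    (P.differentiable_den z₀).hasDerivAt.smul_const f
  have heq : (fun z => (z₀ - z) • N z f) = fun z => Δ z • f := by
    ext z
    rw [← P.left_inv z _ _ hf, ← sub_smul, map_smul]
  rw [heq] at h1
  rw [neg_smul, h2.unique h1, neg_neg]

/-- The dual of `num_apply_eigenvector`: pair `right_inv` with an eigenvector of the adjoint, then
differentiate at `z₀`. -/
theorem inner_num_apply (P : IsResolventPencil T N Δ) {z₀ : ℂ} {f : H}
    (hf : (f, starRingEnd ℂ z₀ • f) ∈ T.adjoint) (g : H) :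
    inner ℂ f (N z₀ g) = -deriv Δ z₀ * inner ℂ f g := by
  have hN : HasDerivAt (fun z => inner ℂ f (N z g)) (inner ℂ f (deriv N z₀ g)) z₀ :=
    (innerSL ℂ f).hasFDerivAt.comp_hasDerivAt z₀
      (P.hasDerivAt_num_apply z₀ g)
  have h1 : HasDerivAt (fun z => (z₀ - z) * inner ℂ f (N z g)) (-inner ℂ f (N z₀ g)) z₀ := by
    simpa using ((hasDerivAt_id z₀).const_sub z₀).fun_mul hN
  have h2 : HasDerivAt (fun z => Δ z * inner ℂ f g) (deriv Δ z₀ * inner ℂ f g) z₀ :=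
    (P.differentiable_den z₀).hasDerivAt.mul_const _
  have heq : (fun z => (z₀ - z) * inner ℂ f (N z g)) = fun z => Δ z * inner ℂ f g := by
    ext z
    have := (Submodule.mem_adjoint_iff _ _).1 hf _ _ (P.right_inv z g)
    have := congrArg (starRingEnd ℂ) this
    simp only [map_sub, map_mul, inner_conj_symm, inner_add_right, inner_smul_right, map_zero,
      Complex.conj_conj] at this
    linear_combination -this
  rw [heq] at h1
  rw [neg_mul, h2.unique h1, neg_neg]

/-- At a simple zero of the denominator there are no associated vectors. -/
theorem eq_zero_of_chain (P : IsResolventPencil T N Δ) {z₀ : ℂ} (h0 : Δ z₀ = 0)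
    (h1 : deriv Δ z₀ ≠ 0) {f g : H} (hg : (g, z₀ • g) ∈ T) (hf : (f, z₀ • f + g) ∈ T) : g = 0 := by
  have := P.left_inv z₀ _ _ hf
  rw [add_sub_cancel_left, P.num_apply_eigenvector hg, h0, zero_smul, neg_smul, neg_eq_zero,
    smul_eq_zero] at this
  exact this.resolve_left h1

theorem rootKer_le (P : IsResolventPencil T N Δ) {z₀ : ℂ} (h0 : Δ z₀ = 0)
    (h1 : deriv Δ z₀ ≠ 0) (k : ℕ) : rootKer T z₀ k ≤ rootKer T z₀ 1 := by
  induction k with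
  | zero => exact bot_le
  | succ k ih =>
    rintro f ⟨g, hg, hf⟩
    have := P.eq_zero_of_chain h0 h1 (mem_rootKer_one.1 (ih hg)) hf
    rw [this, add_zero] at hf
    exact mem_rootKer_one.2 hf

theorem algMultiplicity_le_one (P : IsResolventPencil T N Δ) {z₀ : ℂ} (h0 : Δ z₀ = 0)
    (h1 : deriv Δ z₀ ≠ 0) {Ψ : H} (hker : ∀ f, (f, z₀ • f) ∈ T → ∃ c : ℂ, f = c • Ψ) :
    algMultiplicity T z₀ ≤ 1 := by
  have hle : (⨆ k, rootKer T z₀ k) ≤ Submodule.span ℂ {Ψ} := by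
    refine iSup_le fun k => (P.rootKer_le h0 h1 k).trans fun f hf => ?_
    obtain ⟨c, rfl⟩ := hker f (mem_rootKer_one.1 hf)
    exact Submodule.smul_mem _ _ (Submodule.mem_span_singleton_self Ψ)
  have h : Module.rank ℂ ↥(⨆ k, rootKer T z₀ k) ≤ 1 :=
    (Submodule.rank_mono hle).trans (by simpa using rank_span_le (R := ℂ) ({Ψ} : Set H))
  have h2 : algMultiplicity T z₀ ≤ Cardinal.toENat (1 : Cardinal) := Cardinal.toENat.monotone' h
  simpa using h2

theorem algMultiplicity_eq_zero (P : IsResolventPencil T N Δ) {z₀ : ℂ} (h0 : Δ z₀ ≠ 0) :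
    algMultiplicity T z₀ = 0 := by
  have hle : (⨆ k, rootKer T z₀ k) = ⊥ := by
    rw [eq_bot_iff]
    refine iSup_le fun k => ?_
    induction k with
    | zero => exact le_rfl
    | succ k ih =>
      rintro f ⟨g, hg, hf⟩
      have hg0 : g = 0 := ih hg
      rw [hg0, add_zero] at hf
      by_contra hne
      exact h0 (P.den_eq_zero ⟨f, hne, hf⟩)
  rw [algMultiplicity, hle]
  simp

/-- Differentiating `right_inv` at a double zero of `Δ` shows that `N'(z₀) g` is an associated
vector of the eigenvector `N(z₀) g`. -/
theorem isMultipleEigenvalue (P : IsResolventPencil T N Δ) {z₀ z₁ : ℂ} (h0 : Δ z₀ = 0)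
    (h1 : deriv Δ z₀ = 0) (hz₁ : Δ z₁ ≠ 0) (hN : N z₀ ≠ 0)
    (hT₀ : ∀ h, (0, h) ∈ T → h = 0) : IsMultipleEigenvalue T z₀ := by
  obtain ⟨g, hg⟩ : ∃ g, N z₀ g ≠ 0 := by
    by_contra! h
    exact hN (ContinuousLinearMap.ext h)
  have hT : (N z₀ g, z₀ • N z₀ g) ∈ T := by simpa [h0] using P.right_inv z₀ g
  refine ⟨⟨N z₀ g, hg, hT⟩, ?_⟩
  have hN' := P.hasDerivAt_num_apply z₀ g
  have hD' : HasDerivAt (fun z => Δ z • g + z • N z g) (z₀ • deriv N z₀ g + N z₀ g) z₀ := by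
    have h := ((P.differentiable_den z₀).hasDerivAt.smul_const g).fun_add
      ((hasDerivAt_id z₀).fun_smul hN')
    simpa [h1] using h
  have hpair := (hN'.prodMk hD')
  have hmem : (deriv N z₀ g, z₀ • deriv N z₀ g + N z₀ g) ∈ T := by
    refine (P.isClosed hz₁).mem_of_tendsto hpair.tendsto_slope (Eventually.of_forall fun z => ?_)
    rw [slope_def_module]
    exact T.smul_mem _ (T.sub_mem (P.right_inv z g) (P.right_inv z₀ g))
  refine two_le_algMultiplicity (k := 2) (f := N z₀ g) (g := deriv N z₀ g)
    ⟨0, Submodule.zero_mem _, by simpa using hT⟩ ⟨_, mem_rootKer_one.2 hT, hmem⟩ ?_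
  -- If the associated vector were a multiple of the eigenvector, subtracting would put `(0, N z₀
  -- g)` into the graph, against `hT₀`.
  rw [LinearIndependent.pair_iff' hg]
  rintro a ha
  have h0' := T.sub_mem hmem (T.smul_mem a hT)
  rw [← ha, Prod.smul_mk, Prod.mk_sub_mk, sub_self, smul_comm z₀ a, add_sub_cancel_left] at h0'
  exact hg (hT₀ _ h0')

/-- At a simple eigenvalue, `1 / |α|` is the norm of the residue of the resolvent. -/
theorem one_div_norm_inner_eq [CompleteSpace H] (P : IsResolventPencil T N Δ) {z₀ : ℂ} (h0 : Δ z₀ = 0)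
    (h1 : deriv Δ z₀ ≠ 0) {Ψ Ψs : H} (hn : ‖Ψ‖ = 1)
    (hΨs : (Ψs, starRingEnd ℂ z₀ • Ψs) ∈ T.adjoint) (hns : ‖Ψs‖ = 1)
    (hker : ∀ f, (f, z₀ • f) ∈ T → ∃ c : ℂ, f = c • Ψ) :
    1 / ‖inner ℂ Ψs Ψ‖ = ‖N z₀‖ / ‖deriv Δ z₀‖ := by
  have hrange : ∀ g, ∃ c : ℂ, N z₀ g = c • Ψ := fun g =>
    hker _ (by simpa [h0] using P.right_inv z₀ g)
  have hss : inner ℂ Ψs Ψs = (1 : ℂ) := by simp [inner_self_eq_norm_sq_to_K, hns]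
  have hne : inner ℂ Ψs Ψ ≠ 0 := by
    intro h
    obtain ⟨c, hc⟩ := hrange Ψs
    have := P.inner_num_apply hΨs Ψs
    rw [hc, inner_smul_right, h, mul_zero, hss, mul_one] at this
    exact h1 (by simpa using this.symm)
  -- `N z₀` has rank one: its range is spanned by `Ψ`, and pairing with `Ψs` determines the
  -- coefficient. Its norm is therefore attained at `g = Ψs`.
  have key : ∀ g, ‖N z₀ g‖ = ‖deriv Δ z₀‖ / ‖inner ℂ Ψs Ψ‖ * ‖inner ℂ Ψs g‖ := by
    intro g
    obtain ⟨c, hc⟩ := hrange g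
    have := P.inner_num_apply hΨs g
    rw [hc, inner_smul_right] at this
    have h := congrArg norm this
    rw [norm_mul, norm_mul, norm_neg] at h
    rw [hc, norm_smul, hn, mul_one, div_mul_eq_mul_div, ← h, mul_div_cancel_right₀]
    exact norm_ne_zero_iff.2 hne
  have hnorm : ‖N z₀‖ = ‖deriv Δ z₀‖ / ‖inner ℂ Ψs Ψ‖ := by
    refine ContinuousLinearMap.opNorm_eq_of_bounds (by positivity) (fun g => ?_) fun C hC h => ?_
    · rw [key]
      gcongr
      simpa [hns] using norm_inner_le_norm (𝕜 := ℂ) Ψs g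
    · have := h Ψs
      rw [key, hss, hns] at this
      simpa using this
  rw [hnorm]
  have := norm_ne_zero_iff.2 h1
  field_simp

end IsResolventPencil

end ResolventPencil

/-! ### Integrals along piecewise smooth contours -/

section Contours

theorem IsPiecewiseC1.differentiableAt {γ : ℝ → ℂ} (hγ : IsPiecewiseC1 γ) :
    ∃ S : Finset ℝ, ∀ s ∈ Ioo (0 : ℝ) 1, s ∉ S → DifferentiableAt ℝ γ s := by
  obtain ⟨S, hS⟩ := hγ
  refine ⟨S, fun s hs hsS => ?_⟩
  have hU : Ioo (0 : ℝ) 1 ∩ (S : Set ℝ)ᶜ ∈ 𝓝 s :=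
    inter_mem (isOpen_Ioo.mem_nhds hs) (S.finite_toSet.isClosed.isOpen_compl.mem_nhds hsS)
  obtain ⟨δ, hδ, hball⟩ := Metric.mem_nhds_iff.1 hU
  have hsub : Icc (s - δ / 2) (s + δ / 2) ⊆ Ioo (0 : ℝ) 1 ∩ (S : Set ℝ)ᶜ := by
    refine Subset.trans (fun x hx => ?_) hball
    rw [Metric.mem_ball, Real.dist_eq, abs_lt]
    constructor <;> linarith [hx.1, hx.2]
  have hl := (hsub (left_mem_Icc.2 (by linarith))).1
  have hr := (hsub (right_mem_Icc.2 (by linarith))).1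
  refine ((hS (s - δ / 2) (s + δ / 2) hl.1.le (by linarith) hr.2.le fun x hx hxI =>
    (hsub (Ioo_subset_Icc_self hxI)).2 hx).differentiableOn (by norm_num)).differentiableAt
    (Icc_mem_nhds (by linarith) (by linarith))

theorem integrableOn_deriv_of_contDiffOn {γ : ℝ → ℂ} {a b : ℝ}
    (h : ContDiffOn ℝ 1 γ (Icc a b)) (hab : a < b) : IntegrableOn (deriv γ) (Icc a b) := by
  have hc : ContinuousOn (derivWithin γ (Icc a b)) (Icc a b) :=
    h.continuousOn_derivWithin (uniqueDiffOn_Icc hab) le_rfl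
  have hi := hc.integrableOn_compact isCompact_Icc (μ := volume)
  rw [integrableOn_Icc_iff_integrableOn_Ioo] at hi ⊢
  refine hi.congr_fun (fun x hx => ?_) measurableSet_Ioo
  exact derivWithin_of_mem_nhds (Icc_mem_nhds hx.1 hx.2)

theorem IsPiecewiseC1.intervalIntegrable_deriv {γ : ℝ → ℂ} (hγ : IsPiecewiseC1 γ) :
    IntervalIntegrable (deriv γ) volume 0 1 := by
  obtain ⟨S, hS⟩ := hγ
  rw [intervalIntegrable_iff_integrableOn_Icc_of_le zero_le_one]
  refine LocallyIntegrableOn.integrableOn_isCompact (fun x hx => ?_) isCompact_Icc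
  -- Near `x` the only possible break point is `x` itself, so `γ` is `C¹` on short closed intervals
  -- on each side of `x`.
  have hU : ((S.erase x : Finset ℝ) : Set ℝ)ᶜ ∈ 𝓝 x :=
    (S.erase x).finite_toSet.isClosed.isOpen_compl.mem_nhds (by simp)
  obtain ⟨δ, hδ, hball⟩ := Metric.mem_nhds_iff.1 hU
  have hmem : ∀ s ∈ S, |s - x| < δ → s = x := fun s hs hsx => by
    by_contra hne
    exact hball (by rwa [Metric.mem_ball, Real.dist_eq]) (by simpa [hne] using hs)
  have h1 : IntegrableOn (deriv γ) (Icc (max 0 (x - δ / 2)) x) := by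
    rcases (max_le hx.1 (by linarith) : max 0 (x - δ / 2) ≤ x).lt_or_eq with h | h
    · refine integrableOn_deriv_of_contDiffOn (hS _ _ (le_max_left _ _) h hx.2 fun s hs hsI => ?_) h
      have := (le_max_right 0 (x - δ / 2)).trans_lt hsI.1
      exact hsI.2.ne (hmem s hs (abs_lt.2 ⟨by linarith, by linarith [hsI.2]⟩))
    · rw [h, Icc_self]
      simp
  have h2 : IntegrableOn (deriv γ) (Icc x (min 1 (x + δ / 2))) := by
    rcases (le_min hx.2 (by linarith) : x ≤ min 1 (x + δ / 2)).lt_or_eq with h | h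
    · refine integrableOn_deriv_of_contDiffOn (hS _ _ hx.1 h (min_le_left _ _) fun s hs hsI => ?_) h
      have := hsI.2.trans_le (min_le_right 1 (x + δ / 2))
      exact hsI.1.ne' (hmem s hs (abs_lt.2 ⟨by linarith [hsI.1], by linarith⟩))
    · rw [← h, Icc_self]
      simp
  refine ⟨Icc (max 0 (x - δ / 2)) x ∪ Icc x (min 1 (x + δ / 2)), ?_, h1.union h2⟩
  filter_upwards [self_mem_nhdsWithin, mem_nhdsWithin_of_mem_nhds
    (Ioo_mem_nhds (by linarith : x - δ / 2 < x) (by linarith : x < x + δ / 2))] with y hy hy'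
  rcases le_total y x with h | h
  · exact Or.inl ⟨max_le hy.1 hy'.1.le, h⟩
  · exact Or.inr ⟨h, le_min hy.2 hy'.2.le⟩

variable {E : Type*} [NormedAddCommGroup E] [NormedSpace ℂ E]

theorem IsPiecewiseC1.intervalIntegrable_deriv_smul {γ : ℝ → ℂ} (hγ : IsPiecewiseC1 γ)
    (hc : ContinuousOn γ (Icc 0 1)) {U : Set ℂ} (hU : ∀ s ∈ Icc (0 : ℝ) 1, γ s ∈ U) {f : ℂ → E}
    (hf : ContinuousOn f U) : IntervalIntegrable (fun s => deriv γ s • f (γ s)) volume 0 1 := by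
  refine hγ.intervalIntegrable_deriv.smul_continuousOn ?_
  rw [uIcc_of_le zero_le_one]
  exact hf.comp hc hU

variable [CompleteSpace E]

/-- Cauchy's theorem in a disk for closed piecewise smooth paths. -/
theorem IsContour.integral_eq_zero {γ : ℝ → ℂ} (hγ : IsContour γ) {c : ℂ} {r : ℝ}
    (hball : ∀ s ∈ Icc (0 : ℝ) 1, γ s ∈ Metric.ball c r) {f : ℂ → E}
    (hf : DifferentiableOn ℂ f (Metric.ball c r)) :
    ∫ s in (0 : ℝ)..1, deriv γ s • f (γ s) = 0 := by
  -- A holomorphic function on a disk has a primitive, so the integral along a closed path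
  -- telescopes.
  obtain ⟨g, hg⟩ := hf.isExactOn_ball
  obtain ⟨S, hS⟩ := hγ.piecewiseC1.differentiableAt
  have hgc : ContinuousOn g (Metric.ball c r) := fun z hz => (hg z hz).continuousAt.continuousWithinAt
  rw [MeasureTheory.integral_eq_of_hasDerivAt_off_countable (fun s => g (γ s)) _
    S.finite_toSet.countable, hγ.closed, sub_self]
  · rw [uIcc_of_le zero_le_one]
    exact hgc.comp hγ.continuousOn hball
  · rintro s ⟨hs, hsS⟩
    rw [min_eq_left zero_le_one, max_eq_right zero_le_one] at hs
    exact (hg _ (hball s (Ioo_subset_Icc_self hs))).scomp s (hS s hs hsS).hasDerivAt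
  · exact hγ.piecewiseC1.intervalIntegrable_deriv_smul hγ.continuousOn hball hf.continuousOn

/-- Cauchy's integral formula in a disk for closed piecewise smooth paths. -/
theorem IsContour.integral_sub_inv_smul {γ : ℝ → ℂ} (hγ : IsContour γ) {c : ℂ} {r : ℝ}
    (hball : ∀ s ∈ Icc (0 : ℝ) 1, γ s ∈ Metric.ball c r) {f : ℂ → E}
    (hf : DifferentiableOn ℂ f (Metric.ball c r)) {z : ℂ} (hz : z ∈ Metric.ball c r)
    (hzγ : ∀ s ∈ Icc (0 : ℝ) 1, γ s ≠ z) :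
    ∫ s in (0 : ℝ)..1, deriv γ s • ((γ s - z)⁻¹ • f (γ s)) =
      (2 * Real.pi * Complex.I * windingNumber γ z) • f z := by
  have hd : DifferentiableOn ℂ (dslope f z) (Metric.ball c r) :=
    (Complex.differentiableOn_dslope (Metric.isOpen_ball.mem_nhds hz)).2 hf
  have hinv : IntervalIntegrable (fun s => deriv γ s / (γ s - z)) volume 0 1 :=
    hγ.piecewiseC1.intervalIntegrable_deriv_smul hγ.continuousOn (U := {z}ᶜ) hzγ
      (f := fun w => (w - z)⁻¹) (fun w hw => (by
        have : w - z ≠ 0 := sub_ne_zero.2 hw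
        fun_prop (disch := assumption)))
  -- Split `f(w) / (w - z)` into the difference quotient, which is holomorphic across `z`, and `f(z)
  -- / (w - z)`, which gives the winding number.
  have heq : ∀ s ∈ uIcc (0 : ℝ) 1, deriv γ s • ((γ s - z)⁻¹ • f (γ s)) =
      deriv γ s • dslope f z (γ s) + (deriv γ s / (γ s - z)) • f z := by
    intro s hs
    rw [uIcc_of_le zero_le_one] at hs
    rw [dslope_of_ne _ (hzγ s hs), slope_def_module, div_eq_mul_inv, mul_smul, ← smul_add,
      ← smul_add, sub_add_cancel]
  rw [intervalIntegral.integral_congr heq, intervalIntegral.integral_add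
    (hγ.piecewiseC1.intervalIntegrable_deriv_smul hγ.continuousOn hball hd.continuousOn)
    (intervalIntegrable_iff.2 ((intervalIntegrable_iff.1 hinv).smul_const _)), hγ.integral_eq_zero hball hd, zero_add,
    intervalIntegral.integral_smul_const, windingNumber, mul_inv_cancel_left₀]
  simp [Real.pi_ne_zero]

/-- The positively oriented circle, parametrized over `[0, 1]`. -/
noncomputable def circlePath (c : ℂ) (r : ℝ) (s : ℝ) : ℂ := circleMap c r (2 * Real.pi * s)

theorem hasDerivAt_circlePath (c : ℂ) (r s : ℝ) :
    HasDerivAt (circlePath c r)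
      ((2 * Real.pi : ℝ) • deriv (circleMap c r) (2 * Real.pi * s)) s := by
  have h := (differentiable_circleMap c r (2 * Real.pi * s)).hasDerivAt.scomp s
    ((hasDerivAt_id' s).const_mul (2 * Real.pi))
  rw [mul_one] at h
  exact h

theorem integral_circlePath (c : ℂ) (r : ℝ) (f : ℂ → ℂ) :
    ∫ s in (0 : ℝ)..1, deriv (circlePath c r) s * f (circlePath c r s) = ∮ z in C(c, r), f z := by
  have h := intervalIntegral.smul_integral_comp_mul_left (a := 0) (b := 1)
    (fun θ => deriv (circleMap c r) θ • f (circleMap c r θ)) (2 * Real.pi)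
  rw [mul_zero, mul_one] at h
  rw [circleIntegral, ← h, ← intervalIntegral.integral_smul]
  congr 1
  ext s
  rw [(hasDerivAt_circlePath c r s).deriv, smul_eq_mul, circlePath, smul_mul_assoc]

theorem windingNumber_circlePath (c : ℂ) (r : ℝ) (z : ℂ) :
    windingNumber (circlePath c r) z =
      (2 * Real.pi * Complex.I)⁻¹ * ∮ w in C(c, r), (w - z)⁻¹ := by
  rw [windingNumber, ← integral_circlePath]
  simp only [div_eq_mul_inv]

theorem windingNumber_circlePath_of_mem_ball {c z : ℂ} {r : ℝ} (hz : z ∈ Metric.ball c r) :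
    windingNumber (circlePath c r) z = 1 := by
  rw [windingNumber_circlePath, circleIntegral.integral_sub_inv_of_mem_ball hz, inv_mul_cancel₀]
  simp [Real.pi_ne_zero]

theorem windingNumber_circlePath_of_notMem {c z : ℂ} {r : ℝ} (hr : 0 ≤ r)
    (hz : z ∉ Metric.closedBall c r) : windingNumber (circlePath c r) z = 0 := by
  rw [windingNumber_circlePath, DiffContOnCl.circleIntegral_eq_zero hr, mul_zero]
  refine DifferentiableOn.diffContOnCl fun w hw => ?_
  have : w - z ≠ 0 := sub_ne_zero.2 fun h =>
    hz (h ▸ Metric.closure_ball_subset_closedBall hw)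
  fun_prop (disch := assumption)

theorem circlePath_mem_sphere (c : ℂ) {r : ℝ} (hr : 0 ≤ r) (s : ℝ) :
    circlePath c r s ∈ Metric.sphere c r := circleMap_mem_sphere c hr _

theorem image_circlePath (c : ℂ) {r : ℝ} (hr : 0 ≤ r) :
    circlePath c r '' Icc 0 1 = Metric.sphere c r := by
  refine Subset.antisymm (image_subset_iff.2 fun s _ => circlePath_mem_sphere c hr s) ?_
  rw [← abs_of_nonneg hr, ← image_circleMap_Ioc c r, abs_of_nonneg hr]
  rintro _ ⟨θ, hθ, rfl⟩
  have := Real.pi_pos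
  refine ⟨θ / (2 * Real.pi), ⟨by have := hθ.1; positivity, (div_le_one (by positivity)).2 hθ.2⟩, ?_⟩
  rw [circlePath, mul_div_cancel₀ _ (by positivity)]

theorem isContour_circlePath (c : ℂ) {r : ℝ} (hr : 0 < r) : IsContour (circlePath c r) where
  continuousOn := fun s _ => (hasDerivAt_circlePath c r s).continuousAt.continuousWithinAt
  piecewiseC1 := ⟨∅, fun a b _ _ _ _ =>
    ((contDiff_circleMap c r).comp (contDiff_const.mul contDiff_id)).contDiffOn⟩
  closed := by simp [circlePath, circleMap]
  simple := by
    intro s hs t ht h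
    have hpi := Real.two_pi_pos
    have := injOn_circleMap_of_abs_sub_le' (a := 0) (b := 2 * Real.pi) (c := c) hr.ne' (by simp)
      (⟨by have := hs.1; positivity, by nlinarith [hs.2]⟩ : 2 * Real.pi * s ∈ Ico 0 (2 * Real.pi))
      (⟨by have := ht.1; positivity, by nlinarith [ht.2]⟩ : 2 * Real.pi * t ∈ Ico 0 (2 * Real.pi)) h
    exact mul_left_cancel₀ hpi.ne' this
  positive := by
    intro z hz
    rw [image_circlePath c hr.le] at hz
    by_cases h : z ∈ Metric.ball c r
    · exact Or.inr (windingNumber_circlePath_of_mem_ball h)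
    · refine Or.inl (windingNumber_circlePath_of_notMem hr.le fun h' => ?_)
      rw [← Metric.ball_union_sphere] at h'
      exact h'.elim h hz

theorem Encloses.mem_ball {c z : ℂ} {r : ℝ} (hr : 0 < r) (h : Encloses (circlePath c r) z) :
    z ∈ Metric.ball c r := by
  by_contra hz
  have h1 := h.1
  rw [image_circlePath c hr.le] at h1
  have : z ∉ Metric.closedBall c r := by
    rw [← Metric.ball_union_sphere]
    exact fun h' => h'.elim hz h1
  exact zero_ne_one ((windingNumber_circlePath_of_notMem hr.le this).symm.trans h.2)

end Contours

/-! ### The Volterra operator on `L₂²[0, π]` -/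

section Volterra

abbrev Vec : Type := EuclideanSpace ℂ (Fin 2)

/-- Lebesgue measure on `[0, π]`. -/
noncomputable abbrev periodMeasure : Measure ℝ := volume.restrict (Icc (0 : ℝ) Real.pi)

theorem L2Period.integrable (f : L2Period) : Integrable f periodMeasure :=
  (Lp.memLp f).integrable (by norm_num)

theorem L2Period.intervalIntegrable (f : L2Period) : IntervalIntegrable f volume 0 Real.pi := by
  rw [intervalIntegrable_iff_integrableOn_Icc_of_le Real.pi_pos.le]
  exact f.integrable

theorem intervalIntegrable_of_mem {v : ℝ → Vec} (hv : IntervalIntegrable v volume 0 Real.pi)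
    {x : ℝ} (hx : x ∈ Icc 0 Real.pi) : IntervalIntegrable v volume 0 x := by
  refine hv.mono_set ?_
  rw [uIcc_of_le hx.1, uIcc_of_le Real.pi_pos.le]
  exact Icc_subset_Icc_right hx.2

theorem L2Period.integral_norm_le (f : L2Period) :
    ∫ x, ‖f x‖ ∂periodMeasure ≤ √Real.pi * ‖f‖ := by
  have h := eLpNorm_le_eLpNorm_mul_rpow_measure_univ (p := 1) (q := 2) (by norm_num)
    (Lp.aestronglyMeasurable f)
  rw [eLpNorm_one_eq_lintegral_enorm] at h
  rw [integral_norm_eq_lintegral_enorm (Lp.aestronglyMeasurable f), mul_comm, Lp.norm_def]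
  have h2 := ENNReal.toReal_mono (ENNReal.mul_ne_top (Lp.eLpNorm_ne_top f)
    (ENNReal.rpow_ne_top_of_nonneg (by norm_num) (measure_ne_top _ _))) h
  refine h2.trans_eq ?_
  rw [ENNReal.toReal_mul]
  congr 1
  rw [Measure.restrict_apply_univ, Real.volume_Icc, sub_zero,
    ENNReal.ofReal_rpow_of_pos Real.pi_pos, ENNReal.toReal_ofReal (by positivity), Real.sqrt_eq_rpow]
  norm_num

theorem norm_integral_le_of_mem (f : ℝ → Vec) (hf : Integrable f periodMeasure) {x : ℝ}
    (hx : x ∈ Icc 0 Real.pi) :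
    ‖∫ s in (0 : ℝ)..x, f s‖ ≤ ∫ s, ‖f s‖ ∂periodMeasure := by
  refine (intervalIntegral.norm_integral_le_integral_norm hx.1).trans ?_
  rw [intervalIntegral.integral_of_le hx.1]
  exact setIntegral_mono_set hf.norm (Eventually.of_forall fun _ => norm_nonneg _)
    (Ioc_subset_Icc_self.trans (Icc_subset_Icc_right hx.2)).eventuallyLE

theorem continuousOn_primitive_period {v : ℝ → Vec}
    (hv : IntervalIntegrable v volume 0 Real.pi) :
    ContinuousOn (fun x => ∫ s in (0 : ℝ)..x, v s) (Icc 0 Real.pi) := by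
  rw [← uIcc_of_le Real.pi_pos.le]
  exact intervalIntegral.continuousOn_primitive_interval'
    hv left_mem_uIcc

theorem memLp_of_continuousOn {y : ℝ → Vec} (hy : ContinuousOn y (Icc 0 Real.pi)) :
    MemLp y 2 periodMeasure := by
  obtain ⟨C, hC⟩ := isCompact_Icc.exists_bound_of_continuousOn hy
  exact MemLp.of_bound (hy.aestronglyMeasurable measurableSet_Icc) C
    ((ae_restrict_iff' measurableSet_Icc).2 (Eventually.of_forall hC))

theorem memLp_primitive (f : L2Period) :
    MemLp (fun x => ∫ s in (0 : ℝ)..x, f s) 2 periodMeasure :=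
  memLp_of_continuousOn (continuousOn_primitive_period f.intervalIntegrable)

theorem ae_period_of_forall {P : ℝ → Prop} (h : ∀ x ∈ Icc 0 Real.pi, P x) :
    ∀ᵐ x ∂periodMeasure, P x :=
  (ae_restrict_iff' measurableSet_Icc).2 (Eventually.of_forall h)

theorem integral_congr_period {u v : ℝ → Vec} (h : u =ᵐ[periodMeasure] v) {x : ℝ}
    (hx : x ∈ Icc 0 Real.pi) : ∫ s in (0 : ℝ)..x, u s = ∫ s in (0 : ℝ)..x, v s := by
  rw [intervalIntegral.integral_of_le hx.1, intervalIntegral.integral_of_le hx.1]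
  exact integral_congr_ae (ae_restrict_of_ae_restrict_of_subset
    (Ioc_subset_Icc_self.trans (Icc_subset_Icc_right hx.2)) h)

theorem L2Period.norm_le_of_forall {f : L2Period} {C : ℝ} (hC : 0 ≤ C)
    (h : ∀ᵐ x ∂periodMeasure, ‖f x‖ ≤ C) : ‖f‖ ≤ √Real.pi * C := by
  refine (Lp.norm_le_of_ae_bound hC h).trans_eq ?_
  congr 1
  simp [measureUnivNNReal, Real.sqrt_eq_rpow, ENNReal.coe_toNNReal_eq_toReal, Real.pi_pos.le]

/-- The Volterra operator `(W f)(x) = ∫₀ˣ f` on `L₂²[0, π]`. -/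
noncomputable def volterra : L2Period →L[ℂ] L2Period :=
  LinearMap.mkContinuous
    { toFun := fun f => (memLp_primitive f).toLp
      map_add' := fun f g => by
        rw [← MemLp.toLp_add (memLp_primitive f) (memLp_primitive g)]
        refine MemLp.toLp_congr _ _ (ae_period_of_forall fun x hx => ?_)
        simp only [Pi.add_apply]
        rw [integral_congr_period (Lp.coeFn_add f g) hx]
        exact intervalIntegral.integral_add (intervalIntegrable_of_mem f.intervalIntegrable hx)
          (intervalIntegrable_of_mem g.intervalIntegrable hx)
      map_smul' := fun c f => by
        rw [RingHom.id_apply, ← MemLp.toLp_const_smul c (memLp_primitive f)]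
        refine MemLp.toLp_congr _ _ (ae_period_of_forall fun x hx => ?_)
        simp only [Pi.smul_apply]
        rw [integral_congr_period (Lp.coeFn_smul c f) hx]
        exact intervalIntegral.integral_smul c _ }
    Real.pi fun f => by
      have h : ∀ᵐ x ∂periodMeasure, ‖(memLp_primitive f).toLp _ x‖ ≤ √Real.pi * ‖f‖ := by
        filter_upwards [(memLp_primitive f).coeFn_toLp, ae_period_of_forall fun x hx =>
          (norm_integral_le_of_mem f f.integrable hx).trans f.integral_norm_le] with x hx hx'
        rwa [hx]
      refine (L2Period.norm_le_of_forall (by positivity) h).trans_eq ?_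
      rw [← mul_assoc, Real.mul_self_sqrt Real.pi_pos.le]

theorem coeFn_volterra (f : L2Period) :
    volterra f =ᵐ[periodMeasure] fun x => ∫ s in (0 : ℝ)..x, f s :=
  (memLp_primitive f).coeFn_toLp

/-- The functional `f ↦ ∫₀^π f` on `L₂²[0, π]`. -/
noncomputable def periodIntegral : L2Period →L[ℂ] Vec :=
  LinearMap.mkContinuous
    { toFun := fun f => ∫ s in (0 : ℝ)..Real.pi, f s
      map_add' := fun f g => by
        rw [integral_congr_period (Lp.coeFn_add f g) (right_mem_Icc.2 Real.pi_pos.le)]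
        exact intervalIntegral.integral_add f.intervalIntegrable g.intervalIntegrable
      map_smul' := fun c f => by
        rw [integral_congr_period (Lp.coeFn_smul c f) (right_mem_Icc.2 Real.pi_pos.le)]
        exact intervalIntegral.integral_smul c _ }
    √Real.pi fun f =>
      (norm_integral_le_of_mem f f.integrable (right_mem_Icc.2 Real.pi_pos.le)).trans
        f.integral_norm_le

theorem periodIntegral_apply (f : L2Period) : periodIntegral f = ∫ s in (0 : ℝ)..Real.pi, f s := rfl

/-- The constant functions in `L₂²[0, π]`. -/
noncomputable def constVec : Vec →L[ℂ] L2Period := Lp.constL 2 periodMeasure ℂ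

theorem coeFn_constVec (c : Vec) : constVec c =ᵐ[periodMeasure] fun _ => c :=
  Lp.coeFn_const ..

/-- Multiplication by a bounded matrix function. -/
noncomputable def matMul : Lp (Vec →L[ℂ] Vec) ∞ periodMeasure →L[ℂ] L2Period →L[ℂ] L2Period :=
  (ContinuousLinearMap.id ℂ (Vec →L[ℂ] Vec)).holderL periodMeasure ∞ 2 2

theorem coeFn_matMul (A : Lp (Vec →L[ℂ] Vec) ∞ periodMeasure) (f : L2Period) :
    matMul A f =ᵐ[periodMeasure] fun x => A x (f x) :=
  (ContinuousLinearMap.id ℂ (Vec →L[ℂ] Vec)).coeFn_holder A f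

/-- The first integration only turns the `L²` norm into a uniform bound, by Cauchy–Schwarz. Each
later one gains a factor `x / n`, which is why the power `n + 1` comes with `x ^ n / n!`. -/
theorem volterra_matMul_pow_bound (A : Lp (Vec →L[ℂ] Vec) ∞ periodMeasure) (f : L2Period) (n : ℕ) :
    ∀ᵐ x ∂periodMeasure, ‖((volterra ∘L matMul A) ^ (n + 1)) f x‖ ≤
      (‖A‖ ^ (n + 1) * (√Real.pi * ‖f‖)) * (x ^ n / n.factorial) := by
  have hA : ∀ᵐ x ∂periodMeasure, ‖A x‖ ≤ ‖A‖ := by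
    filter_upwards [ae_le_eLpNormEssSup (f := A) (μ := periodMeasure)] with x hx
    rw [Lp.norm_def, eLpNorm_exponent_top, ← toReal_enorm]
    exact ENNReal.toReal_mono (eLpNorm_exponent_top (f := A) ▸ Lp.eLpNorm_ne_top A) hx
  have hstep : ∀ (g : L2Period) (b : ℝ → ℝ), (∀ᵐ x ∂periodMeasure, ‖g x‖ ≤ b x) →
      Integrable b periodMeasure →
      ∀ᵐ x ∂periodMeasure, ‖(volterra ∘L matMul A) g x‖ ≤ ∫ s in (0 : ℝ)..x, ‖A‖ * b s := by
    intro g b hgb hb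
    filter_upwards [coeFn_volterra (matMul A g), ae_restrict_mem measurableSet_Icc] with x hx hxI
    rw [ContinuousLinearMap.comp_apply, hx]
    refine (intervalIntegral.norm_integral_le_integral_norm hxI.1).trans ?_
    have hsub : Ioc 0 x ⊆ Icc 0 Real.pi := Ioc_subset_Icc_self.trans (Icc_subset_Icc_right hxI.2)
    rw [intervalIntegral.integral_of_le hxI.1, intervalIntegral.integral_of_le hxI.1]
    refine integral_mono_ae ?_ ?_ (ae_restrict_of_ae_restrict_of_subset hsub ?_)
    · exact ((matMul A g).integrable.mono_measure (Measure.restrict_mono hsub le_rfl)).norm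
    · exact (hb.mono_measure (Measure.restrict_mono hsub le_rfl)).const_mul _
    · filter_upwards [coeFn_matMul A g, hgb, hA] with s h1 h2 h3
      rw [h1]
      exact (ContinuousLinearMap.le_opNorm _ _).trans
        (mul_le_mul h3 h2 (norm_nonneg _) (norm_nonneg _))
  induction n with
  | zero =>
    simp only [zero_add, pow_one, pow_zero, Nat.factorial_zero, Nat.cast_one, div_one, mul_one]
    filter_upwards [hstep f (fun x => ‖f x‖) (Eventually.of_forall fun _ => le_rfl)
      f.integrable.norm, ae_restrict_mem measurableSet_Icc] with x hx hxI
    refine hx.trans ?_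
    rw [intervalIntegral.integral_const_mul]
    gcongr
    refine le_trans ?_ f.integral_norm_le
    rw [intervalIntegral.integral_of_le hxI.1]
    exact setIntegral_mono_set f.integrable.norm (Eventually.of_forall fun _ => norm_nonneg _)
      (Ioc_subset_Icc_self.trans (Icc_subset_Icc_right hxI.2)).eventuallyLE
  | succ n ih =>
    filter_upwards [hstep _ _ ih (Continuous.integrableOn_Icc (by fun_prop)),
      ae_restrict_mem measurableSet_Icc] with x hx hxI
    rw [pow_succ', mul_apply_eq_comp]
    refine hx.trans_eq ?_
    simp only [intervalIntegral.integral_const_mul, intervalIntegral.integral_div, integral_pow]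
    rw [Nat.factorial_succ]
    have : (n : ℝ) + 1 ≠ 0 := by positivity
    push_cast
    field_simp
    ring

/-- A high power of `L` has norm less than 1, so `1 - L ^ (n + 1)` is invertible; `1 - L` is a
factor of it that commutes with the cofactor. No smallness of `A` is needed, so the system is
solvable for every `z`. -/
theorem isUnit_one_sub_volterra (A : Lp (Vec →L[ℂ] Vec) ∞ periodMeasure) :
    IsUnit (1 - volterra ∘L matMul A) := by
  set L := volterra ∘L matMul A with hL
  have hbound : ∀ n : ℕ, ‖L ^ (n + 1)‖ ≤ ‖A‖ * Real.pi * ((‖A‖ * Real.pi) ^ n / n.factorial) := by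
    intro n
    refine ContinuousLinearMap.opNorm_le_bound _ (by positivity) fun f => ?_
    have h : ∀ᵐ x ∂periodMeasure, ‖(L ^ (n + 1)) f x‖ ≤
        (‖A‖ ^ (n + 1) * (√Real.pi * ‖f‖)) * (Real.pi ^ n / n.factorial) := by
      filter_upwards [volterra_matMul_pow_bound A f n, ae_restrict_mem measurableSet_Icc]
        with x hx hxI
      refine hx.trans ?_
      have := hxI.1
      gcongr
      exact hxI.2
    refine (L2Period.norm_le_of_forall (by positivity) h).trans_eq ?_
    rw [mul_pow, pow_succ]
    linear_combination (‖A‖ ^ n * ‖A‖ * ‖f‖ * (Real.pi ^ n / n.factorial)) *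
      Real.mul_self_sqrt Real.pi_pos.le
  have hlim : Tendsto (fun n : ℕ => ‖A‖ * Real.pi * ((‖A‖ * Real.pi) ^ n / n.factorial)) atTop (𝓝 0) := by
    simpa using (FloorSemiring.tendsto_pow_div_factorial_atTop (‖A‖ * Real.pi)).const_mul (‖A‖ * Real.pi)
  obtain ⟨n, hn⟩ := (hlim.eventually_lt_const zero_lt_one).exists
  have hunit : IsUnit (1 - L ^ (n + 1)) := isUnit_one_sub_of_norm_lt_one ((hbound n).trans_lt hn)
  have hcomm : Commute (1 - L) (∑ i ∈ Finset.range (n + 1), L ^ i) :=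
    (mul_neg_geom_sum L (n + 1)).trans (geom_sum_mul_neg L (n + 1)).symm
  rw [← mul_neg_geom_sum] at hunit
  exact (hcomm.isUnit_mul_iff.1 hunit).1

/-- A primitive that vanishes a.e. vanishes everywhere by continuity; its a.e. derivative is `f`. -/
theorem volterra_injective : Function.Injective volterra := by
  rw [injective_iff_map_eq_zero]
  intro f hf
  have h0 : ∀ x ∈ Icc 0 Real.pi, ∫ s in (0 : ℝ)..x, f s = 0 := by
    have hae : (fun x => ∫ s in (0 : ℝ)..x, f s) =ᵐ[periodMeasure] fun _ => (0 : Vec) := by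
      filter_upwards [coeFn_volterra f, Lp.coeFn_zero Vec 2 periodMeasure] with x h1 h2
      rw [← h1, hf, h2, Pi.zero_apply]
    exact Measure.eqOn_Icc_of_ae_eq volume Real.pi_pos.ne hae
      (continuousOn_primitive_period f.intervalIntegrable) continuousOn_const
  rw [Lp.eq_zero_iff_ae_eq_zero]
  have h1 := f.intervalIntegrable.ae_hasDerivAt_integral
  have h2 : ∀ᵐ x ∂periodMeasure, x ∈ Ioo 0 Real.pi := by
    rw [periodMeasure, ← Measure.restrict_congr_set Ioo_ae_eq_Icc]
    exact ae_restrict_mem measurableSet_Ioo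
  filter_upwards [ae_restrict_of_ae h1, h2] with x hx hxI
  have hd := hx (by rw [uIcc_of_le Real.pi_pos.le]; exact Ioo_subset_Icc_self hxI) 0 (by simp)
  refine hd.unique ((hasDerivAt_const x (0 : Vec)).congr_of_eventuallyEq ?_)
  filter_upwards [isOpen_Ioo.mem_nhds hxI] with y hy
  exact h0 y (Ioo_subset_Icc_self hy)

end Volterra

/-! ### Endomorphisms of `ℂ²` -/

section TwoByTwo

theorem Vec.ext_coord {a b : Vec} (h0 : a 0 = b 0) (h1 : a 1 = b 1) : a = b := by
  ext i
  fin_cases i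
  · exact h0
  · exact h1

/-- The entries of an endomorphism of `ℂ²`. -/
noncomputable def entry (a : Vec →L[ℂ] Vec) (i j : Fin 2) : ℂ := a (EuclideanSpace.single j 1) i

theorem apply_eq_entry (a : Vec →L[ℂ] Vec) (c : Vec) (i : Fin 2) :
    a c i = entry a i 0 * c 0 + entry a i 1 * c 1 := by
  have hc : c = c 0 • EuclideanSpace.single (0 : Fin 2) (1 : ℂ) +
      c 1 • EuclideanSpace.single (1 : Fin 2) (1 : ℂ) := by
    apply Vec.ext_coord <;> simp
  conv_lhs => rw [hc]
  rw [map_add, map_smul, map_smul, entry, entry]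
  simp [mul_comm]

/-- The trace of an endomorphism of `ℂ²`. -/
noncomputable def trace₂ (a : Vec →L[ℂ] Vec) : ℂ := entry a 0 0 + entry a 1 1

/-- The determinant of an endomorphism of `ℂ²`. -/
noncomputable def det₂ (a : Vec →L[ℂ] Vec) : ℂ := entry a 0 0 * entry a 1 1 - entry a 0 1 * entry a 1 0

/-- The characteristic polynomial of an endomorphism of `ℂ²`. -/
noncomputable def charPoly₂ (a : Vec →L[ℂ] Vec) (w : ℂ) : ℂ := w ^ 2 - trace₂ a * w + det₂ a

/-- `(tr a - w) - a` is the adjugate of `a - w`. It inverts `a - w` up to the characteristic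
polynomial, without division. -/
theorem sub_smul_adjugate (a : Vec →L[ℂ] Vec) (w : ℂ) (c : Vec) :
    a ((trace₂ a - w) • c - a c) - w • ((trace₂ a - w) • c - a c) = charPoly₂ a w • c := by
  apply Vec.ext_coord <;>
  · simp only [map_sub, map_smul, PiLp.sub_apply, PiLp.smul_apply, smul_eq_mul, apply_eq_entry a,
      trace₂, det₂, charPoly₂]
    ring

theorem adjugate_sub_smul (a : Vec →L[ℂ] Vec) (w : ℂ) (c : Vec) :
    (trace₂ a - w) • (a c - w • c) - a (a c - w • c) = charPoly₂ a w • c := by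
  rw [← sub_smul_adjugate]
  simp only [map_sub, map_smul, smul_sub, smul_comm w (trace₂ a - w)]
  abel

theorem exists_eigenvector₂ {a : Vec →L[ℂ] Vec} {w : ℂ} (h : charPoly₂ a w = 0) :
    ∃ c : Vec, c ≠ 0 ∧ a c = w • c := by
  -- Any nonzero value of the adjugate is an eigenvector. If the adjugate vanishes, `a` is the
  -- scalar `tr a - w`; comparing traces, this scalar is `w`.
  by_cases hadj : ∀ c, (trace₂ a - w) • c - a c = 0
  · refine ⟨EuclideanSpace.single 0 1, by simp, ?_⟩
    have h2 : 2 * (trace₂ a - w) = trace₂ a := by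
      have h0 := congrArg (fun v : Vec => v 0) (hadj (EuclideanSpace.single 0 1))
      have h1 := congrArg (fun v : Vec => v 1) (hadj (EuclideanSpace.single 1 1))
      simp only [PiLp.sub_apply, PiLp.smul_apply, PiLp.zero_apply, PiLp.single_apply,
        if_true, smul_eq_mul, mul_one] at h0 h1
      rw [sub_eq_zero] at h0 h1
      rw [two_mul]
      nth_rw 1 [h0]
      rw [h1]
      rfl
    have h3 : trace₂ a - w = w := by linear_combination h2
    rw [← h3]
    exact (sub_eq_zero.1 (hadj _)).symm
  · push Not at hadj
    obtain ⟨c, hc⟩ := hadj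
    refine ⟨_, hc, ?_⟩
    rw [← sub_eq_zero, sub_smul_adjugate, h, zero_smul]

/-- An eigenvalue of a non-scalar endomorphism of `ℂ²` is geometrically simple. -/
theorem eq_smul_of_eigenvectors₂ {a : Vec →L[ℂ] Vec} {w : ℂ} {c : Vec} (hc : c ≠ 0)
    (hac : a c = w • c) (ha : ∃ d, a d ≠ w • d) {d : Vec} (had : a d = w • d) :
    ∃ k : ℂ, d = k • c := by
  by_contra! hk
  obtain ⟨d', hd'⟩ := ha
  have hdet : c 0 * d 1 - c 1 * d 0 ≠ 0 := by
    intro h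
    by_cases h0 : c 0 = 0
    · have h1 : c 1 ≠ 0 := fun h1 => hc (Vec.ext_coord h0 h1)
      refine hk (d 1 / c 1) (Vec.ext_coord ?_ ?_)
      · simp only [PiLp.smul_apply, smul_eq_mul, h0, mul_zero]
        rw [h0] at h
        simpa [h1] using h
      · simp [h1]
    · refine hk (d 0 / c 0) (Vec.ext_coord ?_ ?_)
      · simp [h0]
      · simp only [PiLp.smul_apply, smul_eq_mul]
        field_simp
        linear_combination h
  refine hd' ?_
  -- Cramer's rule: two independent eigenvectors for `w` span the plane, so `a` would be the scalar
  -- `w`.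
  have hd : (c 0 * d 1 - c 1 * d 0) • d' =
      (d' 0 * d 1 - d' 1 * d 0) • c + (c 0 * d' 1 - c 1 * d' 0) • d := by
    apply Vec.ext_coord <;>
    · simp only [PiLp.add_apply, PiLp.smul_apply, smul_eq_mul]
      ring
  have := congrArg a hd
  rw [map_smul, map_add, map_smul, map_smul, hac, had, smul_comm _ w, smul_comm _ w, ← smul_add,
    ← hd, smul_comm w] at this
  exact smul_right_injective _ hdet this

end TwoByTwo

/-! ### The fundamental solution and the resolvent of the Bloch operators -/

section FundamentalSolution

/-- The matrix `J`. -/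
noncomputable def jMat : Vec →L[ℂ] Vec := Matrix.toEuclideanCLM (𝕜 := ℂ) !![0, 1; -1, 0]

theorem jMat_apply_zero (c : Vec) : jMat c 0 = c 1 := by
  simp [jMat, Matrix.ofLp_toEuclideanCLM, Matrix.mulVec, dotProduct]

theorem jMat_apply_one (c : Vec) : jMat c 1 = -c 0 := by
  simp [jMat, Matrix.ofLp_toEuclideanCLM, Matrix.mulVec, dotProduct]

theorem jMat_jMat (c : Vec) : jMat (jMat c) = -c := by
  apply Vec.ext_coord <;> simp [jMat_apply_zero, jMat_apply_one]

/-- The matrix potential `Q(x)`. -/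
noncomputable def potential (p q : ℝ → ℂ) (x : ℝ) : Vec →L[ℂ] Vec :=
  Matrix.toEuclideanCLM (𝕜 := ℂ) !![p x, q x; q x, -p x]

theorem potential_apply_zero (p q : ℝ → ℂ) (x : ℝ) (c : Vec) :
    potential p q x c 0 = p x * c 0 + q x * c 1 := by
  simp [potential, Matrix.ofLp_toEuclideanCLM, Matrix.mulVec, dotProduct]

theorem potential_apply_one (p q : ℝ → ℂ) (x : ℝ) (c : Vec) :
    potential p q x c 1 = q x * c 0 - p x * c 1 := by
  simp [potential, Matrix.ofLp_toEuclideanCLM, Matrix.mulVec, dotProduct, sub_eq_add_neg]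

theorem diracExpr_eq (p q : ℝ → ℂ) (x : ℝ) (y v : Vec) :
    diracExpr p q x y v = jMat v + potential p q x y := by
  apply Vec.ext_coord <;>
  simp [diracExpr, jMat_apply_zero, jMat_apply_one, potential_apply_zero, potential_apply_one,
    dotProduct, sub_eq_add_neg]

theorem eq_diracExpr_iff (p q : ℝ → ℂ) (x : ℝ) (y v h : Vec) :
    h = diracExpr p q x y v ↔ v = jMat (potential p q x y) - jMat h := by
  rw [diracExpr_eq]
  constructor
  · rintro rfl
    rw [map_add, jMat_jMat]
    abel
  · rintro rfl
    rw [map_sub, jMat_jMat, jMat_jMat]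
    abel

theorem potential_eq_smul (p q : ℝ → ℂ) (x : ℝ) :
    potential p q x = p x • Matrix.toEuclideanCLM (𝕜 := ℂ) !![1, 0; 0, -1] +
      q x • Matrix.toEuclideanCLM (𝕜 := ℂ) !![0, 1; 1, 0] := by
  ext c i
  fin_cases i <;>
  simp [potential, Matrix.ofLp_toEuclideanCLM, Matrix.mulVec, dotProduct, add_comm]

/-- Bounded variation enters the argument only here. It gives measurability, the real and imaginary
parts being differences of monotone functions, and the bound `|p(0)|` plus the variation. -/
theorem memLp_top_of_boundedVariationOn {p : ℝ → ℂ} (hp : BoundedVariationOn p (Icc 0 Real.pi)) :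
    MemLp p ∞ periodMeasure := by
  have hm : ∀ u : ℝ → ℝ, BoundedVariationOn u (Icc 0 Real.pi) → AEMeasurable u periodMeasure := by
    intro u hu
    obtain ⟨a, b, ha, hb, rfl⟩ := hu.locallyBoundedVariationOn.exists_monotoneOn_sub_monotoneOn
    exact (aemeasurable_restrict_of_monotoneOn measurableSet_Icc ha).sub
      (aemeasurable_restrict_of_monotoneOn measurableSet_Icc hb)
  have hre : BoundedVariationOn (fun x => (p x).re) (Icc 0 Real.pi) :=
    Complex.reCLM.lipschitz.comp_boundedVariationOn hp
  have him : BoundedVariationOn (fun x => (p x).im) (Icc 0 Real.pi) :=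
    Complex.imCLM.lipschitz.comp_boundedVariationOn hp
  have hpm : AEMeasurable p periodMeasure := by
    have h := ((Complex.measurable_ofReal.comp_aemeasurable (hm _ hre))).add
      ((Complex.measurable_ofReal.comp_aemeasurable (hm _ him)).mul_const Complex.I)
    refine h.congr (Eventually.of_forall fun x => ?_)
    exact Complex.re_add_im (p x)
  refine memLp_top_of_bound hpm.aestronglyMeasurable
    (‖p 0‖ + (eVariationOn p (Icc 0 Real.pi)).toReal) (ae_period_of_forall fun x hx => ?_)
  have h := hp.dist_le hx (left_mem_Icc.2 Real.pi_pos.le)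
  rw [dist_eq_norm] at h
  linarith [norm_le_norm_add_norm_sub' (p x) (p 0)]

theorem memLp_jMat_potential {p q : ℝ → ℂ} (hp : MemLp p ∞ periodMeasure)
    (hq : MemLp q ∞ periodMeasure) : MemLp (fun x => jMat ∘L potential p q x) ∞ periodMeasure := by
  obtain ⟨a, b, hab⟩ : ∃ a b : Vec →L[ℂ] Vec, ∀ x, jMat ∘L potential p q x = p x • a + q x • b :=
    ⟨jMat ∘L Matrix.toEuclideanCLM (𝕜 := ℂ) !![1, 0; 0, -1],
      jMat ∘L Matrix.toEuclideanCLM (𝕜 := ℂ) !![0, 1; 1, 0], fun x => by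
      rw [potential_eq_smul, ContinuousLinearMap.comp_add, ContinuousLinearMap.comp_smul,
        ContinuousLinearMap.comp_smul]⟩
  have h (u : ℝ → ℂ) (hu : MemLp u ∞ periodMeasure) (a : Vec →L[ℂ] Vec) :
      MemLp (fun x => u x • a) ∞ periodMeasure :=
    (ContinuousLinearMap.toSpanSingleton ℂ a).comp_memLp' hu
  have heq : (fun x => jMat ∘L potential p q x) = (fun x => p x • a) + fun x => q x • b :=
    funext hab
  rw [heq]
  exact MemLp.add (ε := Vec →L[ℂ] Vec) (h p hp a) (h q hq b)

/-- Multiplication by `J`. -/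
noncomputable def jMul : L2Period →L[ℂ] L2Period := matMul (Lp.const ∞ periodMeasure jMat)

theorem coeFn_jMul (f : L2Period) : jMul f =ᵐ[periodMeasure] fun x => jMat (f x) := by
  filter_upwards [coeFn_matMul (Lp.const ∞ periodMeasure jMat) f,
    Lp.coeFn_const (p := ∞) (μ := periodMeasure) jMat] with x h1 h2
  rw [jMul, h1, h2]
  rfl

theorem jMul_jMul (f : L2Period) : jMul (jMul f) = -f := by
  apply Lp.ext
  filter_upwards [coeFn_jMul (jMul f), coeFn_jMul f, Lp.coeFn_neg f] with x h1 h2 h3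
  rw [h1, h2, h3, jMat_jMat, Pi.neg_apply]

variable (A : Lp (Vec →L[ℂ] Vec) ∞ periodMeasure)

/-- The coefficient operator `A - z J` of the system `y' = (A - z J) y`. -/
noncomputable def coeffOp (z : ℂ) : L2Period →L[ℂ] L2Period := matMul A - z • jMul

/-- The solution operator of the Volterra equation `f = g + W (A - z J) f`. -/
noncomputable def solOp (z : ℂ) : L2Period →L[ℂ] L2Period :=
  Ring.inverse (1 - volterra ∘L coeffOp A z)

theorem isUnit_one_sub_coeffOp (z : ℂ) : IsUnit (1 - volterra ∘L coeffOp A z) := by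
  have := isUnit_one_sub_volterra (A - z • Lp.const ∞ periodMeasure jMat)
  rwa [map_sub, map_smul] at this

theorem eq_solOp_iff (z : ℂ) (f g : L2Period) :
    f = solOp A z g ↔ f = g + volterra (coeffOp A z f) := by
  have h1 := Ring.mul_inverse_cancel _ (isUnit_one_sub_coeffOp A z)
  have h2 := Ring.inverse_mul_cancel _ (isUnit_one_sub_coeffOp A z)
  constructor
  · rintro rfl
    have := congrArg (fun B : L2Period →L[ℂ] L2Period => B g) h1
    exact sub_eq_iff_eq_add.1 this
  · intro h
    have := congrArg (fun B : L2Period →L[ℂ] L2Period => B f) h2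
    refine this.symm.trans (congrArg (solOp A z) ?_)
    exact sub_eq_iff_eq_add.2 h

theorem differentiable_coeffOp : Differentiable ℂ (coeffOp A) := by
  unfold coeffOp
  fun_prop

theorem differentiable_solOp : Differentiable ℂ (solOp A) := by
  intro z
  refine DifferentiableAt.inverse (𝕜 := ℂ) (h := fun z => 1 - volterra ∘L coeffOp A z) ?_ (isUnit_one_sub_coeffOp A z)
  have := differentiable_coeffOp A z
  fun_prop

/-- The monodromy matrix of the system `y' = (A - z J) y`. -/
noncomputable def monodromy (z : ℂ) : Vec →L[ℂ] Vec :=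
  1 + periodIntegral ∘L coeffOp A z ∘L solOp A z ∘L constVec

/-- Minus the value at `π` of the solution of `y' = (A - z J) y - J g`, `y(0) = 0`. -/
noncomputable def inhomBoundary (z : ℂ) : L2Period →L[ℂ] Vec :=
  periodIntegral ∘L (coeffOp A z ∘L solOp A z ∘L volterra ∘L jMul + jMul)

/-- The numerator of the resolvent. -/
noncomputable def resolventNum (w z : ℂ) : L2Period →L[ℂ] L2Period :=
  solOp A z ∘L (constVec ∘L ((trace₂ (monodromy A z) - w) • ContinuousLinearMap.id ℂ Vec -
    monodromy A z) ∘L inhomBoundary A z - charPoly₂ (monodromy A z) w • volterra ∘L jMul)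

theorem differentiable_monodromy : Differentiable ℂ (monodromy A) := by
  have h1 := differentiable_coeffOp A
  have h2 := differentiable_solOp A
  unfold monodromy
  fun_prop

theorem differentiable_inhomBoundary : Differentiable ℂ (inhomBoundary A) := by
  have h1 := differentiable_coeffOp A
  have h2 := differentiable_solOp A
  unfold inhomBoundary
  fun_prop

theorem differentiable_entry (i j : Fin 2) : Differentiable ℂ fun z => entry (monodromy A z) i j := by
  have h1 := differentiable_monodromy A
  unfold entry
  fun_prop

theorem differentiable_trace : Differentiable ℂ fun z => trace₂ (monodromy A z) :=
  (differentiable_entry A 0 0).add (differentiable_entry A 1 1)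

theorem differentiable_det : Differentiable ℂ fun z => det₂ (monodromy A z) :=
  ((differentiable_entry A 0 0).mul (differentiable_entry A 1 1)).sub
    ((differentiable_entry A 0 1).mul (differentiable_entry A 1 0))

theorem differentiable_charPoly (w : ℂ) :
    Differentiable ℂ fun z => charPoly₂ (monodromy A z) w := by
  have h1 := differentiable_trace A
  have h2 := differentiable_det A
  unfold charPoly₂
  fun_prop

theorem differentiable_resolventNum (w : ℂ) : Differentiable ℂ (resolventNum A w) := by
  have h1 := differentiable_solOp A
  have h2 := differentiable_trace A
  have h3 := differentiable_monodromy A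
  have h4 := differentiable_inhomBoundary A
  have h5 := differentiable_charPoly A w
  unfold resolventNum
  fun_prop

/-- Continuity in the multiplier and the spectral parameter together is what gives bounds uniform in
`t`, by compactness of `|w| = 1`, and bounds along a branch `μ(t)`. -/
theorem continuous_resolventNum : Continuous fun x : ℂ × ℂ => resolventNum A x.1 x.2 := by
  have h1 := (differentiable_solOp A).continuous
  have h2 := (differentiable_trace A).continuous
  have h3 := (differentiable_monodromy A).continuous
  have h4 := (differentiable_inhomBoundary A).continuous
  have h5 := (differentiable_det A).continuous
  unfold resolventNum charPoly₂
  refine (h1.comp continuous_snd).clm_comp (Continuous.sub ?_ ?_)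
  · refine continuous_const.clm_comp (Continuous.clm_comp ?_ (h4.comp continuous_snd))
    exact (((h2.comp continuous_snd).sub continuous_fst).smul continuous_const).sub
      (h3.comp continuous_snd)
  · exact (((continuous_fst.pow 2).sub ((h2.comp continuous_snd).mul continuous_fst)).add
      (h5.comp continuous_snd)).smul continuous_const

/-- The integrated form of the boundary value problem `y' = A y - J h`, `y(π) = w y(0)`. -/
def IsQuasiPeriodicSolution (w : ℂ) (c : Vec) (f h : L2Period) : Prop :=
  f = constVec c + volterra (matMul A f - jMul h) ∧
    periodIntegral (matMul A f - jMul h) = (w - 1) • c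

/-- Variation of constants: the initial value `c` determines `f`, and the boundary condition becomes
a linear system for `c` with matrix `M(z) - w`. -/
theorem isQuasiPeriodicSolution_iff (w z : ℂ) (c : Vec) (f g : L2Period) :
    IsQuasiPeriodicSolution A w c f (z • f + g) ↔
      f = solOp A z (constVec c - volterra (jMul g)) ∧
        monodromy A z c - w • c = inhomBoundary A z g := by
  have h1 : matMul A f - jMul (z • f + g) = coeffOp A z f - jMul g := by
    simp only [coeffOp, map_add, map_smul, _root_.sub_apply, _root_.smul_apply]
    abel
  rw [IsQuasiPeriodicSolution, h1, eq_solOp_iff, map_sub]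
  rw [show constVec c + (volterra (coeffOp A z f) - volterra (jMul g)) =
    constVec c - volterra (jMul g) + volterra (coeffOp A z f) by abel]
  refine and_congr_right fun hf => ?_
  have hf' := (eq_solOp_iff A z f _).2 hf
  have h2 : periodIntegral (coeffOp A z f - jMul g) =
      monodromy A z c - c - inhomBoundary A z g := by
    conv_lhs => rw [hf']
    simp only [monodromy, inhomBoundary, map_sub, _root_.add_apply, map_add,
      ContinuousLinearMap.comp_apply, one_apply_eq_self]
    abel
  rw [h2, sub_smul, one_smul]
  rw [sub_eq_iff_eq_add, sub_eq_iff_eq_add, sub_eq_iff_eq_add]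
  rw [show w • c - c + inhomBoundary A z g + c = inhomBoundary A z g + w • c by abel]

end FundamentalSolution

/-! ### Integration by parts for absolutely continuous functions -/

section ProductRule

theorem AbsolutelyContinuousOnInterval.of_const {F : Type*} [PseudoMetricSpace F] (c : F) (a b : ℝ) :
    AbsolutelyContinuousOnInterval (fun _ => c) a b :=
  (LipschitzWith.const c).lipschitzOnWith.absolutelyContinuousOnInterval

theorem AbsolutelyContinuousOnInterval.congr_uIcc {F : Type*} [PseudoMetricSpace F] {f g : ℝ → F}
    {a b : ℝ} (hf : AbsolutelyContinuousOnInterval f a b) (h : EqOn f g (uIcc a b)) :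
    AbsolutelyContinuousOnInterval g a b := by
  refine Tendsto.congr' ?_ hf
  filter_upwards [mem_inf_of_right (mem_principal_self _)] with E hE
  refine Finset.sum_congr rfl fun i hi => ?_
  rw [h (hE.1 i hi).1, h (hE.1 i hi).2]

theorem absolutelyContinuous_ofReal {r : ℝ → ℝ} {a b : ℝ}
    (hr : AbsolutelyContinuousOnInterval r a b) (c : ℂ) :
    AbsolutelyContinuousOnInterval (fun x => (r x : ℂ) * c) a b := by
  have h := hr.smul (.of_const c a b)
  refine h.congr' ?_
  simp

theorem absolutelyContinuous_primitive {u : ℝ → ℂ} {T : ℝ} (hu : IntervalIntegrable u volume 0 T)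
    (c : ℂ) : AbsolutelyContinuousOnInterval (fun x => c + ∫ s in (0 : ℝ)..x, u s) 0 T := by
  have hre : IntervalIntegrable (fun s => (u s).re) volume 0 T := ⟨hu.1.re, hu.2.re⟩
  have him : IntervalIntegrable (fun s => (u s).im) volume 0 T := ⟨hu.1.im, hu.2.im⟩
  have h1 := absolutelyContinuous_ofReal
    (hre.absolutelyContinuousOnInterval_intervalIntegral (c := 0) left_mem_uIcc) 1
  have h2 := absolutelyContinuous_ofReal
    (him.absolutelyContinuousOnInterval_intervalIntegral (c := 0) left_mem_uIcc) Complex.I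
  have h := (AbsolutelyContinuousOnInterval.of_const c 0 T).add (h1.add h2)
  refine h.congr_uIcc fun x hx => ?_
  have hu' : IntervalIntegrable u volume 0 x := hu.mono_set (uIcc_subset_uIcc left_mem_uIcc hx)
  have e1 := Complex.reCLM.intervalIntegral_comp_comm hu'
  have e2 := Complex.imCLM.intervalIntegral_comp_comm hu'
  simp only [Complex.reCLM_apply, Complex.imCLM_apply] at e1 e2
  simp only [Pi.add_apply, e1, e2, mul_one, Complex.re_add_im]

/-- Integration by parts for primitives of integrable functions. -/
theorem integral_mul_primitive {u v : ℝ → ℂ} {T : ℝ} (hu : IntervalIntegrable u volume 0 T)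
    (hv : IntervalIntegrable v volume 0 T) (c d : ℂ) {x : ℝ} (hx : x ∈ uIcc 0 T) :
    ∫ s in (0 : ℝ)..x, (u s * (d + ∫ r in (0 : ℝ)..s, v r) + (c + ∫ r in (0 : ℝ)..s, u r) * v s) =
      (c + ∫ s in (0 : ℝ)..x, u s) * (d + ∫ s in (0 : ℝ)..x, v s) - c * d := by
  have hU := absolutelyContinuous_primitive hu c
  have hV := absolutelyContinuous_primitive hv d
  have hw : IntervalIntegrable (fun s => u s * (d + ∫ r in (0 : ℝ)..s, v r) +
      (c + ∫ r in (0 : ℝ)..s, u r) * v s) volume 0 T :=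
    (hu.mul_continuousOn hV.continuousOn).add (hv.continuousOn_mul hU.continuousOn)
  have hW := absolutelyContinuous_primitive hw 0
  have hUV : AbsolutelyContinuousOnInterval (fun x => (c + ∫ s in (0 : ℝ)..x, u s) *
    (d + ∫ s in (0 : ℝ)..x, v s)) 0 T := hU.smul hV
  -- The product of the primitives minus the primitive of its formal derivative is absolutely
  -- continuous with derivative zero a.e., hence constant.
  obtain ⟨C, hC⟩ := (hUV.sub hW).const_of_ae_hasDerivAt_zero (by
    filter_upwards [hu.ae_hasDerivAt_integral, hv.ae_hasDerivAt_integral,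
      hw.ae_hasDerivAt_integral] with x h1 h2 h3 hx
    have h := (((h1 hx 0 left_mem_uIcc).const_add c).fun_mul
      ((h2 hx 0 left_mem_uIcc).const_add d)).fun_sub ((h3 hx 0 left_mem_uIcc).const_add 0)
    rw [sub_self] at h
    exact h)
  have h0 := hC 0 left_mem_uIcc
  have h1 := hC x hx
  simp only [Pi.sub_apply, intervalIntegral.integral_same, add_zero, zero_add] at h0 h1
  linear_combination h0 - h1

end ProductRule

/-! ### Boundary terms for products of coordinates of primitives -/

section Boundary

theorem Vec.intervalIntegrable_apply {v : ℝ → Vec} {a b : ℝ}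
    (hv : IntervalIntegrable v volume a b) (i : Fin 2) :
    IntervalIntegrable (fun s => v s i) volume a b :=
  let L : Vec →L[ℂ] ℂ := EuclideanSpace.proj i
  ⟨L.integrable_comp hv.1, L.integrable_comp hv.2⟩

theorem Vec.integral_apply {v : ℝ → Vec} {a b : ℝ} (hv : IntervalIntegrable v volume a b)
    (i : Fin 2) : (∫ s in a..b, v s) i = ∫ s in a..b, v s i :=
  (ContinuousLinearMap.intervalIntegral_comp_comm
    (EuclideanSpace.proj i : Vec →L[ℂ] ℂ) hv).symm

variable {c d : Vec} {f g u v : L2Period}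

theorem ae_eq_primitive (hf : f = constVec c + volterra v) :
    f =ᵐ[periodMeasure] fun x => c + ∫ s in (0 : ℝ)..x, v s := by
  rw [hf]
  filter_upwards [Lp.coeFn_add (constVec c) (volterra v), coeFn_constVec c, coeFn_volterra v]
    with x h1 h2 h3
  rw [h1, Pi.add_apply, h2, h3]

theorem integral_period_eq (w : ℝ → ℂ) :
    ∫ x, w x ∂periodMeasure = ∫ x in (0 : ℝ)..Real.pi, w x := by
  rw [intervalIntegral.integral_of_le Real.pi_pos.le, integral_Icc_eq_integral_Ioc]

/-- The integrand is the derivative of `f_i g_j`; the values of `f` at `0` and `π` are `c` and `c +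
∫ v`. -/
theorem integral_coord_mul_coord (hf : f = constVec c + volterra v)
    (hg : g = constVec d + volterra u) (i j : Fin 2) :
    ∫ x, (v x i * g x j + f x i * u x j) ∂periodMeasure =
      (c + periodIntegral v) i * (d + periodIntegral u) j - c i * d j := by
  have hv := Vec.intervalIntegrable_apply v.intervalIntegrable i
  have hu := Vec.intervalIntegrable_apply u.intervalIntegrable j
  have h := integral_mul_primitive hv hu (c i) (d j) right_mem_uIcc
  rw [PiLp.add_apply, PiLp.add_apply, periodIntegral_apply, periodIntegral_apply,
    Vec.integral_apply v.intervalIntegrable, Vec.integral_apply u.intervalIntegrable, ← h,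
    ← integral_period_eq]
  refine integral_congr_ae ?_
  filter_upwards [ae_eq_primitive hf, ae_eq_primitive hg, ae_restrict_mem measurableSet_Icc]
    with x h1 h2 hx
  rw [h1, h2, PiLp.add_apply, PiLp.add_apply,
    Vec.integral_apply (intervalIntegrable_of_mem v.intervalIntegrable hx),
    Vec.integral_apply (intervalIntegrable_of_mem u.intervalIntegrable hx)]

theorem integral_conj_coord_mul_coord (hf : f = constVec c + volterra v)
    (hg : g = constVec d + volterra u) (i j : Fin 2) :
    ∫ x, (starRingEnd ℂ (v x i) * g x j + starRingEnd ℂ (f x i) * u x j) ∂periodMeasure =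
      starRingEnd ℂ ((c + periodIntegral v) i) * (d + periodIntegral u) j -
        starRingEnd ℂ (c i) * d j := by
  have hv := Vec.intervalIntegrable_apply v.intervalIntegrable i
  have hv' : IntervalIntegrable (fun s => starRingEnd ℂ (v s i)) volume 0 Real.pi :=
    ⟨Complex.conjCLE.toContinuousLinearMap.integrable_comp hv.1,
      Complex.conjCLE.toContinuousLinearMap.integrable_comp hv.2⟩
  have hconj : ∀ x, ∫ s in (0 : ℝ)..x, starRingEnd ℂ (v s i) =
      starRingEnd ℂ (∫ s in (0 : ℝ)..x, v s i) := fun x => by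
    rw [intervalIntegral, intervalIntegral, integral_conj, integral_conj, map_sub]
  have hu := Vec.intervalIntegrable_apply u.intervalIntegrable j
  have h := integral_mul_primitive hv' hu (starRingEnd ℂ (c i)) (d j) right_mem_uIcc
  rw [PiLp.add_apply, PiLp.add_apply, periodIntegral_apply, periodIntegral_apply,
    Vec.integral_apply v.intervalIntegrable, Vec.integral_apply u.intervalIntegrable, map_add,
    ← hconj, ← h, ← integral_period_eq]
  refine integral_congr_ae ?_
  filter_upwards [ae_eq_primitive hf, ae_eq_primitive hg, ae_restrict_mem measurableSet_Icc]
    with x h1 h2 hx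
  rw [h1, h2, PiLp.add_apply, PiLp.add_apply,
    Vec.integral_apply (intervalIntegrable_of_mem v.intervalIntegrable hx),
    Vec.integral_apply (intervalIntegrable_of_mem u.intervalIntegrable hx), map_add, hconj]

end Boundary

/-! ### Liouville's formula and the location of the eigenvalues -/

section Determinant

variable (A : Lp (Vec →L[ℂ] Vec) ∞ periodMeasure)

theorem coeFn_coeffOp (z : ℂ) (f : L2Period) :
    coeffOp A z f =ᵐ[periodMeasure] fun x => A x (f x) - z • jMat (f x) := by
  filter_upwards [Lp.coeFn_sub (matMul A f) (z • jMul f), coeFn_matMul A f,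
    Lp.coeFn_smul z (jMul f), coeFn_jMul f] with x h1 h2 h3 h4
  rw [coeffOp, _root_.sub_apply, _root_.smul_apply, h1, Pi.sub_apply, h2, h3, Pi.smul_apply, h4]

/-- Liouville's formula for a trace-free system. -/
theorem det_monodromy (hA : ∀ᵐ x ∂periodMeasure, trace₂ (A x) = 0) (z : ℂ) :
    det₂ (monodromy A z) = 1 := by
  let e (j : Fin 2) : Vec := EuclideanSpace.single j 1
  let y (j : Fin 2) : L2Period := solOp A z (constVec (e j))
  have hy (j : Fin 2) : y j = constVec (e j) + volterra (coeffOp A z (y j)) :=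
    (eq_solOp_iff A z _ _).1 rfl
  have h1 := integral_coord_mul_coord (hy 0) (hy 1) 0 1
  have h2 := integral_coord_mul_coord (hy 0) (hy 1) 1 0
  -- The difference of the integrands is the derivative of the Wronskian, which is the trace of the
  -- coefficient times the Wronskian. The term `z J` contributes no trace.
  have h3 : ∫ x, (coeffOp A z (y 0) x 0 * y 1 x 1 + y 0 x 0 * coeffOp A z (y 1) x 1) ∂periodMeasure =
      ∫ x, (coeffOp A z (y 0) x 1 * y 1 x 0 + y 0 x 1 * coeffOp A z (y 1) x 0) ∂periodMeasure := by
    refine integral_congr_ae ?_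
    filter_upwards [hA, coeFn_coeffOp A z (y 0), coeFn_coeffOp A z (y 1)] with x h0 h1 h2
    rw [trace₂] at h0
    simp only [h1, h2, PiLp.sub_apply, PiLp.smul_apply, jMat_apply_zero, jMat_apply_one,
      apply_eq_entry (A x), smul_eq_mul]
    linear_combination (y 0 x 0 * y 1 x 1 - y 0 x 1 * y 1 x 0) * h0
  rw [h1, h2] at h3
  have h4 (j : Fin 2) : e j + periodIntegral (coeffOp A z (y j)) = monodromy A z (e j) := rfl
  rw [h4, h4] at h3
  simp only [e, PiLp.single_apply] at h3
  simp only [det₂, entry]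
  simp at h3
  linear_combination h3

/-- The Lagrange identity for quasi-periodic functions. -/
theorem im_inner_jMul {c : Vec} {f v : L2Period} (hf : f = constVec c + volterra v) {w : ℂ}
    (hw : ‖w‖ = 1) (hc : periodIntegral v = (w - 1) • c) : (inner ℂ f (jMul v)).im = 0 := by
  have h1 := integral_conj_coord_mul_coord hf hf 0 1
  have h2 := integral_conj_coord_mul_coord hf hf 1 0
  have hcw : c + periodIntegral v = w • c := by rw [hc, sub_smul, one_smul, add_sub_cancel]
  have hww : starRingEnd ℂ w * w = 1 := by
    rw [← Complex.normSq_eq_conj_mul_self, Complex.normSq_eq_norm_sq, hw]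
    norm_num
  have hs : Integrable (fun x => inner ℂ (f x) (jMul v x)) periodMeasure :=
    L2.integrable_inner f (jMul v)
  have hs' : Integrable (fun x => starRingEnd ℂ (inner ℂ (f x) (jMul v x))) periodMeasure :=
    Complex.conjCLE.toContinuousLinearMap.integrable_comp hs
  have hint (i j : Fin 2) : Integrable (fun x => starRingEnd ℂ (v x i) * f x j +
      starRingEnd ℂ (f x i) * v x j) periodMeasure := by
    have h (f : L2Period) (i : Fin 2) : MemLp (fun x => f x i) 2 periodMeasure :=
      (EuclideanSpace.proj i : Vec →L[ℂ] ℂ).comp_memLp' (Lp.memLp f)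
    exact ((h v i).star.integrable_mul (h f j)).add ((h f i).star.integrable_mul (h v j))
  -- The integrand is the derivative of `conj f₀ · f₁ - conj f₁ · f₀`, whose values at `0` and `π`
  -- agree because `|w| = 1`.
  have h3 : ∫ x, (inner ℂ (f x) (jMul v x) - starRingEnd ℂ (inner ℂ (f x) (jMul v x)))
      ∂periodMeasure = 0 := by
    rw [← sub_eq_zero_of_eq (a := starRingEnd ℂ ((c + periodIntegral v) 0) *
      (c + periodIntegral v) 1 - starRingEnd ℂ (c 0) * c 1 -
      (starRingEnd ℂ ((c + periodIntegral v) 1) * (c + periodIntegral v) 0 -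
        starRingEnd ℂ (c 1) * c 0)) (b := 0), sub_zero, ← h1, ← h2,
      ← integral_sub (hint 0 1) (hint 1 0)]
    · refine integral_congr_ae ?_
      filter_upwards [coeFn_jMul v] with x hx
      simp only [hx, PiLp.inner_apply, Fin.sum_univ_two, RCLike.inner_apply, jMat_apply_zero,
        jMat_apply_one, map_add, map_mul, map_neg, Complex.conj_conj]
      ring
    · simp only [hcw, PiLp.smul_apply, smul_eq_mul, map_mul]
      linear_combination (starRingEnd ℂ (c 0) * c 1 - starRingEnd ℂ (c 1) * c 0) * hww
  rw [integral_sub hs hs', integral_conj, ← L2.inner_def, sub_eq_zero] at h3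
  exact Complex.conj_eq_iff_im.1 h3.symm

/-- Eigenvalues of the quasi-periodic problems lie in a horizontal strip. -/
theorem im_le_of_quasiPeriodic {w z : ℂ} (hw : ‖w‖ = 1) {c : Vec} {f : L2Period}
    (hf : IsQuasiPeriodicSolution A w c f (z • f)) (hne : f ≠ 0) :
    z.im ≤ ‖jMul ∘L matMul A‖ := by
  -- With `v = A f - z J f` and `J² = -1`, one has `J v = J A f + z f`, so `Im z ‖f‖²` is controlled
  -- by the bounded operator `J A`.
  have h := im_inner_jMul hf.1 hw hf.2
  rw [map_sub, map_smul, map_smul, jMul_jMul, smul_neg, sub_neg_eq_add, inner_add_right,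
    inner_smul_right, inner_self_eq_norm_sq_to_K] at h
  have h2 : z.im * ‖f‖ ^ 2 = -(inner ℂ f (jMul (matMul A f))).im := by
    have : (z * ((‖f‖ : ℝ) : ℂ) ^ 2).im = z.im * ‖f‖ ^ 2 := by
      rw [← Complex.ofReal_pow, Complex.im_mul_ofReal]
    rw [← this]
    rw [Complex.add_im] at h
    exact eq_neg_of_add_eq_zero_right h
  have h3 : z.im * ‖f‖ ^ 2 ≤ ‖jMul ∘L matMul A‖ * ‖f‖ ^ 2 := by
    rw [h2]
    refine (neg_le_abs _).trans ((Complex.abs_im_le_norm _).trans ((norm_inner_le_norm _ _).trans ?_))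
    calc ‖f‖ * ‖jMul (matMul A f)‖ ≤ ‖f‖ * (‖jMul ∘L matMul A‖ * ‖f‖) := by
          gcongr
          exact (jMul ∘L matMul A).le_opNorm f
      _ = _ := by ring
  exact le_of_mul_le_mul_right h3 (by have := norm_pos_iff.2 hne; positivity)

end Determinant

/-! ### The Bloch operators -/

section BlochOperators

/-! ### Nonvanishing of the resolvent numerator; scalar monodromy -/

section Abstract

variable (A : Lp (Vec →L[ℂ] Vec) ∞ periodMeasure)

theorem solOp_constVec_injective (z : ℂ) :
    Function.Injective fun c : Vec => solOp A z (constVec c) := by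
  intro c d h
  have hc := (eq_solOp_iff A z _ (constVec c)).1 rfl
  have hd := (eq_solOp_iff A z _ (constVec d)).1 rfl
  simp only at h
  rw [← h] at hd
  have heq : constVec c = constVec d := add_right_cancel (hc.symm.trans hd)
  have hae : (fun _ : ℝ => c) =ᵐ[periodMeasure] fun _ => d := by
    filter_upwards [coeFn_constVec c, coeFn_constVec d] with x h1 h2
    rw [← h1, ← h2, heq]
  have hne : NeBot (ae periodMeasure) := by
    rw [ae_neBot, Ne, Measure.restrict_eq_zero, Real.volume_Icc]
    simp [Real.pi_pos]
  exact hae.exists.choose_spec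

/-- Take the linear function `f` with `f(0) = 0` and `f(π) = -e`, and let `g` be the inhomogeneity
that makes `f` a solution. -/
theorem inhomBoundary_surjective (z : ℂ) : Function.Surjective (inhomBoundary A z) := by
  intro e
  let v : L2Period := constVec (-(Real.pi⁻¹ : ℝ) • e)
  let f : L2Period := volterra v
  let g : L2Period := jMul (v - coeffOp A z f)
  have hg : jMul g = coeffOp A z f - v := by rw [jMul_jMul, neg_sub]
  have hf : f = solOp A z (constVec 0 - volterra (jMul g)) := by
    rw [eq_solOp_iff, hg, map_sub, map_zero]
    abel
  have hv : periodIntegral v = -e := by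
    rw [periodIntegral_apply, integral_congr_period (coeFn_constVec _)
      (right_mem_Icc.2 Real.pi_pos.le), intervalIntegral.integral_const, sub_zero, neg_smul,
      smul_neg, smul_smul, mul_inv_cancel₀ Real.pi_pos.ne', one_smul]
  refine ⟨g, ?_⟩
  have h : volterra (jMul g) = -(constVec 0 - volterra (jMul g)) := by simp
  simp only [inhomBoundary, ContinuousLinearMap.comp_apply, _root_.add_apply]
  rw [h, map_neg, map_neg, ← hf, hg, map_add, map_neg, map_sub, hv]
  abel

/-- The numerator solves the boundary problem with right-hand side scaled by the characteristic
polynomial; the adjugate of `M(z) - w` supplies the initial value, so nothing is divided. -/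
theorem resolventNum_apply (w z : ℂ) (g : L2Period) :
    resolventNum A w z g = solOp A z (constVec ((trace₂ (monodromy A z) - w) • inhomBoundary A z g -
      monodromy A z (inhomBoundary A z g)) - volterra (jMul (charPoly₂ (monodromy A z) w • g))) := by
  rw [map_smul, map_smul]
  rfl

/-- At an eigenvalue the numerator is the adjugate of `M(z) - w` between a surjection and an
injection, so it vanishes only with the adjugate. That would make `M(z)` the scalar `w`. -/
theorem resolventNum_ne_zero {w z : ℂ} (h0 : charPoly₂ (monodromy A z) w = 0)
    (hm : ∃ d, monodromy A z d ≠ w • d) : resolventNum A w z ≠ 0 := by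
  intro hN
  obtain ⟨d, hd⟩ := hm
  have hadj : ∀ c, monodromy A z c = (trace₂ (monodromy A z) - w) • c := by
    intro c
    obtain ⟨g, rfl⟩ := inhomBoundary_surjective A z c
    have h := resolventNum_apply A w z g
    rw [hN, h0, zero_smul, map_zero, map_zero, sub_zero] at h
    have h' := solOp_constVec_injective A z (a₁ := 0) (by
      simp only [map_zero]
      exact h)
    exact (sub_eq_zero.1 h'.symm).symm
  refine hd ?_
  have h2 : trace₂ (monodromy A z) = 2 * (trace₂ (monodromy A z) - w) := by
    conv_lhs => rw [trace₂, entry, entry, hadj, hadj]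
    simp
    ring
  rw [hadj d]
  congr 1
  linear_combination -h2

/-- At a scalar monodromy matrix the trace is critical. -/
theorem deriv_trace_eq_zero (hdet : ∀ z, det₂ (monodromy A z) = 1) {w z : ℂ}
    (hm : ∀ d, monodromy A z d = w • d) : deriv (fun z => trace₂ (monodromy A z)) z = 0 := by
  have h (i j : Fin 2) := (differentiable_entry A i j z).hasDerivAt
  have h1 := ((h 0 0).fun_mul (h 1 1)).fun_sub ((h 0 1).fun_mul (h 1 0))
  have h2 : (fun z => entry (monodromy A z) 0 0 * entry (monodromy A z) 1 1 -
      entry (monodromy A z) 0 1 * entry (monodromy A z) 1 0) = fun _ => 1 := funext hdet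
  rw [h2] at h1
  -- Differentiating `det M = 1` where `M` is the scalar `w` leaves `w · (tr M)' = 0`.
  have h3 := h1.unique (hasDerivAt_const z 1)
  have e (i j : Fin 2) : entry (monodromy A z) i j = if i = j then w else 0 := by
    rw [entry, hm]
    simp [PiLp.single_apply]
  have hw : w * w = 1 := by
    have := hdet z
    simpa [det₂, e] using this
  simp only [e] at h3
  simp at h3
  have h4 : HasDerivAt (fun z => trace₂ (monodromy A z)) _ z := (h 0 0).fun_add (h 1 1)
  rw [h4.deriv]
  have hw0 : w ≠ 0 := left_ne_zero_of_mul_eq_one hw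
  apply mul_left_cancel₀ hw0
  linear_combination h3

end Abstract

/-- The coefficient `J Q`. -/
noncomputable def coeffLp (p q : ℝ → ℂ) (hp : MemLp p ∞ periodMeasure)
    (hq : MemLp q ∞ periodMeasure) : Lp (Vec →L[ℂ] Vec) ∞ periodMeasure :=
  (memLp_jMat_potential hp hq).toLp

/-- The Floquet multiplier `exp(iπt)`. -/
noncomputable def multiplier (t : ℝ) : ℂ := Complex.exp (Complex.I * Real.pi * t)

theorem norm_multiplier (t : ℝ) : ‖multiplier t‖ = 1 := by
  rw [multiplier, Complex.norm_exp]
  simp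

theorem multiplier_ne_zero (t : ℝ) : multiplier t ≠ 0 := Complex.exp_ne_zero _

theorem continuous_multiplier : Continuous multiplier := by
  unfold multiplier
  fun_prop

theorem multiplier_sq_add_one (t : ℝ) :
    multiplier t ^ 2 + 1 = multiplier t * (2 * Real.cos (Real.pi * t) : ℝ) := by
  have h : Complex.exp (Complex.I * Real.pi * t) * Complex.exp (-(Real.pi * t) * Complex.I) = 1 := by
    rw [← Complex.exp_add, ← Complex.exp_zero]
    congr 1
    ring
  push_cast
  rw [Complex.two_cos, multiplier, show (Real.pi * t : ℂ) * Complex.I = Complex.I * Real.pi * t by ring]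
  linear_combination -h

variable {p q : ℝ → ℂ} (hp : MemLp p ∞ periodMeasure) (hq : MemLp q ∞ periodMeasure)

theorem coeFn_coeffLp : coeffLp p q hp hq =ᵐ[periodMeasure] fun x => jMat ∘L potential p q x :=
  (memLp_jMat_potential hp hq).coeFn_toLp

theorem trace_coeffLp : ∀ᵐ x ∂periodMeasure, trace₂ (coeffLp p q hp hq x) = 0 := by
  filter_upwards [coeFn_coeffLp hp hq] with x hx
  rw [hx]
  simp [trace₂, entry, jMat_apply_zero, jMat_apply_one, potential_apply_zero, potential_apply_one]

/-- Solving for the derivative gives `v = J Q f - J h` a.e., which is in `L²` because `Q` is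
bounded. The domain can thus be described by `L²` classes and the Volterra operator alone. -/
theorem mem_blochOp_iff (t : ℝ) (f h : L2Period) : (f, h) ∈ blochOp p q t ↔
    ∃ c, IsQuasiPeriodicSolution (coeffLp p q hp hq) (multiplier t) c f h := by
  have hgen : (matMul (coeffLp p q hp hq) f - jMul h : L2Period) =ᵐ[periodMeasure]
      fun x => jMat (potential p q x (f x)) - jMat (h x) := by
    filter_upwards [Lp.coeFn_sub (matMul (coeffLp p q hp hq) f) (jMul h),
      coeFn_matMul (coeffLp p q hp hq) f, coeFn_jMul h, coeFn_coeffLp hp hq] with x h1 h2 h3 h4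
    rw [h1, Pi.sub_apply, h2, h3, h4]
    rfl
  constructor
  · rintro ⟨y, v, hv, hy, hb, hf, hh⟩
    simp only at hf hh
    have hae : (matMul (coeffLp p q hp hq) f - jMul h : L2Period) =ᵐ[periodMeasure] v := by
      filter_upwards [hgen, hf, hh] with x h1 h2 h3
      rw [h1, h2, (eq_diracExpr_iff p q x _ _ _).1 h3]
    refine ⟨y 0, ?_, ?_⟩
    · apply Lp.ext
      filter_upwards [hf, Lp.coeFn_add (constVec (y 0)) (volterra
        (matMul (coeffLp p q hp hq) f - jMul h)), coeFn_constVec (y 0),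
        coeFn_volterra (matMul (coeffLp p q hp hq) f - jMul h),
        ae_restrict_mem measurableSet_Icc] with x h1 h2 h3 h4 h5
      rw [h1, h2, Pi.add_apply, h3, h4, integral_congr_period hae h5, hy x h5]
    · have hpi : Real.pi ∈ Icc 0 Real.pi := right_mem_Icc.2 Real.pi_pos.le
      rw [periodIntegral_apply, integral_congr_period hae hpi, sub_smul, one_smul]
      exact eq_sub_of_add_eq' ((hy _ hpi).symm.trans hb)
  · rintro ⟨c, hf, hc⟩
    refine ⟨fun x => c + ∫ s in (0 : ℝ)..x, (matMul (coeffLp p q hp hq) f - jMul h : L2Period) s,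
      (matMul (coeffLp p q hp hq) f - jMul h : L2Period), L2Period.intervalIntegrable _,
      fun x _ => by simp, ?_, ae_eq_primitive hf, ?_⟩
    · change c + periodIntegral (matMul (coeffLp p q hp hq) f - jMul h) = multiplier t • _
      simp only [intervalIntegral.integral_same, add_zero]
      rw [hc, sub_smul, one_smul, add_sub_cancel]
    · filter_upwards [hgen, ae_eq_primitive hf] with x h1 h2
      rw [eq_diracExpr_iff, h1, ← h2]

theorem isResolventPencil_blochOp (t : ℝ) : IsResolventPencil (blochOp p q t)
    (resolventNum (coeffLp p q hp hq) (multiplier t))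
    (fun z => charPoly₂ (monodromy (coeffLp p q hp hq) z) (multiplier t)) where
  differentiable_num := differentiable_resolventNum _ _
  differentiable_den := differentiable_charPoly _ _
  right_inv z g := by
    rw [mem_blochOp_iff hp hq]
    refine ⟨(trace₂ (monodromy (coeffLp p q hp hq) z) - multiplier t) •
      inhomBoundary (coeffLp p q hp hq) z g - monodromy (coeffLp p q hp hq) z
        (inhomBoundary (coeffLp p q hp hq) z g), ?_⟩
    rw [add_comm, isQuasiPeriodicSolution_iff]
    refine ⟨resolventNum_apply _ _ _ _, ?_⟩
    rw [sub_smul_adjugate, map_smul]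
  left_inv z f h hfh := by
    obtain ⟨c, hc⟩ := (mem_blochOp_iff hp hq t f h).1 hfh
    obtain ⟨g, rfl⟩ : ∃ g, h = z • f + g := ⟨h - z • f, by abel⟩
    obtain ⟨h1, h2⟩ := (isQuasiPeriodicSolution_iff _ _ _ _ _ _).1 hc
    rw [add_sub_cancel_left, resolventNum_apply, ← h2, adjugate_sub_smul, map_smul, map_smul,
      map_smul, ← smul_sub, map_smul, ← h1]

theorem mem_blochOp_eigen_iff (t : ℝ) (z : ℂ) (f : L2Period) : (f, z • f) ∈ blochOp p q t ↔
    ∃ c, f = solOp (coeffLp p q hp hq) z (constVec c) ∧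
      monodromy (coeffLp p q hp hq) z c = multiplier t • c := by
  rw [mem_blochOp_iff hp hq]
  refine exists_congr fun c => ?_
  have := isQuasiPeriodicSolution_iff (coeffLp p q hp hq) (multiplier t) z c f 0
  rw [add_zero, map_zero, map_zero, map_zero, sub_zero, sub_eq_zero] at this
  exact this

/-- The continuous representative vanishes at `0`, so `c = 0`; then `volterra_injective` applies. -/
theorem eq_zero_of_constVec_add_volterra {c : Vec} {v : L2Period}
    (h : 0 = constVec c + volterra v) : v = 0 := by
  have hae : (fun x => c + ∫ s in (0 : ℝ)..x, v s) =ᵐ[periodMeasure] fun _ => (0 : Vec) := by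
    filter_upwards [ae_eq_primitive h, Lp.coeFn_zero Vec 2 periodMeasure] with x h1 h2
    rw [← h1, h2, Pi.zero_apply]
  have h0 := Measure.eqOn_Icc_of_ae_eq volume Real.pi_pos.ne hae
    (continuousOn_const.add (continuousOn_primitive_period v.intervalIntegrable)) continuousOn_const
    (left_mem_Icc.2 Real.pi_pos.le)
  have hc : c = 0 := by simpa using h0
  rw [hc, map_zero, zero_add] at h
  exact volterra_injective (by rw [← h, map_zero])

theorem eq_zero_of_mem_blochOp (hp : MemLp p ∞ periodMeasure) (hq : MemLp q ∞ periodMeasure) (t : ℝ)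
    {h : L2Period} (hh : (0, h) ∈ blochOp p q t) : h = 0 := by
  obtain ⟨c, hc, -⟩ := (mem_blochOp_iff hp hq t 0 h).1 hh
  have hv := eq_zero_of_constVec_add_volterra hc
  rw [map_zero, zero_sub, neg_eq_zero] at hv
  have := jMul_jMul h
  rwa [hv, map_zero, eq_comm, neg_eq_zero] at this

/-- The Hill discriminant: the trace of the monodromy matrix. -/
noncomputable def discriminant (z : ℂ) : ℂ := trace₂ (monodromy (coeffLp p q hp hq) z)

theorem differentiable_discriminant : Differentiable ℂ (discriminant hp hq) :=
  differentiable_trace _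

theorem charPoly_eq (t : ℝ) (z : ℂ) :
    charPoly₂ (monodromy (coeffLp p q hp hq) z) (multiplier t) =
      -multiplier t * (discriminant hp hq z - (2 * Real.cos (Real.pi * t) : ℝ)) := by
  rw [charPoly₂, det_monodromy _ (trace_coeffLp hp hq)]
  rw [discriminant]
  linear_combination multiplier_sq_add_one t

theorem charPoly_eq_zero_iff (t : ℝ) (z : ℂ) :
    charPoly₂ (monodromy (coeffLp p q hp hq) z) (multiplier t) = 0 ↔
      discriminant hp hq z = (2 * Real.cos (Real.pi * t) : ℝ) := by
  rw [charPoly_eq, mul_eq_zero, neg_eq_zero, or_iff_right (multiplier_ne_zero t), sub_eq_zero]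

theorem deriv_charPoly (t : ℝ) (z : ℂ) :
    deriv (fun z => charPoly₂ (monodromy (coeffLp p q hp hq) z) (multiplier t)) z =
      -multiplier t * deriv (discriminant hp hq) z := by
  simp only [charPoly_eq]
  rw [deriv_const_mul _ ((differentiable_discriminant hp hq z).sub_const _), deriv_sub_const]

theorem isEigenvalue_iff (t : ℝ) (z : ℂ) : IsEigenvalue (blochOp p q t) z ↔
    discriminant hp hq z = (2 * Real.cos (Real.pi * t) : ℝ) := by
  rw [← charPoly_eq_zero_iff]
  refine ⟨fun h => (isResolventPencil_blochOp hp hq t).den_eq_zero h, fun h => ?_⟩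
  obtain ⟨c, hc, hm⟩ := exists_eigenvector₂ h
  refine ⟨solOp (coeffLp p q hp hq) z (constVec c), fun h0 => hc ?_,
    (mem_blochOp_eigen_iff hp hq t z _).2 ⟨c, rfl, hm⟩⟩
  exact solOp_constVec_injective (coeffLp p q hp hq) z (by simpa using h0)

/-- The discriminant does not take the value `2 cos πt` far away from the real axis. -/
theorem exists_charPoly_ne_zero (t : ℝ) :
    ∃ z, charPoly₂ (monodromy (coeffLp p q hp hq) z) (multiplier t) ≠ 0 := by
  -- A point of the imaginary axis just above the bound of `im_le_of_quasiPeriodic`.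
  refine ⟨((‖jMul ∘L matMul (coeffLp p q hp hq)‖ + 1 : ℝ) : ℂ) * Complex.I, fun h => ?_⟩
  obtain ⟨f, hf, hT⟩ := (isEigenvalue_iff hp hq t _).2 ((charPoly_eq_zero_iff hp hq t _).1 h)
  obtain ⟨c, hc⟩ := (mem_blochOp_iff hp hq t _ _).1 hT
  have := im_le_of_quasiPeriodic _ (norm_multiplier t) hc hf
  rw [Complex.im_ofReal_mul, Complex.I_im, mul_one] at this
  linarith

/-- `D' ≠ 0` excludes a scalar monodromy matrix (`deriv_trace_eq_zero`), and a non-scalar 2×2 matrix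
has one-dimensional eigenspaces. -/
theorem exists_eq_smul_of_deriv_ne_zero {t : ℝ} {z : ℂ} (hd : deriv (discriminant hp hq) z ≠ 0)
    {f : L2Period} (hf : f ≠ 0) (hfT : (f, z • f) ∈ blochOp p q t) {g : L2Period}
    (hg : (g, z • g) ∈ blochOp p q t) : ∃ k : ℂ, g = k • f := by
  obtain ⟨c, rfl, hc⟩ := (mem_blochOp_eigen_iff hp hq t z f).1 hfT
  obtain ⟨d, rfl, hd'⟩ := (mem_blochOp_eigen_iff hp hq t z g).1 hg
  have hc0 : c ≠ 0 := by
    rintro rfl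
    simp at hf
  have hns : ∃ e, monodromy (coeffLp p q hp hq) z e ≠ multiplier t • e := by
    by_contra! h
    exact hd (deriv_trace_eq_zero _ (det_monodromy _ (trace_coeffLp hp hq)) h)
  obtain ⟨k, rfl⟩ := eq_smul_of_eigenvectors₂ hc0 hc hns hd'
  exact ⟨k, by rw [map_smul, map_smul]⟩

/-- If `M(z)` is not the scalar `w`, the numerator is nonzero and the double zero of `Δ` yields an
associated vector. If it is, the two basis vectors yield independent eigenfunctions. -/
theorem isMultipleEigenvalue_of_deriv_eq_zero {t : ℝ} {z : ℂ}
    (hz : discriminant hp hq z = (2 * Real.cos (Real.pi * t) : ℝ))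
    (hd : deriv (discriminant hp hq) z = 0) : IsMultipleEigenvalue (blochOp p q t) z := by
  have P := isResolventPencil_blochOp hp hq t
  obtain ⟨z₁, hz₁⟩ := exists_charPoly_ne_zero hp hq t
  have h0 := (charPoly_eq_zero_iff hp hq t z).2 hz
  by_cases hm : ∃ d, monodromy (coeffLp p q hp hq) z d ≠ multiplier t • d
  · exact P.isMultipleEigenvalue h0 (by rw [deriv_charPoly, hd, mul_zero]) hz₁
      (resolventNum_ne_zero _ h0 hm) fun h hh =>
        eq_zero_of_mem_blochOp hp hq t hh
  · push Not at hm
    refine ⟨(isEigenvalue_iff hp hq t z).2 hz, ?_⟩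
    let e (j : Fin 2) : Vec := EuclideanSpace.single j 1
    have he (j : Fin 2) : solOp (coeffLp p q hp hq) z (constVec (e j)) ∈
        rootKer (blochOp p q t) z 1 :=
      mem_rootKer_one.2 ((mem_blochOp_eigen_iff hp hq t z _).2 ⟨e j, rfl, hm _⟩)
    refine two_le_algMultiplicity (he 0) (he 1) ?_
    have hinj := solOp_constVec_injective (coeffLp p q hp hq) z
    rw [LinearIndependent.pair_iff]
    intro a b hab
    have h := hinj (a₁ := a • e 0 + b • e 1) (a₂ := 0) (by simpa using hab)
    have h0 := congrArg (fun v : Vec => v 0) h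
    have h1 := congrArg (fun v : Vec => v 1) h
    simp [e] at h0 h1
    exact ⟨h0, h1⟩

theorem algMultiplicity_le_one_of_deriv_ne_zero {z : ℂ} (hd : deriv (discriminant hp hq) z ≠ 0)
    (t : ℝ) : algMultiplicity (blochOp p q t) z ≤ 1 := by
  have P := isResolventPencil_blochOp hp hq t
  by_cases h0 : charPoly₂ (monodromy (coeffLp p q hp hq) z) (multiplier t) = 0
  · obtain ⟨f, hf, hfT⟩ := (isEigenvalue_iff hp hq t z).2 ((charPoly_eq_zero_iff hp hq t z).1 h0)
    refine P.algMultiplicity_le_one h0 ?_ fun g hg =>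
      exists_eq_smul_of_deriv_ne_zero hp hq hd hf hfT hg
    rw [deriv_charPoly]
    exact mul_ne_zero (neg_ne_zero.2 (multiplier_ne_zero t)) hd
  · rw [P.algMultiplicity_eq_zero h0]
    exact zero_le_one

theorem one_div_norm_inner_eq {t : ℝ} {z : ℂ} (hd : deriv (discriminant hp hq) z ≠ 0)
    {Ψ Ψs : L2Period} (hΨ : IsEigenvector (blochOp p q t) z Ψ) (hn : ‖Ψ‖ = 1)
    (hΨs : IsEigenvector (blochOp p q t).adjoint (starRingEnd ℂ z) Ψs) (hns : ‖Ψs‖ = 1) :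
    1 / ‖inner ℂ Ψs Ψ‖ = ‖resolventNum (coeffLp p q hp hq) (multiplier t) z‖ /
      ‖deriv (discriminant hp hq) z‖ := by
  have P := isResolventPencil_blochOp hp hq t
  have hd' : deriv (fun z => charPoly₂ (monodromy (coeffLp p q hp hq) z) (multiplier t)) z ≠ 0 := by
    rw [deriv_charPoly]
    exact mul_ne_zero (neg_ne_zero.2 (multiplier_ne_zero t)) hd
  rw [P.one_div_norm_inner_eq (P.den_eq_zero ⟨Ψ, hΨ⟩) hd' hn hΨs.2 hns
    fun f hf => exists_eq_smul_of_deriv_ne_zero hp hq hd hΨ.1 hΨ.2 hf, deriv_charPoly, norm_mul,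
    norm_neg, norm_multiplier, one_mul]

end BlochOperators

/-! ### Contour integrals of the resolvents -/

section ContourIntegrals

variable {p q : ℝ → ℂ} (hp : MemLp p ∞ periodMeasure) (hq : MemLp q ∞ periodMeasure)

theorem opResolvent_blochOp {t : ℝ} {z : ℂ}
    (hz : discriminant hp hq z ≠ (2 * Real.cos (Real.pi * t) : ℝ)) :
    opResolvent (blochOp p q t) z = (charPoly₂ (monodromy (coeffLp p q hp hq) z) (multiplier t))⁻¹ •
      resolventNum (coeffLp p q hp hq) (multiplier t) z :=
  ((isResolventPencil_blochOp hp hq t).isResolventAt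
    (mt (charPoly_eq_zero_iff hp hq t z).1 hz)).opResolvent_eq

theorem mem_opResolventSet_blochOp {t : ℝ} {z : ℂ} : z ∈ opResolventSet (blochOp p q t) ↔
    discriminant hp hq z ≠ (2 * Real.cos (Real.pi * t) : ℝ) := by
  refine ⟨fun h hz => ((isEigenvalue_iff hp hq t z).2 hz).notMem_opResolventSet h, fun hz => ?_⟩
  exact ((isResolventPencil_blochOp hp hq t).isResolventAt
    (mt (charPoly_eq_zero_iff hp hq t z).1 hz)).mem_opResolventSet

theorem contourProjection_eq_zero {t : ℝ} {γ : ℝ → ℂ} (hγ : IsContour γ) {c : ℂ} {r : ℝ}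
    (hball : ∀ s ∈ Icc (0 : ℝ) 1, γ s ∈ Metric.ball c r)
    (hD : ∀ z ∈ Metric.ball c r, discriminant hp hq z ≠ (2 * Real.cos (Real.pi * t) : ℝ)) :
    contourProjection p q t γ = 0 := by
  have h := hγ.integral_eq_zero hball (f := fun z =>
    (charPoly₂ (monodromy (coeffLp p q hp hq) z) (multiplier t))⁻¹ •
      resolventNum (coeffLp p q hp hq) (multiplier t) z)
    (((differentiable_charPoly _ _).differentiableOn.inv fun z hz =>
      mt (charPoly_eq_zero_iff hp hq t z).1 (hD z hz)).smul
        (differentiable_resolventNum _ _).differentiableOn)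
  rw [contourProjection, ← h]
  refine intervalIntegral.integral_congr fun s hs => ?_
  rw [uIcc_of_le zero_le_one] at hs
  rw [opResolvent_blochOp hp hq (hD _ (hball s hs))]

/-- The residue theorem. Injectivity of `D` makes `z` the only zero of `Δ` in the disk, and it is
simple, so `Δ(w) / (w - z)` extends to a nonvanishing holomorphic function. -/
theorem contourProjection_eq {t : ℝ} {γ : ℝ → ℂ} (hγ : IsContour γ) {c : ℂ} {r : ℝ}
    (hball : ∀ s ∈ Icc (0 : ℝ) 1, γ s ∈ Metric.ball c r)
    (hinj : InjOn (discriminant hp hq) (Metric.ball c r)) {z : ℂ} (hz : z ∈ Metric.ball c r)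
    (hd : deriv (discriminant hp hq) z ≠ 0)
    (hzt : discriminant hp hq z = (2 * Real.cos (Real.pi * t) : ℝ))
    (hγz : ∀ s ∈ Icc (0 : ℝ) 1, γ s ≠ z) :
    contourProjection p q t γ = (2 * Real.pi * Complex.I * windingNumber γ z) •
      (-multiplier t * deriv (discriminant hp hq) z)⁻¹ •
        resolventNum (coeffLp p q hp hq) (multiplier t) z := by
  set Δ : ℂ → ℂ := fun z => charPoly₂ (monodromy (coeffLp p q hp hq) z) (multiplier t) with hΔ
  have hΔd : Differentiable ℂ Δ := differentiable_charPoly _ _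
  have hΔz : Δ z = 0 := (charPoly_eq_zero_iff hp hq t z).2 hzt
  have hΔ' : deriv Δ z = -multiplier t * deriv (discriminant hp hq) z := deriv_charPoly hp hq t z
  have hne : ∀ w ∈ Metric.ball c r, w ≠ z → discriminant hp hq w ≠ (2 * Real.cos (Real.pi * t) : ℝ) :=
    fun w hw hwz h => hwz (hinj hw hz (h.trans hzt.symm))
  have hslope : ∀ w ∈ Metric.ball c r, dslope Δ z w ≠ 0 := by
    intro w hw
    by_cases hwz : w = z
    · rw [hwz, dslope_same, hΔ']
      exact mul_ne_zero (neg_ne_zero.2 (multiplier_ne_zero t)) hd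
    · intro h
      have := sub_smul_dslope Δ z w
      rw [h, smul_zero, hΔz, sub_zero] at this
      exact hne w hw hwz ((charPoly_eq_zero_iff hp hq t w).1 this.symm)
  have hsd : DifferentiableOn ℂ (dslope Δ z) (Metric.ball c r) :=
    (Complex.differentiableOn_dslope (Metric.isOpen_ball.mem_nhds hz)).2 hΔd.differentiableOn
  have h := hγ.integral_sub_inv_smul hball (f := fun w => (dslope Δ z w)⁻¹ •
      resolventNum (coeffLp p q hp hq) (multiplier t) w)
    ((hsd.inv hslope).smul (differentiable_resolventNum _ _).differentiableOn) hz hγz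
  simp only [dslope_same, hΔ'] at h
  rw [contourProjection, ← h]
  refine intervalIntegral.integral_congr fun s hs => ?_
  rw [uIcc_of_le zero_le_one] at hs
  rw [opResolvent_blochOp hp hq (hne _ (hball s hs) (hγz s hs)), smul_smul (γ s - z)⁻¹, ← mul_inv]
  have := sub_smul_dslope Δ z (γ s)
  rw [hΔz, sub_zero, smul_eq_mul] at this
  rw [this]

theorem norm_contourProjection {t : ℝ} {γ : ℝ → ℂ} (hγ : IsContour γ) {c : ℂ} {r : ℝ}
    (hball : ∀ s ∈ Icc (0 : ℝ) 1, γ s ∈ Metric.ball c r)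
    (hinj : InjOn (discriminant hp hq) (Metric.ball c r)) {z : ℂ} (hz : z ∈ Metric.ball c r)
    (hd : deriv (discriminant hp hq) z ≠ 0)
    (hzt : discriminant hp hq z = (2 * Real.cos (Real.pi * t) : ℝ))
    (hγz : ∀ s ∈ Icc (0 : ℝ) 1, γ s ≠ z) :
    ‖contourProjection p q t γ‖ = 2 * Real.pi * ‖windingNumber γ z‖ *
      (‖resolventNum (coeffLp p q hp hq) (multiplier t) z‖ / ‖deriv (discriminant hp hq) z‖) := by
  rw [contourProjection_eq hp hq hγ hball hinj hz hd hzt hγz, norm_smul, norm_smul, norm_inv,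
    norm_mul, norm_mul, norm_mul, norm_mul (-multiplier t), norm_neg, norm_multiplier]
  have e : ‖(2 : ℂ)‖ * ‖(Real.pi : ℂ)‖ * ‖Complex.I‖ = 2 * Real.pi := by
    simp [abs_of_pos Real.pi_pos]
  rw [e]
  ring

theorem exists_ball_injOn {f : ℂ → ℂ} (hf : Differentiable ℂ f) {z : ℂ} (hd : deriv f z ≠ 0) :
    ∃ r > 0, InjOn f (Metric.ball z r) ∧ ∀ w ∈ Metric.closedBall z r, deriv f w ≠ 0 := by
  have hs : HasStrictDerivAt f (deriv f z) z := (hf.analyticAt z).hasStrictDerivAt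
  have hs' := hs.hasStrictFDerivAt_equiv hd
  have h1 : (hs'.toOpenPartialHomeomorph f).source ∈ 𝓝 z := hs'.mem_toOpenPartialHomeomorph_source |>
    (hs'.toOpenPartialHomeomorph f).open_source.mem_nhds
  have h2 : {w | deriv f w ≠ 0} ∈ 𝓝 z :=
    (hf.analyticAt z).deriv.continuousAt.eventually_ne hd
  obtain ⟨r, hr, h⟩ := Metric.nhds_basis_closedBall.mem_iff.1 (inter_mem h1 h2)
  refine ⟨r, hr, ?_, fun w hw => (h hw).2⟩
  exact (hs'.toOpenPartialHomeomorph f).injOn.mono fun w hw =>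
    (h (Metric.ball_subset_closedBall hw)).1

/-- A point where the discriminant is locally injective is not a spectral singularity. -/
theorem deriv_eq_zero_of_isSpectralSingularity {lam : ℂ} (h : IsSpectralSingularity p q lam) :
    deriv (discriminant hp hq) lam = 0 := by
  by_contra hd
  obtain ⟨r, hr, hinj, hne⟩ := exists_ball_injOn (differentiable_discriminant hp hq) hd
  have hderiv : Continuous (deriv (discriminant hp hq)) :=
    (differentiable_discriminant hp hq).contDiff.continuous_deriv (n := 1) le_rfl
  -- All multipliers lie on the unit circle, so one constant bounds `‖N‖ / |D'|` for every `t` and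
  -- every eigenvalue in the disk.
  obtain ⟨C, hC⟩ := ((isCompact_sphere (0 : ℂ) 1).prod
    (isCompact_closedBall lam r)).exists_bound_of_continuousOn (f := fun x : ℂ × ℂ =>
      ‖resolventNum (coeffLp p q hp hq) x.1 x.2‖ / ‖deriv (discriminant hp hq) x.2‖)
    ((continuous_resolventNum _).norm.continuousOn.div
      (hderiv.comp continuous_snd).norm.continuousOn fun x hx => norm_ne_zero_iff.2 (hne _ hx.2))
  obtain ⟨γ, hγ, hlim⟩ := h.2 r hr
  have hlt : ENNReal.ofReal (2 * Real.pi * C) < ⊤ := ENNReal.ofReal_lt_top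
  obtain ⟨n, hn⟩ := (hlim.eventually_const_lt hlt).exists
  refine hn.not_ge (iSup_le fun t => iSup_le fun _ => iSup_le fun hres => ?_)
  rw [← ofReal_norm]
  obtain ⟨hcont, hball, -⟩ := hγ n
  by_cases hz : ∃ z ∈ Metric.ball lam r, discriminant hp hq z = (2 * Real.cos (Real.pi * t) : ℝ)
  · obtain ⟨z, hz, hzt⟩ := hz
    have hγz : ∀ s ∈ Icc (0 : ℝ) 1, γ n s ≠ z := fun s hs hsz =>
      (mem_opResolventSet_blochOp hp hq).1 (hres s hs) (hsz ▸ hzt)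
    have hz' := Metric.ball_subset_closedBall hz
    rw [norm_contourProjection hp hq hcont hball hinj hz (hne z hz') hzt hγz]
    refine ENNReal.ofReal_le_ofReal ?_
    have hCz := (Real.le_norm_self _).trans (hC (multiplier t, z) ⟨by simp [norm_multiplier], hz'⟩)
    have hw : ‖windingNumber (γ n) z‖ ≤ 1 := by
      have hzimg : z ∉ γ n '' Icc 0 1 := by
        rintro ⟨s, hs, hsz⟩
        exact hγz s hs hsz
      rcases hcont.positive z hzimg with h | h <;> simp [h]
    have h0 : 0 ≤ ‖resolventNum (coeffLp p q hp hq) (multiplier t) z‖ /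
      ‖deriv (discriminant hp hq) z‖ := by positivity
    have hpi := Real.pi_pos
    calc _ ≤ 2 * Real.pi * 1 * (‖resolventNum (coeffLp p q hp hq) (multiplier t) z‖ /
        ‖deriv (discriminant hp hq) z‖) := by gcongr
      _ ≤ 2 * Real.pi * 1 * C := by gcongr
      _ = 2 * Real.pi * C := by ring
  · push Not at hz
    rw [contourProjection_eq_zero hp hq hcont hball hz]
    simp

/-- If `D(lam)` is not in `[-2, 2]`, a whole disk around `lam` is free of Bloch eigenvalues and all
contour integrals in it vanish. -/
theorem exists_cos_eq_of_isSpectralSingularity {lam : ℂ} (h : IsSpectralSingularity p q lam) :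
    ∃ t ∈ Ioc (-1 : ℝ) 1, discriminant hp hq lam = (2 * Real.cos (Real.pi * t) : ℝ) := by
  by_contra! hne
  let K : Set ℂ := (fun x : ℝ => (x : ℂ)) '' Icc (-2) 2
  have hK : IsClosed K := (isCompact_Icc.image Complex.continuous_ofReal).isClosed
  have hlam : discriminant hp hq lam ∉ K := by
    rintro ⟨x, hx, hxl⟩
    have hpi := Real.pi_pos
    refine hne (Real.arccos (x / 2) / Real.pi) ⟨?_, ?_⟩ ?_
    · have : 0 ≤ Real.arccos (x / 2) / Real.pi := div_nonneg (Real.arccos_nonneg _) hpi.le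
      linarith
    · exact (div_le_one hpi).2 (Real.arccos_le_pi _)
    · rw [← hxl, mul_div_cancel₀ _ hpi.ne', Real.cos_arccos (by linarith [hx.1]) (by linarith [hx.2])]
      push_cast
      ring
  obtain ⟨r, hr, hball⟩ := Metric.mem_nhds_iff.1
    ((differentiable_discriminant hp hq).continuous.continuousAt.preimage_mem_nhds
      (hK.isOpen_compl.mem_nhds hlam))
  obtain ⟨γ, hγ, hlim⟩ := h.2 r hr
  obtain ⟨n, hn⟩ := (hlim.eventually_const_lt ENNReal.zero_lt_top).exists
  refine hn.not_ge (iSup_le fun t => iSup_le fun _ => iSup_le fun hres => ?_)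
  rw [← ofReal_norm, contourProjection_eq_zero hp hq (hγ n).1 (hγ n).2.1, norm_zero,
    ENNReal.ofReal_zero]
  intro z hz hzt
  refine hball hz ⟨2 * Real.cos (Real.pi * t), ⟨?_, ?_⟩, hzt.symm⟩
  · linarith [Real.neg_one_le_cos (Real.pi * t)]
  · linarith [Real.cos_le_one (Real.pi * t)]

theorem isMultipleEigenvalue_of_isSpectralSingularity (hp : MemLp p ∞ periodMeasure)
    (hq : MemLp q ∞ periodMeasure) {lam : ℂ} (h : IsSpectralSingularity p q lam) :
    ∃ t ∈ Ioc (-1 : ℝ) 1, IsMultipleEigenvalue (blochOp p q t) lam := by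
  obtain ⟨t, ht, hlam⟩ := exists_cos_eq_of_isSpectralSingularity hp hq h
  exact ⟨t, ht, isMultipleEigenvalue_of_deriv_eq_zero hp hq hlam
    (deriv_eq_zero_of_isSpectralSingularity hp hq h)⟩

/-- Small circles around simple eigenvalues with large spectral projections. -/
theorem exists_contours {lam : ℂ} {ε : ℝ}
    (h : ∀ n : ℕ, ∃ (t : ℝ) (z : ℂ), z ∈ Metric.ball lam ε ∧ deriv (discriminant hp hq) z ≠ 0 ∧
      discriminant hp hq z = (2 * Real.cos (Real.pi * t) : ℝ) ∧
      n ≤ ‖resolventNum (coeffLp p q hp hq) (multiplier t) z‖ / ‖deriv (discriminant hp hq) z‖) :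
    ∃ γ : ℕ → ℝ → ℂ,
    (∀ n, IsContour (γ n) ∧ (∀ s ∈ Icc (0 : ℝ) 1, γ n s ∈ Metric.ball lam ε) ∧
      ∀ t ∈ Ioc (-1 : ℝ) 1, EnclosesAtMostOne p q t (γ n)) ∧
    Tendsto (fun n => ⨆ (t : ℝ) (_ : t ∈ Ioc (-1 : ℝ) 1)
        (_ : ∀ s ∈ Icc (0 : ℝ) 1, γ n s ∈ opResolventSet (blochOp p q t)),
        ‖contourProjection p q t (γ n)‖ₑ) atTop (𝓝 (⊤ : ℝ≥0∞)) := by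
  choose t z hz hd hzt hn using h
  have hr : ∀ n, ∃ r > 0, InjOn (discriminant hp hq) (Metric.ball (z n) r) ∧
      (∀ w ∈ Metric.ball (z n) r, deriv (discriminant hp hq) w ≠ 0) ∧
      Metric.ball (z n) r ⊆ Metric.ball lam ε := by
    intro n
    obtain ⟨r, hr, h1, h2⟩ := exists_ball_injOn (differentiable_discriminant hp hq) (hd n)
    obtain ⟨r', hr', h3⟩ := Metric.isOpen_iff.1 Metric.isOpen_ball _ (hz n)
    refine ⟨min r r', lt_min hr hr', h1.mono (Metric.ball_subset_ball (min_le_left _ _)),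
      fun w hw => h2 w ?_, (Metric.ball_subset_ball (min_le_right _ _)).trans h3⟩
    exact Metric.ball_subset_closedBall (Metric.ball_subset_ball (min_le_left _ _) hw)
  choose r hr0 hinj hder hsub using hr
  have hγball : ∀ n, ∀ s ∈ Icc (0 : ℝ) 1, circlePath (z n) (r n / 2) s ∈ Metric.ball (z n) (r n) := by
    intro n s _
    have h := circlePath_mem_sphere (z n) (half_pos (hr0 n)).le s
    rw [Metric.mem_sphere] at h
    rw [Metric.mem_ball, h]
    linarith [hr0 n]
  have hγne : ∀ n, ∀ s ∈ Icc (0 : ℝ) 1, circlePath (z n) (r n / 2) s ≠ z n := by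
    intro n s _ hs
    have h := circlePath_mem_sphere (z n) (half_pos (hr0 n)).le s
    rw [Metric.mem_sphere, hs, dist_self] at h
    linarith [hr0 n]
  have hencl : ∀ n w, Encloses (circlePath (z n) (r n / 2)) w → w ∈ Metric.ball (z n) (r n) :=
    fun n w hw => Metric.ball_subset_ball (by linarith [hr0 n]) (hw.mem_ball (half_pos (hr0 n)))
  refine ⟨fun n => circlePath (z n) (r n / 2), fun n => ⟨isContour_circlePath _ (half_pos (hr0 n)),
    fun s hs => hsub n (hγball n s hs), fun t _ => ⟨fun w w' hw hw' he he' => ?_, fun w hw => ?_⟩⟩, ?_⟩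
  · exact hinj n (hencl n w hw) (hencl n w' hw')
      (((isEigenvalue_iff hp hq t w).1 he).trans ((isEigenvalue_iff hp hq t w').1 he').symm)
  · exact algMultiplicity_le_one_of_deriv_ne_zero hp hq (hder n w (hencl n w hw)) t
  refine tendsto_nhds_top_mono ENNReal.tendsto_nat_nhds_top (Eventually.of_forall fun n => ?_)
  -- The parameter of the branch may leave `(-1, 1]`. Multiplier and discriminant condition have
  -- period 2 in `t`, so it can be reduced to that interval.
  have hmod := toIocMod_mem_Ioc (two_pos : (0 : ℝ) < 2) (-1) (t n)
  set t' := toIocMod (two_pos : (0 : ℝ) < 2) (-1) (t n) with ht'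
  obtain ⟨k, hk⟩ : ∃ k : ℤ, t' = t n - k * 2 :=
    ⟨toIocDiv (two_pos : (0 : ℝ) < 2) (-1) (t n), by rw [ht', toIocMod, zsmul_eq_mul]⟩
  have hmult : multiplier t' = multiplier (t n) := by
    rw [multiplier, multiplier, hk]
    push_cast
    rw [show Complex.I * Real.pi * (t n - k * 2) =
      Complex.I * Real.pi * t n - k * (2 * Real.pi * Complex.I) by ring,
      Complex.exp_periodic.sub_int_mul_eq]
  have hcos : Real.cos (Real.pi * t') = Real.cos (Real.pi * t n) := by
    rw [hk, show Real.pi * (t n - k * 2) = Real.pi * t n - k * (2 * Real.pi) by ring,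
      Real.cos_periodic.sub_int_mul_eq]
  have hzt' : discriminant hp hq (z n) = (2 * Real.cos (Real.pi * t') : ℝ) := by rw [hzt, hcos]
  have hres : ∀ s ∈ Icc (0 : ℝ) 1,
      circlePath (z n) (r n / 2) s ∈ opResolventSet (blochOp p q t') := fun s hs =>
    (mem_opResolventSet_blochOp hp hq).2 fun h => hγne n s hs
      (hinj n (hγball n s hs) (Metric.mem_ball_self (hr0 n)) (h.trans hzt'.symm))
  refine le_trans ?_ (le_iSup_of_le t' (le_iSup_of_le ⟨hmod.1, by linarith [hmod.2]⟩
    (le_iSup_of_le hres le_rfl)))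
  rw [← ofReal_norm, norm_contourProjection hp hq (isContour_circlePath _ (half_pos (hr0 n)))
    (hγball n) (hinj n) (Metric.mem_ball_self (hr0 n)) (hd n) hzt' (hγne n), hmult,
    windingNumber_circlePath_of_mem_ball (Metric.mem_ball_self (half_pos (hr0 n))), norm_one, mul_one]
  simp only
  rw [← ENNReal.ofReal_natCast]
  -- The extra factor `2π` only helps, being at least 1.
  refine ENNReal.ofReal_le_ofReal ((hn n).trans (le_mul_of_one_le_left (by positivity) ?_))
  linarith [Real.pi_gt_three]

end ContourIntegrals

/-! ### Essential spectral singularities -/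

section Essential

/-- Where `sin πt₀ ≠ 0` the cosine has nonzero derivative. Where `sin πt₀ = 0` the sine has one, so
nearby `sin² > 0` and `cos² < 1 = cos² πt₀`. -/
theorem eventually_cos_ne (t₀ : ℝ) :
    ∀ᶠ t in 𝓝[≠] t₀, Real.cos (Real.pi * t) ≠ Real.cos (Real.pi * t₀) := by
  have hlin : HasDerivAt (fun t : ℝ => Real.pi * t) Real.pi t₀ := by
    simpa using (hasDerivAt_id t₀).const_mul Real.pi
  by_cases hs : Real.sin (Real.pi * t₀) = 0
  · have hc : Real.cos (Real.pi * t₀) ≠ 0 := by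
      intro hc
      have := Real.sin_sq_add_cos_sq (Real.pi * t₀)
      rw [hs, hc] at this
      norm_num at this
    filter_upwards [hlin.sin.eventually_ne (c := 0) (mul_ne_zero hc Real.pi_ne_zero)] with t ht h
    have h1 := Real.sin_sq_add_cos_sq (Real.pi * t)
    have h2 := Real.sin_sq_add_cos_sq (Real.pi * t₀)
    rw [h] at h1
    rw [hs] at h2
    exact ht (pow_eq_zero_iff two_ne_zero |>.1 (by linarith))
  · exact hlin.cos.eventually_ne (mul_ne_zero (neg_ne_zero.2 hs) Real.pi_ne_zero)

/-- The order of vanishing of `f - f z₀` and of `f'` at a point near which `f` is not constant. -/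
theorem exists_order_bounds {f : ℂ → ℂ} (hf : Differentiable ℂ f) {z₀ z₁ : ℂ} (hne : f z₁ ≠ f z₀) :
    ∃ m : ℕ, ∃ C > 0, ∃ K > 0, ∀ᶠ z in 𝓝 z₀, ‖f z - f z₀‖ ≤ C * ‖z - z₀‖ ^ (m + 1) ∧
      K * ‖z - z₀‖ ^ m ≤ ‖deriv f z‖ := by
  have han : AnalyticAt ℂ (fun z => f z - f z₀) z₀ := (hf.sub_const _).analyticAt z₀
  have hnz : ¬ ∀ᶠ z in 𝓝 z₀, f z - f z₀ = 0 := by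
    intro h
    have hon : AnalyticOnNhd ℂ (fun z => f z - f z₀) univ := fun z _ => (hf.sub_const _).analyticAt z
    have := hon.eqOn_zero_of_preconnected_of_eventuallyEq_zero isPreconnected_univ (mem_univ z₀) h
      (mem_univ z₁)
    exact hne (sub_eq_zero.1 this)
  obtain ⟨n, g, hg, hg0, hfg⟩ := han.exists_eventuallyEq_pow_smul_nonzero_iff.2 hnz
  obtain ⟨m, rfl⟩ : ∃ m, n = m + 1 := by
    refine Nat.exists_eq_succ_of_ne_zero fun hn => hg0 ?_
    have := hfg.self_of_nhds
    simpa [hn] using this.symm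
  -- From `f - f z₀ = (z - z₀) ^ (m + 1) g` one gets `f' = (z - z₀) ^ m k`, with `k z₀ = (m + 1) g
  -- z₀ ≠ 0`.
  set k : ℂ → ℂ := fun z => (m + 1) * g z + (z - z₀) * deriv g z with hk
  have hkc : ContinuousAt k z₀ := by
    have h1 := hg.continuousAt
    have h2 := hg.deriv.continuousAt
    fun_prop
  have hk0 : k z₀ ≠ 0 := by
    simp only [hk, sub_self, zero_mul, add_zero]
    exact mul_ne_zero (by exact_mod_cast m.succ_ne_zero) hg0
  have hd : ∀ᶠ z in 𝓝 z₀, deriv f z = (z - z₀) ^ m * k z := by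
    filter_upwards [hfg.eventually_nhds, hg.eventually_analyticAt] with z hz hgz
    have h1 : HasDerivAt (fun z => f z - f z₀) (deriv f z) z := (hf z).hasDerivAt.sub_const _
    have h2 : HasDerivAt (fun w => (w - z₀) ^ (m + 1) * g w)
        (((m + 1 : ℕ) * (z - z₀) ^ m * 1) * g z + (z - z₀) ^ (m + 1) * deriv g z) z :=
      (((hasDerivAt_id z).sub_const z₀).pow (m + 1)).mul hgz.differentiableAt.hasDerivAt
    rw [h1.unique (h2.congr_of_eventuallyEq hz)]
    simp only [hk]
    push_cast
    ring
  refine ⟨m, ‖g z₀‖ + 1, by positivity, ‖k z₀‖ / 2, by positivity, ?_⟩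
  filter_upwards [hfg, hd, hg.continuousAt.norm.eventually_lt_const (lt_add_one _),
    hkc.norm.eventually_const_lt (half_lt_self (norm_pos_iff.2 hk0))] with z h1 h2 h3 h4
  constructor
  · rw [h1, norm_smul, norm_pow, mul_comm]
    gcongr
  · rw [h2, norm_mul, norm_pow, mul_comm]
    gcongr

theorem integrableOn_Ioo_abs_rpow {r ε : ℝ} (hr : -1 < r) (hε : 0 < ε) (t₀ : ℝ) :
    IntegrableOn (fun t => |t - t₀| ^ r) (Ioo (t₀ - ε) (t₀ + ε)) := by
  have h0 : IntervalIntegrable (fun t : ℝ => |t| ^ r) volume 0 ε := by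
    refine (intervalIntegral.intervalIntegrable_rpow' hr (a := 0) (b := ε)).congr fun t ht => ?_
    rw [uIoc_of_le hε.le] at ht
    rw [abs_of_pos ht.1]
  have h1 : IntervalIntegrable (fun t : ℝ => |t| ^ r) volume (-ε) 0 := by
    have := (IntervalIntegrable.iff_comp_neg (f := fun t : ℝ => |t| ^ r)).1 h0
    simpa using this.symm
  have h2 := (h1.trans h0).comp_sub_right t₀
  rw [intervalIntegrable_iff_integrableOn_Ioo_of_le (by linarith)] at h2
  rwa [neg_add_eq_sub, add_comm ε] at h2

/-- Measurability of `h` comes from `R`: the eigenfunctions are chosen arbitrarily in `t`, so `1 /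
|α|` is under control only where it equals a continuous expression. The point `t₀` is null. -/
theorem integrableOn_of_punctured_bound {h R b : ℝ → ℝ} {t₀ ε : ℝ}
    (hR : ContinuousOn R (Ioo (t₀ - ε) (t₀ + ε) \ {t₀}))
    (hh : ∀ t ∈ Ioo (t₀ - ε) (t₀ + ε) \ {t₀}, h t = R t ∧ |R t| ≤ b t)
    (hb : IntegrableOn b (Ioo (t₀ - ε) (t₀ + ε))) : IntegrableOn h (Ioo (t₀ - ε) (t₀ + ε)) := by
  have hmeas : MeasurableSet (Ioo (t₀ - ε) (t₀ + ε) \ {t₀}) :=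
    measurableSet_Ioo.diff (measurableSet_singleton t₀)
  have hRi : IntegrableOn R (Ioo (t₀ - ε) (t₀ + ε) \ {t₀}) :=
    (hb.mono_set sdiff_subset).mono' (hR.aestronglyMeasurable hmeas)
      ((ae_restrict_iff' hmeas).2 (Eventually.of_forall fun t ht => (hh t ht).2))
  have hhi := hRi.congr_fun (fun t ht => (hh t ht).1.symm) hmeas
  refine hhi.congr_set_ae ?_
  exact (sdiff_ae_eq_self.2 (measure_mono_null inter_subset_right (by simp))).symm

variable {p q : ℝ → ℂ} (hp : MemLp p ∞ periodMeasure) (hq : MemLp q ∞ periodMeasure)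

/-- The reciprocal of the modulus of `α` along a branch of simple eigenvalues. -/
noncomputable def branchNorm (μ : ℝ → ℂ) (t : ℝ) : ℝ :=
  ‖resolventNum (coeffLp p q hp hq) (multiplier t) (μ t)‖ / ‖deriv (discriminant hp hq) (μ t)‖

/-- Data of a branch of eigenvalues at an essential spectral singularity. -/
structure IsEssentialBranch (lam : ℂ) (t₀ : ℝ) (μ : ℝ → ℂ) : Prop where
  mem : t₀ ∈ Ioc (-1 : ℝ) 1
  value : μ t₀ = lam
  continuousAt : ContinuousAt μ t₀
  discriminant_eq : ∀ᶠ t in 𝓝 t₀, discriminant hp hq (μ t) = (2 * Real.cos (Real.pi * t) : ℝ)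
  ne_zero : ∀ᶠ t in 𝓝[≠] t₀, deriv (discriminant hp hq) (μ t) ≠ 0
  not_bounded : ∀ b : ℝ → ℝ, (∀ᶠ t in 𝓝[≠] t₀, branchNorm hp hq μ t ≤ b t) →
    ∀ ε > 0, ¬ IntegrableOn b (Ioo (t₀ - ε) (t₀ + ε))

theorem exists_order_bounds_discriminant {lam : ℂ} {t₀ : ℝ}
    (h : discriminant hp hq lam = (2 * Real.cos (Real.pi * t₀) : ℝ)) :
    ∃ m : ℕ, ∃ C > 0, ∃ K > 0, ∀ᶠ z in 𝓝 lam,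
      ‖discriminant hp hq z - discriminant hp hq lam‖ ≤ C * ‖z - lam‖ ^ (m + 1) ∧
      K * ‖z - lam‖ ^ m ≤ ‖deriv (discriminant hp hq) z‖ := by
  obtain ⟨z₁, hz₁⟩ := exists_charPoly_ne_zero hp hq t₀
  refine exists_order_bounds (differentiable_discriminant hp hq) (z₁ := z₁) ?_
  rw [h]
  exact mt (charPoly_eq_zero_iff hp hq t₀ z₁).2 hz₁

theorem continuous_deriv_discriminant : Continuous (deriv (discriminant hp hq)) :=
  (differentiable_discriminant hp hq).contDiff.continuous_deriv (n := 1) le_rfl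

/-- For `t ≠ t₀` close to `t₀`, `cos πt ≠ cos πt₀` forces `μ(t) ≠ lam`, and zeros of `D'` are
isolated. So the branch is simple off `t₀`, where `1 / |α| = branchNorm`; an integrable majorant of
the latter would make `1 / |α|` integrable. -/
theorem IsEssentialSpectralSingularity.exists_branch {lam : ℂ}
    (h : IsEssentialSpectralSingularity p q lam) : ∃ t₀ μ, IsEssentialBranch hp hq lam t₀ μ := by
  obtain ⟨t₀, ht₀, μ, Ψ, Ψs, hμ, ⟨δ, hδ, hcont, hdata⟩, hint⟩ := h
  have hI : Ioo (t₀ - δ) (t₀ + δ) ∈ 𝓝 t₀ := Ioo_mem_nhds (by linarith) (by linarith)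
  have hD : ∀ t ∈ Ioo (t₀ - δ) (t₀ + δ),
      discriminant hp hq (μ t) = (2 * Real.cos (Real.pi * t) : ℝ) := fun t ht =>
    (isEigenvalue_iff hp hq t (μ t)).1 ⟨_, (hdata t ht).1⟩
  have hμc : ContinuousAt μ t₀ := hcont.continuousAt hI
  have hlam : discriminant hp hq lam = (2 * Real.cos (Real.pi * t₀) : ℝ) := by
    rw [← hμ]
    exact hD t₀ (mem_of_mem_nhds hI)
  obtain ⟨m, C, hC, K, hK, hmCK⟩ := exists_order_bounds_discriminant hp hq hlam
  have hne : ∀ᶠ t in 𝓝[≠] t₀, deriv (discriminant hp hq) (μ t) ≠ 0 := by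
    have h1 : ∀ᶠ t in 𝓝[≠] t₀, _ := (hμc.tendsto.eventually (hμ ▸ hmCK)).filter_mono nhdsWithin_le_nhds
    filter_upwards [h1, eventually_cos_ne t₀, mem_nhdsWithin_of_mem_nhds hI] with t h1 h2 h3 h0
    have h4 := h1.2
    rw [h0, norm_zero, hμ] at h4
    have hμt : μ t - lam ≠ 0 := by
      intro he
      have := hD t h3
      rw [sub_eq_zero.1 he, hlam] at this
      have := Complex.ofReal_injective this
      exact h2 (by linarith)
    have := norm_pos_iff.2 hμt
    have : 0 < K * ‖μ t - lam‖ ^ m := by positivity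
    linarith
  refine ⟨t₀, μ, ht₀, hμ, hμc, Filter.mem_of_superset hI hD, hne, fun b hb ε hε hbi => ?_⟩
  obtain ⟨η, hη, hηs⟩ := Metric.mem_nhdsWithin_iff.1 (inter_mem (inter_mem hne hb)
    (mem_nhdsWithin_of_mem_nhds (inter_mem hI (Ioo_mem_nhds (by linarith : t₀ - ε < t₀)
      (by linarith : t₀ < t₀ + ε)))))
  have hηs' : ∀ t ∈ Ioo (t₀ - η) (t₀ + η) \ {t₀}, _ := fun t ht =>
    hηs ⟨Metric.mem_ball.2 (by rw [Real.dist_eq, abs_lt]; constructor <;> linarith [ht.1.1, ht.1.2]),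
      ht.2⟩
  refine hint η hη (integrableOn_of_punctured_bound (R := branchNorm hp hq μ) (b := b) ?_ ?_ ?_)
  · intro t ht
    obtain ⟨⟨h1, h2⟩, h3, h4⟩ := hηs' t ht
    have hμt : ContinuousAt μ t := hcont.continuousAt (isOpen_Ioo.mem_nhds h3)
    have hN : ContinuousAt (fun t => resolventNum (coeffLp p q hp hq) (multiplier t) (μ t)) t :=
      ContinuousAt.comp (f := fun t => (multiplier t, μ t))
        (g := fun x : ℂ × ℂ => resolventNum (coeffLp p q hp hq) x.1 x.2)
        (continuous_resolventNum _).continuousAt (continuous_multiplier.continuousAt.prodMk hμt)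
    have hd : ContinuousAt (fun t => deriv (discriminant hp hq) (μ t)) t :=
      (continuous_deriv_discriminant hp hq).continuousAt.comp hμt
    exact (hN.norm.div hd.norm (norm_ne_zero_iff.2 h1)).continuousWithinAt
  · intro t ht
    obtain ⟨⟨h1, h2⟩, h3, h4⟩ := hηs' t ht
    obtain ⟨hΨ, hn, hΨs, hns⟩ := hdata t h3
    refine ⟨one_div_norm_inner_eq hp hq h1 hΨ hn hΨs hns, ?_⟩
    rwa [abs_of_nonneg (by unfold branchNorm; positivity)]
  · refine hbi.mono_set fun t ht => ?_
    by_cases htt : t = t₀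
    · rw [htt]
      exact ⟨by linarith, by linarith⟩
    · exact (hηs' t ⟨ht, htt⟩).2.2

namespace IsEssentialBranch

variable {hp hq} {lam : ℂ} {t₀ : ℝ} {μ : ℝ → ℂ}

theorem discriminant_value (h : IsEssentialBranch hp hq lam t₀ μ) :
    discriminant hp hq lam = (2 * Real.cos (Real.pi * t₀) : ℝ) := by
  rw [← h.value]
  exact h.discriminant_eq.self_of_nhds

theorem eventually_norm_num_le (h : IsEssentialBranch hp hq lam t₀ μ) : ∃ B > 0, ∀ᶠ t in 𝓝 t₀,
    ‖resolventNum (coeffLp p q hp hq) (multiplier t) (μ t)‖ ≤ B := by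
  have hN : ContinuousAt (fun t => resolventNum (coeffLp p q hp hq) (multiplier t) (μ t)) t₀ :=
    ContinuousAt.comp (f := fun t => (multiplier t, μ t))
      (g := fun x : ℂ × ℂ => resolventNum (coeffLp p q hp hq) x.1 x.2)
      (continuous_resolventNum _).continuousAt
      (continuous_multiplier.continuousAt.prodMk h.continuousAt)
  exact ⟨_, by positivity, (hN.norm.eventually_lt_const (lt_add_one _)).mono fun t ht => ht.le⟩

/-- Otherwise `branchNorm` would be bounded near `t₀`, with an integrable constant majorant. -/
theorem deriv_eq_zero (h : IsEssentialBranch hp hq lam t₀ μ) :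
    deriv (discriminant hp hq) lam = 0 := by
  by_contra hd
  obtain ⟨B, hB, hBt⟩ := h.eventually_norm_num_le
  have hdc : ContinuousAt (fun t => deriv (discriminant hp hq) (μ t)) t₀ :=
    (continuous_deriv_discriminant hp hq).continuousAt.comp h.continuousAt
  have hpos : 0 < ‖deriv (discriminant hp hq) (μ t₀)‖ := by
    rw [h.value]
    exact norm_pos_iff.2 hd
  refine h.not_bounded (fun _ => B / (‖deriv (discriminant hp hq) (μ t₀)‖ / 2)) ?_ 1 one_pos
    (integrableOn_const (by simp))
  filter_upwards [mem_nhdsWithin_of_mem_nhds hBt, mem_nhdsWithin_of_mem_nhds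
    (hdc.norm.eventually_const_lt (half_lt_self hpos))] with t h1 h2
  unfold branchNorm
  have h2' : ‖deriv (discriminant hp hq) (μ t₀)‖ / 2 ≤ ‖deriv (discriminant hp hq) (μ t)‖ := h2.le
  gcongr

theorem sin_eq_zero (h : IsEssentialBranch hp hq lam t₀ μ) : Real.sin (Real.pi * t₀) = 0 := by
  by_contra hs
  obtain ⟨B, hB, hBt⟩ := h.eventually_norm_num_le
  obtain ⟨m, C, hC, K, hK, hmCK⟩ := exists_order_bounds_discriminant hp hq h.discriminant_value
  have hmCK' : ∀ᶠ t in 𝓝 t₀, _ := h.continuousAt.tendsto.eventually (h.value.symm ▸ hmCK)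
  have hcos : HasDerivAt (fun t : ℝ => 2 * Real.cos (Real.pi * t))
      (2 * (-Real.sin (Real.pi * t₀) * Real.pi)) t₀ := by
    have hlin : HasDerivAt (fun t : ℝ => Real.pi * t) Real.pi t₀ := by
      simpa using (hasDerivAt_id t₀).const_mul Real.pi
    exact hlin.cos.const_mul 2
  set a : ℝ := |2 * (-Real.sin (Real.pi * t₀) * Real.pi)| with ha
  have ha0 : 0 < a := by
    rw [ha]
    exact abs_pos.2 (mul_ne_zero two_ne_zero (mul_ne_zero (neg_ne_zero.2 hs) Real.pi_ne_zero))
  have hslope := hcos.tendsto_slope.abs.eventually_const_lt (half_lt_self ha0)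
  -- From `k |t - t₀| ≤ |μ(t) - lam| ^ (m + 1)`, raising to the power `r` bounds `|μ(t) - lam| ^ m`,
  -- hence `|D'|`, from below. Since `r < 1`, the resulting majorant is integrable.
  set r : ℝ := (m : ℝ) / (m + 1) with hr
  have hr1 : -1 < -r := by
    rw [neg_lt_neg_iff, hr, div_lt_one (by positivity)]
    linarith
  set k : ℝ := a / 2 / C with hk
  have hk0 : 0 < k := by positivity
  refine h.not_bounded (fun t => B / (K * k ^ r) * |t - t₀| ^ (-r)) ?_ 1 one_pos
    ((integrableOn_Ioo_abs_rpow hr1 one_pos t₀).const_mul _)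
  filter_upwards [mem_nhdsWithin_of_mem_nhds hBt, mem_nhdsWithin_of_mem_nhds hmCK', hslope,
    mem_nhdsWithin_of_mem_nhds h.discriminant_eq, self_mem_nhdsWithin] with t h1 h2 h3 h4 h5
  rw [h.value] at h2
  have ht : 0 < |t - t₀| := abs_pos.2 (sub_ne_zero.2 h5)
  have h6 : a / 2 * |t - t₀| ≤ C * ‖μ t - lam‖ ^ (m + 1) := by
    refine le_trans ?_ h2.1
    rw [h4, h.discriminant_value, ← Complex.ofReal_sub, Complex.norm_real, Real.norm_eq_abs]
    rw [slope_def_field, abs_div, lt_div_iff₀ ht] at h3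
    exact h3.le
  have h7 : k * |t - t₀| ≤ ‖μ t - lam‖ ^ (m + 1) := by
    rw [hk, div_mul_eq_mul_div, div_le_iff₀ hC, mul_comm _ C]
    exact h6
  have h8 : (k * |t - t₀|) ^ r ≤ ‖μ t - lam‖ ^ m := by
    refine (Real.rpow_le_rpow (by positivity) h7 (by positivity)).trans_eq ?_
    rw [← Real.rpow_natCast, ← Real.rpow_mul (norm_nonneg _), hr, Nat.cast_add_one,
      mul_div_cancel₀ _ (by positivity), Real.rpow_natCast]
  have h9 : K * (k * |t - t₀|) ^ r ≤ ‖deriv (discriminant hp hq) (μ t)‖ :=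
    (mul_le_mul_of_nonneg_left h8 hK.le).trans h2.2
  calc branchNorm hp hq μ t ≤ B / (K * (k * |t - t₀|) ^ r) := by
        unfold branchNorm
        gcongr
    _ = B / (K * k ^ r) * |t - t₀| ^ (-r) := by
        rw [Real.mul_rpow hk0.le ht.le, Real.rpow_neg ht.le]
        field_simp

theorem eq_zero_or_eq_one (h : IsEssentialBranch hp hq lam t₀ μ) : t₀ = 0 ∨ t₀ = 1 := by
  obtain ⟨n, hn⟩ := Real.sin_eq_zero_iff.1 h.sin_eq_zero
  have hn' : (n : ℝ) = t₀ := mul_right_cancel₀ Real.pi_ne_zero (hn.trans (mul_comm _ _))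
  have h1 := h.mem
  rw [← hn'] at h1 ⊢
  have h2 : -1 < n := by exact_mod_cast h1.1
  have h3 : n ≤ 1 := by exact_mod_cast h1.2
  interval_cases n <;> simp

theorem isMultipleEigenvalue (h : IsEssentialBranch hp hq lam t₀ μ) :
    IsMultipleEigenvalue (blochOp p q 0) lam ∨ IsMultipleEigenvalue (blochOp p q 1) lam := by
  have := isMultipleEigenvalue_of_deriv_eq_zero hp hq h.discriminant_value h.deriv_eq_zero
  rcases h.eq_zero_or_eq_one with h | h
  · exact Or.inl (h ▸ this)
  · exact Or.inr (h ▸ this)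

/-- If `branchNorm` stayed below `n` near `t₀`, the constant `n` would be an integrable majorant. So
large values recur arbitrarily close to `t₀`, where the branch is simple and near `lam`. -/
theorem exists_large (h : IsEssentialBranch hp hq lam t₀ μ) {ε : ℝ} (hε : 0 < ε) (n : ℕ) :
    ∃ (t : ℝ) (z : ℂ), z ∈ Metric.ball lam ε ∧ deriv (discriminant hp hq) z ≠ 0 ∧
      discriminant hp hq z = (2 * Real.cos (Real.pi * t) : ℝ) ∧
      n ≤ ‖resolventNum (coeffLp p q hp hq) (multiplier t) z‖ /
        ‖deriv (discriminant hp hq) z‖ := by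
  have hfreq : ∃ᶠ t in 𝓝[≠] t₀, (n : ℝ) < branchNorm hp hq μ t := by
    intro hev
    refine h.not_bounded (fun _ => n) (hev.mono fun t ht => not_lt.1 ht) 1 one_pos
      (integrableOn_const (by simp))
  have hball : ∀ᶠ t in 𝓝 t₀, μ t ∈ Metric.ball lam ε :=
    h.continuousAt.preimage_mem_nhds (h.value.symm ▸ Metric.ball_mem_nhds lam hε)
  obtain ⟨t, h1, ⟨h2, h3⟩, h4⟩ := (hfreq.and_eventually
    (((hball.and h.discriminant_eq).filter_mono nhdsWithin_le_nhds).and h.ne_zero)).exists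
  exact ⟨t, μ t, h2, h4, h3, h1.le⟩

end IsEssentialBranch

end Essential

/-! ### The spectrum of the operator on the line -/

section Line

theorem norm_jMat (c : Vec) : ‖jMat c‖ = ‖c‖ := by
  rw [EuclideanSpace.norm_eq, EuclideanSpace.norm_eq]
  simp [Fin.sum_univ_two, jMat_apply_zero, jMat_apply_one, add_comm]

/-- A slowly decaying cutoff function. -/
noncomputable def cutoff (ε x : ℝ) : ℝ := (1 + (ε * x) ^ 2)⁻¹

/-- The derivative of the cutoff function. -/
noncomputable def cutoffDeriv (ε x : ℝ) : ℝ := -(2 * ε * (ε * x)) / (1 + (ε * x) ^ 2) ^ 2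

theorem cutoff_pos (ε x : ℝ) : 0 < cutoff ε x := by
  unfold cutoff
  positivity

theorem cutoff_le_one (ε x : ℝ) : cutoff ε x ≤ 1 :=
  inv_le_one_of_one_le₀ (by linarith [sq_nonneg (ε * x)])

theorem hasDerivAt_cutoff (ε x : ℝ) : HasDerivAt (cutoff ε) (cutoffDeriv ε x) x := by
  have h1 : HasDerivAt (fun x => 1 + (ε * x) ^ 2) (2 * ε * (ε * x)) x := by
    have h := (((hasDerivAt_id' x).const_mul ε).fun_pow 2).const_add 1
    refine h.congr_deriv ?_
    push_cast
    ring
  exact h1.fun_inv (by positivity)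

theorem continuous_cutoff (ε : ℝ) : Continuous (cutoff ε) :=
  continuous_iff_continuousAt.2 fun x => (hasDerivAt_cutoff ε x).continuousAt

theorem continuous_cutoffDeriv (ε : ℝ) : Continuous (cutoffDeriv ε) := by
  unfold cutoffDeriv
  exact Continuous.div (by fun_prop) (by fun_prop) fun x => by positivity

/-- This is `2 |s| ≤ 1 + s²` with `s = ε x`. A pointwise bound of the derivative by the cutoff
itself avoids any comparison of `L²` norms over different regions. -/
theorem abs_cutoffDeriv_le {ε : ℝ} (hε : 0 ≤ ε) (x : ℝ) :
    |cutoffDeriv ε x| ≤ ε * cutoff ε x := by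
  have h0 : 0 < 1 + (ε * x) ^ 2 := by positivity
  rw [cutoffDeriv, cutoff, abs_div, abs_neg, abs_mul, abs_mul, abs_of_pos (pow_pos h0 2),
    abs_of_nonneg hε, abs_two, div_le_iff₀ (pow_pos h0 2)]
  have : 2 * |ε * x| ≤ 1 + (ε * x) ^ 2 := by
    rw [← sq_abs (ε * x)]
    linarith [sq_nonneg (|ε * x| - 1)]
  calc 2 * ε * |ε * x| = ε * (2 * |ε * x|) := by ring
    _ ≤ ε * (1 + (ε * x) ^ 2) := by gcongr
    _ = ε * (1 + (ε * x) ^ 2)⁻¹ * (1 + (ε * x) ^ 2) ^ 2 := by field_simp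

theorem memLp_cutoff {ε : ℝ} (hε : 0 < ε) : MemLp (cutoff ε) 2 volume := by
  rw [memLp_two_iff_integrable_sq (continuous_cutoff ε).aestronglyMeasurable]
  have h : Integrable (cutoff ε) := integrable_inv_one_add_sq.comp_mul_left' hε.ne'
  refine h.mono ((continuous_cutoff ε).pow 2).aestronglyMeasurable (Eventually.of_forall fun x => ?_)
  rw [norm_pow, sq]
  refine mul_le_of_le_one_left (norm_nonneg _) ?_
  rw [Real.norm_of_nonneg (cutoff_pos ε x).le]
  exact cutoff_le_one ε x

/-- A quasi-periodic solution on the line of `J y' + Q y = lam y`. -/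
structure IsFloquetSolution (p q : ℝ → ℂ) (lam : ℂ) (Y V : ℝ → Vec) : Prop where
  integrable : ∀ a b, IntervalIntegrable V volume a b
  eq_primitive : ∀ x, Y x = Y 0 + ∫ s in (0 : ℝ)..x, V s
  equation : ∀ᵐ x, V x = jMat (potential p q x (Y x)) - lam • jMat (Y x)
  bounded : ∃ B, ∀ x, ‖Y x‖ ≤ B
  ne_zero : ¬ Y =ᵐ[volume] 0

theorem IsFloquetSolution.continuous {p q : ℝ → ℂ} {lam : ℂ} {Y V : ℝ → Vec}
    (h : IsFloquetSolution p q lam Y V) : Continuous Y := by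
  rw [funext h.eq_primitive]
  exact continuous_const.add (intervalIntegral.continuous_primitive h.integrable 0)

theorem IsFloquetSolution.mul_cutoff_eq {p q : ℝ → ℂ} {lam : ℂ} {Y V : ℝ → Vec}
    (h : IsFloquetSolution p q lam Y V) (ε x : ℝ) :
    (cutoff ε x : ℂ) • Y x = (cutoff ε 0 : ℂ) • Y 0 +
      ∫ s in (0 : ℝ)..x, ((cutoffDeriv ε s : ℂ) • Y s + (cutoff ε s : ℂ) • V s) := by
  have hφ' : IntervalIntegrable (fun s => (cutoffDeriv ε s : ℂ)) volume 0 x :=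
    (Complex.continuous_ofReal.comp (continuous_cutoffDeriv ε)).intervalIntegrable _ _
  have hφ : ∀ y, (cutoff ε 0 : ℂ) + ∫ s in (0 : ℝ)..y, (cutoffDeriv ε s : ℂ) = cutoff ε y := by
    intro y
    rw [intervalIntegral.integral_ofReal, intervalIntegral.integral_eq_sub_of_hasDerivAt
      (fun s _ => hasDerivAt_cutoff ε s) ((continuous_cutoffDeriv ε).intervalIntegrable _ _)]
    push_cast
    ring
  have hV := h.integrable 0 x
  have hint : IntervalIntegrable (fun s => (cutoffDeriv ε s : ℂ) • Y s + (cutoff ε s : ℂ) • V s)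
      volume 0 x :=
    (((Complex.continuous_ofReal.comp (continuous_cutoffDeriv ε)).smul
      h.continuous).intervalIntegrable _ _).add
      (hV.continuousOn_smul (Complex.continuous_ofReal.comp (continuous_cutoff ε)).continuousOn)
  ext i
  have key := integral_mul_primitive hφ' (Vec.intervalIntegrable_apply hV i) (cutoff ε 0 : ℂ) (Y 0 i)
    right_mem_uIcc
  have hY : ∀ y, Y 0 i + ∫ s in (0 : ℝ)..y, V s i = Y y i := by
    intro y
    rw [← Vec.integral_apply (h.integrable 0 y), ← PiLp.add_apply, ← h.eq_primitive]
  simp only [hφ, hY] at key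
  rw [PiLp.add_apply, Vec.integral_apply hint]
  simp only [PiLp.add_apply, PiLp.smul_apply, smul_eq_mul]
  rw [key]
  ring

/-- For `u = φ Y` with `φ` the cutoff, `(L - lam) u = φ' J Y` has norm at most `ε ‖u‖`. A bounded
resolvent `R` would give `‖u‖ ≤ ‖R‖ ε ‖u‖`, impossible once `‖R‖ ε < 1`. -/
theorem IsFloquetSolution.mem_opSpectrum {p q : ℝ → ℂ} {lam : ℂ} {Y V : ℝ → Vec}
    (h : IsFloquetSolution p q lam Y V) : lam ∈ opSpectrum (diracOp p q) := by
  rintro ⟨R, hR⟩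
  obtain ⟨B, hB⟩ := h.bounded
  set ε : ℝ := (2 * (‖R‖ + 1))⁻¹ with hε
  have hR1 : 0 < ‖R‖ + 1 := by positivity
  have hε0 : 0 < ε := by positivity
  have hc1 : Continuous fun x => (cutoff ε x : ℂ) :=
    Complex.continuous_ofReal.comp (continuous_cutoff ε)
  have hc2 : Continuous fun x => (cutoffDeriv ε x : ℂ) :=
    Complex.continuous_ofReal.comp (continuous_cutoffDeriv ε)
  have hu : MemLp (fun x => (cutoff ε x : ℂ) • Y x) 2 volume := by
    refine (memLp_cutoff hε0).of_le_mul (c := B) (hc1.smul h.continuous).aestronglyMeasurable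
      (Eventually.of_forall fun x => ?_)
    rw [norm_smul, Complex.norm_real, mul_comm]
    exact mul_le_mul_of_nonneg_right (hB x) (norm_nonneg _)
  have hbound : ∀ x, ‖(cutoffDeriv ε x : ℂ) • jMat (Y x)‖ ≤ ε * ‖(cutoff ε x : ℂ) • Y x‖ := by
    intro x
    rw [norm_smul, norm_smul, norm_jMat, Complex.norm_real, Complex.norm_real, Real.norm_eq_abs,
      Real.norm_eq_abs, ← mul_assoc, abs_of_pos (cutoff_pos ε x)]
    exact mul_le_mul_of_nonneg_right (abs_cutoffDeriv_le hε0.le x) (norm_nonneg _)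
  have hg : MemLp (fun x => (cutoffDeriv ε x : ℂ) • jMat (Y x)) 2 volume :=
    hu.of_le_mul (hc2.smul (jMat.continuous.comp h.continuous)).aestronglyMeasurable
      (Eventually.of_forall hbound)
  have hmem : (hu.toLp, hg.toLp + lam • hu.toLp) ∈ diracOp p q := by
    refine ⟨fun x => (cutoff ε x : ℂ) • Y x,
      fun s => (cutoffDeriv ε s : ℂ) • Y s + (cutoff ε s : ℂ) • V s, ?_, ?_, hu.coeFn_toLp, ?_⟩
    · intro x
      refine ⟨Icc (x - 1) (x + 1), Icc_mem_nhds (by linarith) (by linarith), ?_⟩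
      rw [← intervalIntegrable_iff_integrableOn_Icc_of_le (by linarith)]
      exact ((hc2.smul h.continuous).intervalIntegrable _ _).add
        ((h.integrable _ _).continuousOn_smul hc1.continuousOn)
    · exact h.mul_cutoff_eq ε
    · filter_upwards [Lp.coeFn_add hg.toLp (lam • hu.toLp), hg.coeFn_toLp,
        Lp.coeFn_smul lam hu.toLp, hu.coeFn_toLp, h.equation] with x h1 h2 h3 h4 h5
      rw [h1, Pi.add_apply, h2, h3, Pi.smul_apply, h4, diracExpr_eq, h5]
      simp only [map_add, map_sub, map_smul, jMat_jMat, smul_sub, smul_neg]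
      rw [smul_comm lam]
      abel
  have hRu := (hR _ _).2 hmem
  have hgu : ‖hg.toLp‖ ≤ ε * ‖hu.toLp‖ := by
    refine Lp.norm_le_mul_norm_of_ae_le_mul ?_
    filter_upwards [hg.coeFn_toLp, hu.coeFn_toLp] with x h1 h2
    rw [h1, h2]
    exact hbound x
  have hu0 : 0 < ‖hu.toLp‖ := by
    rw [norm_pos_iff]
    intro h0
    rw [Lp.eq_zero_iff_ae_eq_zero] at h0
    refine h.ne_zero ?_
    filter_upwards [h0, hu.coeFn_toLp] with x h1 h2
    rw [h1, Pi.zero_apply, eq_comm, smul_eq_zero] at h2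
    exact h2.resolve_left (Complex.ofReal_ne_zero.2 (cutoff_pos ε x).ne')
  have h1 := R.le_opNorm hg.toLp
  rw [hRu] at h1
  have h2 : ‖R‖ * ε < 1 := by
    rw [hε, ← div_eq_mul_inv, div_lt_one (by positivity)]
    linarith [norm_nonneg R]
  have h3 : ‖hu.toLp‖ ≤ ‖R‖ * ε * ‖hu.toLp‖ := by
    rw [mul_assoc]
    exact h1.trans (mul_le_mul_of_nonneg_left hgu (norm_nonneg R))
  nlinarith

/-- Extension of a function from `[0, π)` with the Floquet multiplier `exp(iπt)`. -/
noncomputable def floquetExtend (t : ℝ) (v : ℝ → Vec) (x : ℝ) : Vec :=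
  Complex.exp (Complex.I * t * (x - toIcoMod Real.pi_pos 0 x : ℝ)) • v (toIcoMod Real.pi_pos 0 x)

theorem floquetExtend_of_mem (t : ℝ) (v : ℝ → Vec) {x : ℝ} (hx : x ∈ Ico 0 Real.pi) :
    floquetExtend t v x = v x := by
  have : toIcoMod Real.pi_pos 0 x = x := (toIcoMod_eq_self Real.pi_pos).2 (by simpa using hx)
  simp [floquetExtend, this]

theorem floquetExtend_add_pi (t : ℝ) (v : ℝ → Vec) (x : ℝ) :
    floquetExtend t v (x + Real.pi) = multiplier t • floquetExtend t v x := by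
  rw [floquetExtend, floquetExtend, toIcoMod_add_right, smul_smul, multiplier, ← Complex.exp_add]
  congr 2
  push_cast
  ring

theorem intervalIntegrable_floquetExtend (t : ℝ) {v : ℝ → Vec}
    (hv : IntervalIntegrable v volume 0 Real.pi) (a b : ℝ) :
    IntervalIntegrable (floquetExtend t v) volume a b := by
  have hc : Continuous fun x : ℝ => Complex.exp (-(Complex.I * t * x)) := by fun_prop
  have hc' : Continuous fun x : ℝ => Complex.exp (Complex.I * t * x) := by fun_prop
  -- The Floquet form: the extension is `exp(itx)` times the `π`-periodic function `P`.
  let P : ℝ → Vec := fun x => Complex.exp (-(Complex.I * t * (toIcoMod Real.pi_pos 0 x : ℝ))) •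
    v (toIcoMod Real.pi_pos 0 x)
  have hP : Function.Periodic P Real.pi := fun x => by simp only [P, toIcoMod_add_right]
  have hP0 : IntervalIntegrable P volume 0 Real.pi := by
    have h := hv.continuousOn_smul hc.continuousOn
    rw [intervalIntegrable_iff_integrableOn_Ico_of_le Real.pi_pos.le] at h ⊢
    refine h.congr_fun (fun x hx => ?_) measurableSet_Ico
    have : toIcoMod Real.pi_pos 0 x = x := (toIcoMod_eq_self Real.pi_pos).2 (by simpa using hx)
    simp only [P, this]
  have hPab : IntervalIntegrable P volume a b :=
    hP.intervalIntegrable₀ Real.pi_pos.ne' hP0 a b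
  refine (hPab.continuousOn_smul hc'.continuousOn).congr fun x _ => ?_
  simp only [P, floquetExtend, smul_smul, ← Complex.exp_add]
  congr 2
  push_cast
  ring

/-- The exceptional set on the line is covered by countably many translates of a null set. -/
theorem ae_of_periodic {P : ℝ → Prop} (hper : ∀ x, P (x + Real.pi) ↔ P x)
    (h : ∀ᵐ x ∂periodMeasure, P x) : ∀ᵐ x, P x := by
  rw [ae_restrict_iff' measurableSet_Icc] at h
  have hk (k : ℤ) : ∀ᵐ x : ℝ, x - k * Real.pi ∈ Icc 0 Real.pi → P (x - k * Real.pi) :=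
    (measurePreserving_sub_right volume (k * Real.pi)).quasiMeasurePreserving.ae h
  filter_upwards [ae_all_iff.2 hk] with x hx
  have hpr : Function.Periodic P Real.pi := fun x => propext (hper x)
  have h1 := hx (toIcoDiv Real.pi_pos 0 x)
  rw [← zsmul_eq_mul] at h1
  have h2 := toIcoMod_mem_Ico' Real.pi_pos x
  have h3 := h1 ⟨h2.1, h2.2.le⟩
  rwa [hpr.sub_zsmul_eq] at h3

variable {p q : ℝ → ℂ} (hp : MemLp p ∞ periodMeasure) (hq : MemLp q ∞ periodMeasure)

theorem exists_isFloquetSolution (hpp : Function.Periodic p Real.pi)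
    (hqp : Function.Periodic q Real.pi) {lam : ℂ} {t : ℝ}
    (h : discriminant hp hq lam = (2 * Real.cos (Real.pi * t) : ℝ)) :
    ∃ Y V, IsFloquetSolution p q lam Y V := by
  obtain ⟨f, hf, y, v, hv, hy, hb, hfy, hfv⟩ := (isEigenvalue_iff hp hq t lam).2 h
  simp only at hfy hfv
  set V := floquetExtend t v with hV
  have hVi := intervalIntegrable_floquetExtend t hv
  -- Only the derivative is extended quasi-periodically; `Y` is its primitive, so no gluing at
  -- multiples of `π` is needed. The boundary condition on `y` then makes `Y` quasi-periodic.
  set Y : ℝ → Vec := fun x => y 0 + ∫ s in (0 : ℝ)..x, V s with hY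
  have hVv : V =ᵐ[periodMeasure] v := by
    rw [periodMeasure, ← Measure.restrict_congr_set Ico_ae_eq_Icc]
    filter_upwards [ae_restrict_mem measurableSet_Ico] with x hx
    exact floquetExtend_of_mem t v hx
  have hYy : ∀ x ∈ Icc 0 Real.pi, Y x = y x := fun x hx => by
    rw [hy x hx, hY]
    simp only
    rw [integral_congr_period hVv hx]
  have hY0 : Y 0 = y 0 := hYy 0 (left_mem_Icc.2 Real.pi_pos.le)
  have hYper : ∀ x, Y (x + Real.pi) = multiplier t • Y x := by
    intro x
    have h1 : ∫ s in (0 : ℝ)..(x + Real.pi), V s =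
        (∫ s in (0 : ℝ)..Real.pi, V s) + multiplier t • ∫ s in (0 : ℝ)..x, V s := by
      rw [← intervalIntegral.integral_add_adjacent_intervals (hVi 0 Real.pi) (hVi _ _),
        ← intervalIntegral.integral_smul]
      congr 1
      have := intervalIntegral.integral_comp_add_right (a := 0) (b := x) V Real.pi
      rw [zero_add] at this
      rw [← this]
      exact intervalIntegral.integral_congr fun s _ => floquetExtend_add_pi t v s
    have h2 : Y Real.pi = multiplier t • y 0 := (hYy _ (right_mem_Icc.2 Real.pi_pos.le)).trans hb
    simp only [hY] at h2 ⊢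
    rw [h1, ← add_assoc, h2, smul_add]
  have hYc : Continuous Y := continuous_const.add (intervalIntegral.continuous_primitive hVi 0)
  refine ⟨Y, V, hVi, fun x => by rw [hY0], ?_, ?_, ?_⟩
  · refine ae_of_periodic (fun x => ?_) ?_
    · have h1 : potential p q (x + Real.pi) = potential p q x := by
        rw [potential, potential, hpp, hqp]
      have h2 : V (x + Real.pi) = multiplier t • V x := floquetExtend_add_pi t v x
      rw [h1, hYper, h2]
      simp only [map_smul]
      rw [smul_comm lam, ← smul_sub]
      exact (smul_right_injective _ (multiplier_ne_zero t)).eq_iff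
    · filter_upwards [hVv, hfy, hfv, Lp.coeFn_smul lam f, ae_restrict_mem measurableSet_Icc]
        with x h1 h2 h3 h4 h5
      rw [hYy x h5, h1, ← map_smul, ← h2, ← Pi.smul_apply, ← h4]
      rw [← h2] at h3
      exact (eq_diracExpr_iff p q x _ _ _).1 h3
  · obtain ⟨B, hB⟩ := isCompact_Icc.exists_bound_of_continuousOn
      (hYc.continuousOn (s := Icc 0 Real.pi))
    refine ⟨B, fun x => ?_⟩
    have hper : Function.Periodic (fun x => ‖Y x‖) Real.pi := fun x => by
      simp only [hYper, norm_smul, norm_multiplier, one_mul]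
    obtain ⟨x', hx', he⟩ := hper.exists_mem_Ico₀ Real.pi_pos x
    exact he.trans_le (hB x' ⟨hx'.1, hx'.2.le⟩)
  · intro h0
    refine hf ?_
    rw [Lp.eq_zero_iff_ae_eq_zero]
    filter_upwards [ae_restrict_of_ae h0, hfy, ae_restrict_mem measurableSet_Icc] with x h1 h2 h3
    rw [h2, ← hYy x h3, h1]

end Line

/-! ### The three assertions -/

theorem corollary1 (p q : ℝ → ℂ)
    (hp : Function.Periodic p Real.pi) (hq : Function.Periodic q Real.pi)
    (hpBV : BoundedVariationOn p (Icc 0 Real.pi))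
    (hqBV : BoundedVariationOn q (Icc 0 Real.pi)) :
    {lam : ℂ | IsSpectralSingularity p q lam} ⊆
        {lam : ℂ | ∃ t ∈ Ioc (-1 : ℝ) 1, IsMultipleEigenvalue (blochOp p q t) lam} ∧
      {lam : ℂ | IsEssentialSpectralSingularity p q lam} ⊆
        {lam : ℂ | IsSpectralSingularity p q lam} ∧
      ∀ lam : ℂ, IsEssentialSpectralSingularity p q lam →
        IsMultipleEigenvalue (blochOp p q 0) lam ∨ IsMultipleEigenvalue (blochOp p q 1) lam := by
  have hp' := memLp_top_of_boundedVariationOn hpBV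
  have hq' := memLp_top_of_boundedVariationOn hqBV
  refine ⟨fun lam h => isMultipleEigenvalue_of_isSpectralSingularity hp' hq' h, fun lam h => ?_,
    fun lam h => ?_⟩
  · obtain ⟨t₀, μ, hb⟩ := h.exists_branch hp' hq'
    obtain ⟨Y, V, hY⟩ := exists_isFloquetSolution hp' hq' hp hq hb.discriminant_value
    exact ⟨hY.mem_opSpectrum, fun ε hε => exists_contours hp' hq' (hb.exists_large hε)⟩
  · obtain ⟨t₀, μ, hb⟩ := h.exists_branch hp' hq'
    exact hb.isMultipleEigenvalue
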